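/- **Setting.** Let $Y$ be a compact Hausdorff space with a finite open cover $(F_i)_{i\in A}$. For nonempty $I\subset A$ put $F_I=\bigcap_{i\in I}F_i$, and let $\mathcal I_Y$ be the set of nonempty $I\subset A$ with $F_I\neq\emptyset$. Let $\mathcal K=(W_I,\Gamma_I,\psi_I,\rho_{IJ})$ be an oriented strict orbifold atlas of dimension $d$ on $Y$ with footprints $F_I$. This means the following. * The $W_I$ ($I\in\mathcal I_Y$) are oriented smooth $d$-manifolds (Hausdorff, second countable, not necessarily connected). The $\Gamma_i$ are finite groups, and $\Gamma_I=\prod_{i\in I}\Gamma_i$ acts on $W_I$ by orientation preserving diffeomorphisms; for $|I|>1$ and $i\in I$ the subgroup $\Gamma_{I\setminus\{i\}}$ acts freely. Each $\psi_I:W_I\to Y$ factors through a homeomorphism $W_I/\Gamma_I\to F_I$. * For $I\subset J$ the map $\rho_{IJ}:W_J\to W_I$ is an orientation preserving local diffeomorphism, equivariant with respect to the projection $\Gamma_J\to\Gamma_I$, with image $\psi_I^{-1}(F_J)$ and with the $\Gamma_{J\setminus I}$-orbits as fibres. Moreover $\rho_{JJ}=\mathrm{id}$, $\psi_I\circ\rho_{IJ}=\psi_J$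 and $\rho_{IJ}\circ\rho_{JL}=\rho_{IL}$. Let $\mathbf G_{\mathcal K}$ be its groupoid completion: its objects are $\bigsqcup_I W_I$, and its morphisms from $W_I$ to $W_J$ are $W_{I\cup J}\times\Gamma_{I\cap J}$ for $I\cup J\in\mathcal I_Y$ (none otherwise; $\Gamma_\emptyset=1$). The morphism $(z,\gamma)$ has source $(I,\gamma^{-1}\rho_{I,I\cup J}(z))$, target $(J,\rho_{J,I\cup J}(z))$ and inverse $(\gamma^{-1}z,\gamma^{-1})$. The composite $W_I\to W_J\to W_L$ of $(z,\gamma)$ and $(w,\delta)$ is $(\rho_{I\cup L,I\cup J\cup L}(v),\alpha\,\delta'\gamma')$. Here $\gamma',\delta'$ are the components of $\gamma,\delta$ in $\Gamma_{I\cap J\cap L}$, and $(v,\alpha)\in W_{I\cup J\cup L}\times\Gamma_{(I\cap L)\setminus J}$ is the unique pair with $\rho_{I\cup J,I\cup J\cup L}(v)=\gamma_0^{-1}\alpha\delta z$ and $\rho_{J\cup L,I\cup J\cup L}(v)=\gamma_0^{-1}w$, where $\gamma_0$ is the component of $\gamma$ in $\Gamma_{(I\cap J)\setminus L}$. Let $(Q_I)_{I\in\mathcal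 I_Y}$ be a cover reduction: the $Q_I\subset Y$ are open, $\overline{Q_I}$ is compact and contained in $F_I$, $\bigcup_I Q_I=Y$, and $\overline{Q_I}\cap\overline{Q_J}\neq\emptyset$ implies $I\subset J$ or $J\subset I$. Put $V_I=\psi_I^{-1}(Q_I)$ and, for $I\subset J$, $\widetilde V_{IJ}=V_J\cap\psi_J^{-1}(Q_I)$. Let $\mathbf V_{\mathcal K}$ have objects $\bigsqcup_I V_I$. Its morphisms from $V_I$ to $V_J$ are $\bigcup_{\emptyset\ne L\subset I}(\widetilde V_{LJ}\cap\widetilde V_{IJ})\times\Gamma_{I\setminus L}$ if $I\subset J$ (that is, those $(z,\gamma)$ in $\mathbf G_{\mathcal K}$ with target point $\rho_{J,I\cup J}(z)$ in $\widetilde V_{LJ}\cap\widetilde V_{IJ}$ and $\gamma\in\Gamma_{I\setminus L}$ for some $L$), the inverses of the morphisms from $V_J$ to $V_I$ if $J\subsetneq I$, and none otherwise. Let $\mathbf G_{\mathcal V}$ be the full subcategory of $\mathbf G_{\mathcal K}$ with objects $\bigsqcup_I V_I$. For a topological groupoid $\mathbf G$ let $|\mathbf G|$ be its realization (the quotient of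 the object space by the relation that a morphism exists) and $|\mathbf G|_{\mathcal H}$ the maximal Hausdorff quotient of $|\mathbf G|$. Write $\pi$ for the projection from objects to $|\mathbf G|$ and $\pi^{\mathcal H}$ for that to $|\mathbf G|_{\mathcal H}$. A *weighted nonsingular branched (wnb) groupoid* is an oriented étale groupoid $\mathbf G$ with at most one morphism between any two objects, together with a function $\Lambda:|\mathbf G|_{\mathcal H}\to\mathbb Q\cap(0,\infty)$ such that each $p\in|\mathbf G|_{\mathcal H}$ has an open neighbourhood $N$, finitely many disjoint open subsets $U_1,\dots,U_\ell$ of $(\pi^{\mathcal H})^{-1}(N)$, and positive rational weights $m_1,\dots,m_\ell$ with the following properties: * the preimage of $N$ in $|\mathbf G|$ is $\bigcup_i\pi(U_i)$; * each $\pi^{\mathcal H}|_{U_i}$ is a homeomorphism onto a relatively closed subset of $N$; * $\Lambda(q)=\sum_{i:\,q\in\pi^{\mathcal H}(U_i)}m_i$ for all $q\in N$. **Proposition.** 1. $\mathbf V_{\mathcal K}$ is a well defined subgroupoid of $\mathbf G_{\mathcal K}$ (its morphisms contain the identities and are closed under composition and inversion), and it is nonsingular: there is at most one morphism between any two objects.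 With the orientation induced from the $W_I$ it is an oriented étale groupoid of dimension $d$. 2. The closure of $\mathrm{Mor}_{\mathbf V_{\mathcal K}}$ in $\mathrm{Mor}_{\mathbf G_{\mathcal V}}$ is the space of morphisms of a topological groupoid $\mathbf V^{\mathcal H}_{\mathcal K}$ with the same objects $\bigsqcup_I V_I$ and with the structural maps of $\mathbf G_{\mathcal K}$. The source and target maps of $\mathbf G_{\mathcal K}$ are étale, and all structural maps of $\mathbf V^{\mathcal H}_{\mathcal K}$ are locally homeomorphisms onto their images. The identity on objects induces a homeomorphism $|\mathbf V_{\mathcal K}|_{\mathcal H}\cong|\mathbf V^{\mathcal H}_{\mathcal K}|$. 3. There is a function $\Lambda_V:|\mathbf V_{\mathcal K}|_{\mathcal H}\to\mathbb Q\cap(0,\infty)$ such that $(\mathbf V_{\mathcal K},\Lambda_V)$ is a wnb groupoid and, for all $J$ and $y\in\pi^{\mathcal H}(V_J)$, $$\Lambda_V(y)=\frac{n(y)}{|\Gamma_J|},\qquad n(y)=\#\{x\in V_J\mid\pi^{\mathcal H}(x)=y\}<\infty .$$ Moreover the set $\{I\in\mathcal I_Y\mid I\subset J,\ y\in\overline{\pi^{\mathcal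 H}(V_I)}\}$ has a least element $I_y$, and $V_J\cap(\pi^{\mathcal H})^{-1}(y)$ is a free $\Gamma_{J\setminus I_y}$-orbit. 4. The inclusion $\mathbf V_{\mathcal K}\to\mathbf G_{\mathcal V}$ extends to an inclusion $\mathbf V^{\mathcal H}_{\mathcal K}\to\mathbf G_{\mathcal V}$. The induced map $|\iota|:|\mathbf V^{\mathcal H}_{\mathcal K}|\to|\mathbf G_{\mathcal V}|$ is continuous. Let $|\psi|:|\mathbf G_{\mathcal V}|\to Y$ be induced by the $\psi_I$. Then the pushforward of $\Lambda_V$ by $|\psi|\circ|\iota|:|\mathbf V_{\mathcal K}|_{\mathcal H}=|\mathbf V^{\mathcal H}_{\mathcal K}|\to Y$ is $\Lambda_Y$: for every $q\in Y$ the fibre over $q$ is finite and $$\sum_{p\,:\,|\psi|(|\iota|(p))=q}\Lambda_V(p)=\Lambda_Y(q)=\frac1{|\Gamma^x|},$$ where $\Gamma^x$ is the group of morphisms from $x$ to $x$ in $\mathbf G_{\mathcal K}$, for any object $x$ of $\mathbf G_{\mathcal K}$ over $q$. -/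

import Mathlib

open Set Topology
open scoped Manifold ContDiff

universe uA uY uG uW

/-! ### Disjoint unions of manifolds, orientations -/

/-- The disjoint union of a family of charted spaces: its charts are the charts of the summands. -/
noncomputable instance sigmaChartedSpace {H : Type*} [TopologicalSpace H] [Nonempty H]
    {ι : Type*} {M : ι → Type*} [∀ i, TopologicalSpace (M i)] [∀ i, ChartedSpace H (M i)] :
    ChartedSpace H (Σ i, M i) where
  atlas := {e | ∃ (i : ι) (e' : OpenPartialHomeomorph (M i) H), e' ∈ atlas H (M i) ∧
    e = e'.lift_openEmbedding (IsOpenEmbedding.sigmaMk (i := i))}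
  chartAt x := (chartAt H x.2).lift_openEmbedding (IsOpenEmbedding.sigmaMk (i := x.1))
  mem_chart_source x := ⟨x.2, mem_chart_source H x.2, rfl⟩
  chart_mem_atlas x := ⟨x.1, chartAt H x.2, chart_mem_atlas H x.2, rfl⟩

/-- `f` is a smooth local diffeomorphism of `d`-dimensional manifolds (an étale map). -/
def IsEtale (d : ℕ) {M N : Type*} [TopologicalSpace M] [TopologicalSpace N]
    [ChartedSpace (EuclideanSpace ℝ (Fin d)) M] [ChartedSpace (EuclideanSpace ℝ (Fin d)) N]
    (f : M → N) : Prop :=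
  IsLocalDiffeomorph (𝓡 d) (𝓡 d) ∞ f

/-- The linear map `L` is an isomorphism that carries the orientation `o` to `o'`. -/
def MapsOrientation {d : ℕ} {T T' : Type*} [AddCommGroup T] [Module ℝ T] [TopologicalSpace T]
    [AddCommGroup T'] [Module ℝ T'] [TopologicalSpace T'] (L : T →L[ℝ] T')
    (o : Orientation ℝ T (Fin d)) (o' : Orientation ℝ T' (Fin d)) : Prop :=
  ∃ e : T ≃ₗ[ℝ] T', (∀ v, e v = L v) ∧ Orientation.map (Fin d) e o = o'

/-- A choice of an orientation of each tangent space. -/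
abbrev OrientationField (d : ℕ) (M : Type*) [TopologicalSpace M]
    [ChartedSpace (EuclideanSpace ℝ (Fin d)) M] :=
  ∀ x : M, Orientation ℝ (TangentSpace (𝓡 d) x) (Fin d)

/-- An orientation field is continuous (that is, an orientation of the manifold)
if in every preferred chart it is constant near the base point of that chart. -/
def OrientationField.IsContinuous {d : ℕ} {M : Type*} [TopologicalSpace M]
    [ChartedSpace (EuclideanSpace ℝ (Fin d)) M] (o : OrientationField d M) : Prop :=
  ∀ x₀ : M, ∃ o' : Orientation ℝ (EuclideanSpace ℝ (Fin d)) (Fin d), ∀ᶠ x in 𝓝 x₀,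
    MapsOrientation (T' := EuclideanSpace ℝ (Fin d))
      (mfderiv (𝓡 d) 𝓘(ℝ, EuclideanSpace ℝ (Fin d)) (extChartAt (𝓡 d) x₀) x) (o x) o'

/-- The differential of `f` carries the orientation of the source to that of the target. -/
def PreservesOrientation {d : ℕ} {M N : Type*} [TopologicalSpace M] [TopologicalSpace N]
    [ChartedSpace (EuclideanSpace ℝ (Fin d)) M] [ChartedSpace (EuclideanSpace ℝ (Fin d)) N]
    (o : OrientationField d M) (o' : OrientationField d N) (f : M → N) : Prop :=
  ∀ x, MapsOrientation (mfderiv (𝓡 d) (𝓡 d) f x) (o x) (o' (f x))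

/-- Every point has a neighbourhood on which `f` is a homeomorphism onto its image. -/
def IsLocallyEmbedding {X Z : Type*} [TopologicalSpace X] [TopologicalSpace Z]
    (f : X → Z) : Prop :=
  ∀ x, ∃ U : Set X, IsOpen U ∧ x ∈ U ∧ IsEmbedding (U.domRestrict f)

/-! ### Topological, étale and weighted nonsingular branched groupoids -/

/-- A topological groupoid with objects `O` and morphisms `M`;
`comp f g` is the composite `src f ⟶ tgt f = src g ⟶ tgt g`. -/
structure TopologicalGroupoid (O M : Type*) [TopologicalSpace O] [TopologicalSpace M] where
  src : M → O
  tgt : M → O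
  one : O → M
  inv : M → M
  comp : ∀ f g : M, tgt f = src g → M
  src_one : ∀ x, src (one x) = x
  tgt_one : ∀ x, tgt (one x) = x
  src_inv : ∀ f, src (inv f) = tgt f
  tgt_inv : ∀ f, tgt (inv f) = src f
  src_comp : ∀ f g h, src (comp f g h) = src f
  tgt_comp : ∀ f g h, tgt (comp f g h) = tgt g
  one_comp : ∀ f, comp (one (src f)) f (tgt_one _) = f
  comp_one : ∀ f, comp f (one (tgt f)) (src_one _).symm = f
  comp_inv : ∀ f, comp f (inv f) (src_inv f).symm = one (src f)
  inv_comp : ∀ f, comp (inv f) f (tgt_inv f) = one (tgt f)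
  assoc : ∀ f g k (h : tgt f = src g) (h' : tgt g = src k),
    comp (comp f g h) k ((tgt_comp f g h).trans h') =
      comp f (comp g k h') (h.trans (src_comp g k h').symm)
  continuous_src : Continuous src
  continuous_tgt : Continuous tgt
  continuous_one : Continuous one
  continuous_inv : Continuous inv
  continuous_comp : Continuous
    (fun p : {p : M × M // tgt p.1 = src p.2} => comp p.1.1 p.1.2 p.2)

namespace TopologicalGroupoid

variable {O M : Type*} [TopologicalSpace O] [TopologicalSpace M] (𝒢 : TopologicalGroupoid O M)

/-- Two objects are equivalent if there is a morphism between them. -/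
def setoid : Setoid O where
  r x y := ∃ f, 𝒢.src f = x ∧ 𝒢.tgt f = y
  iseqv :=
    { refl := fun x => ⟨𝒢.one x, 𝒢.src_one x, 𝒢.tgt_one x⟩
      symm := by
        rintro _ _ ⟨f, rfl, rfl⟩
        exact ⟨𝒢.inv f, 𝒢.src_inv f, 𝒢.tgt_inv f⟩
      trans := by
        rintro _ _ _ ⟨f, rfl, rfl⟩ ⟨g, h, rfl⟩
        exact ⟨𝒢.comp f g h.symm, 𝒢.src_comp _ _ _, 𝒢.tgt_comp _ _ _⟩ }

/-- The realization `|𝒢|`, with the quotient topology. -/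
abbrev Realization := Quotient 𝒢.setoid

/-- The projection `Obj → |𝒢|`. -/
def proj (x : O) : 𝒢.Realization := Quotient.mk 𝒢.setoid x

/-- The maximal Hausdorff quotient `|𝒢|_H` of the realization. -/
abbrev HausdorffRealization := T2Quotient 𝒢.Realization

/-- The projection `Obj → |𝒢|_H`. -/
def projH (x : O) : 𝒢.HausdorffRealization := T2Quotient.mk (𝒢.proj x)

/-- There is at most one morphism between any two objects. -/
def Nonsingular : Prop := ∀ f g, 𝒢.src f = 𝒢.src g → 𝒢.tgt f = 𝒢.tgt g → f = g

end TopologicalGroupoid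

/-- An oriented étale groupoid of dimension `d`: objects and morphisms are oriented smooth
`d`-manifolds (Hausdorff and paracompact), and all structural maps are orientation preserving
local diffeomorphisms.

For the composition this is expressed in local parametrizations `u ↦ (u, φ u)` of the space of
composable pairs, in which composition is the local diffeomorphism `χ`. It preserves
orientations because `src (comp f g) = src f`, and so do `src` and the first projection. -/
structure OrientedEtaleGroupoid (d : ℕ) (O M : Type*) [TopologicalSpace O] [TopologicalSpace M]
    [ChartedSpace (EuclideanSpace ℝ (Fin d)) O] [ChartedSpace (EuclideanSpace ℝ (Fin d)) M]
    extends TopologicalGroupoid O M where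
  t2_obj : T2Space O
  t2_mor : T2Space M
  paracompact_obj : ParacompactSpace O
  paracompact_mor : ParacompactSpace M
  manifold_obj : IsManifold (𝓡 d) ∞ O
  manifold_mor : IsManifold (𝓡 d) ∞ M
  etale_src : IsEtale d src
  etale_tgt : IsEtale d tgt
  etale_one : IsEtale d one
  etale_inv : IsEtale d inv
  etale_comp : ∀ f g, tgt f = src g → ∃ φ χ : PartialDiffeomorph (𝓡 d) (𝓡 d) M M ∞,
    f ∈ φ.source ∧ f ∈ χ.source ∧ φ f = g ∧
      ∀ u ∈ φ.source ∩ χ.source, ∃ h : tgt u = src (φ u), χ u = comp u (φ u) h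
  orientObj : OrientationField d O
  orientMor : OrientationField d M
  continuous_orientObj : orientObj.IsContinuous
  continuous_orientMor : orientMor.IsContinuous
  orient_src : PreservesOrientation orientMor orientObj src
  orient_tgt : PreservesOrientation orientMor orientObj tgt
  orient_one : PreservesOrientation orientObj orientMor one
  orient_inv : PreservesOrientation orientMor orientMor inv

open Classical in
/-- `(𝒢, Λ)` is a weighted nonsingular branched groupoid. In the local data, `N` is the
neighbourhood, `U i` are the local branches and `m i` their weights. -/
structure OrientedEtaleGroupoid.IsWnb {d : ℕ} {O M : Type*} [TopologicalSpace O]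
    [TopologicalSpace M] [ChartedSpace (EuclideanSpace ℝ (Fin d)) O]
    [ChartedSpace (EuclideanSpace ℝ (Fin d)) M] (𝒢 : OrientedEtaleGroupoid d O M)
    (Λ : 𝒢.HausdorffRealization → ℚ) : Prop where
  nonsingular : 𝒢.Nonsingular
  pos : ∀ p, 0 < Λ p
  branches : ∀ p, ∃ N : Set 𝒢.HausdorffRealization, IsOpen N ∧ p ∈ N ∧
    ∃ (l : ℕ) (U : Fin l → Set O) (m : Fin l → ℚ),
      (∀ i, IsOpen (U i)) ∧ (∀ i, U i ⊆ 𝒢.projH ⁻¹' N) ∧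
      (∀ i j, i ≠ j → Disjoint (U i) (U j)) ∧ (∀ i, 0 < m i) ∧
      -- Covering
      T2Quotient.mk ⁻¹' N = (⋃ i, 𝒢.proj '' U i) ∧
      -- Local regularity
      (∀ i, IsEmbedding ((U i).domRestrict 𝒢.projH) ∧
        ∃ C, IsClosed C ∧ 𝒢.projH '' U i = C ∩ N) ∧
      -- Weighting
      ∀ q ∈ N, Λ q = ∑ i with q ∈ 𝒢.projH '' U i, m i

/-- The pushforward of a weighting function: `(f_* Λ)(z)` is the sum of `Λ` over the fibre
of `f` at `z`. -/
noncomputable def pushforwardWeight {X Z : Type*} (f : X → Z) (Λ : X → ℚ) (z : Z) : ℚ :=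
  ∑ᶠ x ∈ f ⁻¹' {z}, Λ x

/-! ### Orbifold atlases -/

/-- The set of finite nonempty `I` with `F_I = ⋂_{i ∈ I} F_i ≠ ∅`, ordered by inclusion. -/
abbrev FootprintIndex {A : Type uA} {Y : Type uY} (F : A → Set Y) :=
  {I : Finset A // I.Nonempty ∧ (⋂ i ∈ I, F i).Nonempty}

/-- The product group `Γ_I = ∏_{i ∈ I} Γ_i`. -/
abbrev ProdGroup {A : Type uA} (Γ : A → Type uG) (I : Finset A) := ∀ i : I, Γ i

/-- The homomorphism `Γ_I → Γ_J` that keeps the components with index in `I ∩ J` and fills in `1`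
elsewhere: the projection `Γ_I → Γ_J` if `J ⊆ I`, the inclusion if `I ⊆ J`. -/
def ProdGroup.tr {A : Type uA} [DecidableEq A] {Γ : A → Type uG} [∀ i, Group (Γ i)]
    {I : Finset A} (J : Finset A) (γ : ProdGroup Γ I) : ProdGroup Γ J :=
  fun j => if h : j.1 ∈ I then γ ⟨j.1, h⟩ else 1

section tr

variable {A : Type uA} [DecidableEq A] {Γ : A → Type uG} [∀ i, Group (Γ i)] {I : Finset A}

lemma ProdGroup.tr_apply (J : Finset A) (γ : ProdGroup Γ I) (j : J) :
    γ.tr J j = if h : j.1 ∈ I then γ ⟨j.1, h⟩ else 1 := rfl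

lemma ProdGroup.tr_mul (J : Finset A) (γ δ : ProdGroup Γ I) :
    (γ * δ).tr J = γ.tr J * δ.tr J := by
  funext j
  simp only [tr_apply, Pi.mul_apply]
  split_ifs <;> simp

lemma ProdGroup.tr_inv (J : Finset A) (γ : ProdGroup Γ I) : (γ⁻¹).tr J = (γ.tr J)⁻¹ := by
  funext j
  simp only [tr_apply, Pi.inv_apply]
  split_ifs <;> simp

end tr

/-- `γ ∈ Γ_J` lies in the subgroup `Γ_{J ∖ I}`. -/
def ProdGroup.TrivialOn {A : Type uA} {Γ : A → Type uG} [∀ i, Group (Γ i)]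
    {J : Finset A} (I : Finset A) (γ : ProdGroup Γ J) : Prop :=
  ∀ j : J, j.1 ∈ I → γ j = 1

/-- A strict orbifold atlas of dimension `d` on `Y`, with a finite open cover `(F_i)_{i ∈ A}`.
The chart domains `W_I` are smooth `d`-manifolds, not necessarily connected. -/
structure OrbifoldAtlas (d : ℕ) (A : Type uA) [DecidableEq A] (Y : Type uY)
    [TopologicalSpace Y] where
  F : A → Set Y
  isOpen_F : ∀ i, IsOpen (F i)
  cover_F : ⋃ i, F i = univ
  Γ : A → Type uG
  [group : ∀ i, Group (Γ i)]
  [finite : ∀ i, Finite (Γ i)]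
  W : FootprintIndex F → Type uW
  [top : ∀ I, TopologicalSpace (W I)]
  [charted : ∀ I, ChartedSpace (EuclideanSpace ℝ (Fin d)) (W I)]
  [manifold : ∀ I, IsManifold (𝓡 d) ∞ (W I)]
  [t2 : ∀ I, T2Space (W I)]
  [secondCountable : ∀ I, SecondCountableTopology (W I)]
  [action : ∀ I, MulAction (ProdGroup Γ I.1) (W I)]
  smooth_action : ∀ I (γ : ProdGroup Γ I.1),
    ContMDiff (𝓡 d) (𝓡 d) ∞ (fun x : W I => γ • x)
  /-- the footprint maps -/
  ψ : ∀ I, W I → Y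
  /-- `ψ I` factors through a homeomorphism from `W_I / Γ_I` onto `F_I` -/
  footprint : ∀ I, ∃ e : Quotient (MulAction.orbitRel (ProdGroup Γ I.1) (W I)) ≃ₜ
      (⋂ i ∈ I.1, F i : Set Y),
    ∀ x, (e (Quotient.mk _ x) : Y) = ψ I x
  /-- `Γ_{I ∖ i}` acts freely if `|I| > 1` -/
  free : ∀ I : FootprintIndex F, 1 < I.1.card → ∀ i ∈ I.1, ∀ γ : ProdGroup Γ I.1,
    γ.TrivialOn {i} → ∀ x : W I, γ • x = x → γ = 1
  /-- `ρ_{IJ} : W_J → W_I` for `I ⊆ J` -/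
  ρ : ∀ {I J : FootprintIndex F}, I ≤ J → W J → W I
  etale_ρ : ∀ {I J} (h : I ≤ J), IsEtale d (ρ h)
  ρ_self : ∀ {J} (h : J ≤ J) (x : W J), ρ h x = x
  equivariant_ρ : ∀ {I J} (h : I ≤ J) (γ : ProdGroup Γ J.1) (x : W J),
    ρ h (γ • x) = γ.tr I.1 • ρ h x
  /-- `ρ_{IJ}` is a map onto `W_{IJ} = ψ_I⁻¹(F_J)`, and its fibres are the `Γ_{J ∖ I}`-orbits. As it
  is a local diffeomorphism, it induces a diffeomorphism from `W_J / Γ_{J ∖ I}` to `W_{IJ}`. -/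
  range_ρ : ∀ {I J} (h : I ≤ J), range (ρ h) = ψ I ⁻¹' (⋂ i ∈ J.1, F i)
  ρ_eq_iff : ∀ {I J} (h : I ≤ J) (x y : W J),
    ρ h x = ρ h y ↔ ∃ γ : ProdGroup Γ J.1, γ.TrivialOn I.1 ∧ γ • x = y
  ψ_ρ : ∀ {I J} (h : I ≤ J) (x : W J), ψ I (ρ h x) = ψ J x
  ρ_ρ : ∀ {I J L} (h : I ≤ J) (h' : J ≤ L) (x : W L), ρ h (ρ h' x) = ρ (h.trans h') x

/-- An atlas on an oriented orbifold: the chart domains are oriented, and the group actions and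
coordinate changes preserve the orientations. -/
structure OrientedOrbifoldAtlas (d : ℕ) (A : Type uA) [DecidableEq A] (Y : Type uY)
    [TopologicalSpace Y] extends OrbifoldAtlas.{uA, uY, uG, uW} d A Y where
  orient : ∀ I, OrientationField d (W I)
  continuous_orient : ∀ I, (orient I).IsContinuous
  orient_action : ∀ I (γ : ProdGroup Γ I.1),
    PreservesOrientation (orient I) (orient I) (fun x : W I => γ • x)
  orient_ρ : ∀ {I J} (h : I ≤ J), PreservesOrientation (orient J) (orient I) (ρ h)

namespace OrbifoldAtlas

attribute [instance] group finite top charted manifold t2 secondCountable action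

variable {d : ℕ} {A : Type uA} [DecidableEq A] {Y : Type uY} [TopologicalSpace Y]
  (K : OrbifoldAtlas.{uA, uY, uG, uW} d A Y)

/-- The index set `I_Y` of the atlas. -/
abbrev Index := FootprintIndex K.F

/-- The space of objects `⨆_I W_I`. -/
abbrev Obj := Σ I : K.Index, K.W I

/-- The footprint map on objects. -/
def footprintMap (x : K.Obj) : Y := K.ψ x.1 x.2

lemma ψ_mem (I : K.Index) (x : K.W I) : K.ψ I x ∈ ⋂ i ∈ I.1, K.F i := by
  obtain ⟨e, he⟩ := K.footprint I
  rw [← he]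
  exact (e _).2

lemma continuous_ψ (I : K.Index) : Continuous (K.ψ I) := by
  obtain ⟨e, he⟩ := K.footprint I
  have : K.ψ I = fun x => ((e (Quotient.mk _ x) : (⋂ i ∈ I.1, K.F i : Set Y)) : Y) := by
    funext x; exact (he x).symm
  rw [this]
  exact continuous_subtype_val.comp (e.continuous.comp continuous_quotient_mk')

lemma continuous_footprintMap : Continuous K.footprintMap :=
  continuous_sigma fun I => K.continuous_ψ I

lemma ψ_smul (I : K.Index) (γ : ProdGroup K.Γ I.1) (x : K.W I) : K.ψ I (γ • x) = K.ψ I x := by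
  obtain ⟨e, he⟩ := K.footprint I
  rw [← he, ← he]
  congr 2
  exact Quotient.sound ⟨γ, rfl⟩

lemma continuous_smul (I : K.Index) (γ : ProdGroup K.Γ I.1) :
    Continuous (fun x : K.W I => γ • x) := (K.smooth_action I γ).continuous

lemma continuous_ρ {I J : K.Index} (h : I ≤ J) : Continuous (K.ρ h) :=
  (IsLocalDiffeomorph.isLocalHomeomorph (K.etale_ρ h)).continuous

/-- The components of the space of morphisms of the groupoid completion: pairs `I, J` with
`I ∪ J ∈ I_Y` together with an element of `Γ_{I ∩ J}`. -/
structure MorIndex where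
  i : K.Index
  j : K.Index
  nonempty : (⋂ a ∈ i.1 ∪ j.1, K.F a).Nonempty
  γ : ProdGroup K.Γ (i.1 ∩ j.1)

/-- The index `I ∪ J`. -/
def MorIndex.union {K : OrbifoldAtlas.{uA, uY, uG, uW} d A Y} (m : K.MorIndex) : K.Index :=
  ⟨m.i.1 ∪ m.j.1, m.i.2.1.mono Finset.subset_union_left, m.nonempty⟩

lemma MorIndex.le_i {K : OrbifoldAtlas.{uA, uY, uG, uW} d A Y} (m : K.MorIndex) :
    m.i ≤ m.union := Finset.subset_union_left (s₁ := m.i.1) (s₂ := m.j.1)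

lemma MorIndex.le_j {K : OrbifoldAtlas.{uA, uY, uG, uW} d A Y} (m : K.MorIndex) :
    m.j ≤ m.union := Finset.subset_union_right (s₁ := m.i.1) (s₂ := m.j.1)

/-- The space of morphisms `⨆_{I,J} W_{I ∪ J} × Γ_{I ∩ J}` of the groupoid completion, where the
finite groups `Γ_{I ∩ J}` are discrete. -/
abbrev Mor := Σ m : K.MorIndex, K.W m.union

variable {K}

/-- The source `(I, γ⁻¹ ρ_{I, I ∪ J}(z))` of `(z, γ) ∈ W_{I ∪ J} × Γ_{I ∩ J}`. -/
def src (f : K.Mor) : K.Obj := ⟨f.1.i, (f.1.γ.tr f.1.i.1)⁻¹ • K.ρ f.1.le_i f.2⟩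

/-- The target `(J, ρ_{J, I ∪ J}(z))` of `(z, γ) ∈ W_{I ∪ J} × Γ_{I ∩ J}`. -/
def tgt (f : K.Mor) : K.Obj := ⟨f.1.j, K.ρ f.1.le_j f.2⟩

/-- The identity morphism `(x, 1) ∈ W_{I ∪ I} × Γ_{I ∩ I}` at `(I, x)`; the map `ρ` between
`W_I` and `W_{I ∪ I}` is the identity. -/
def one (x : K.Obj) : K.Mor :=
  let m : K.MorIndex := ⟨x.1, x.1, by simpa using x.1.2.2, 1⟩
  ⟨m, K.ρ (I := m.union) (J := x.1) (Finset.union_subset subset_rfl subset_rfl) x.2⟩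

/-- The inverse `(γ⁻¹ z, γ⁻¹)` of `(z, γ)`; the map `ρ` between `W_{I ∪ J}` and `W_{J ∪ I}` is
the identity. -/
def inv (f : K.Mor) : K.Mor :=
  let m : K.MorIndex :=
    ⟨f.1.j, f.1.i, by rw [Finset.union_comm]; exact f.1.nonempty, (f.1.γ⁻¹).tr _⟩
  ⟨m, K.ρ (I := m.union) (J := f.1.union) (Finset.union_comm f.1.j.1 f.1.i.1).subset
    ((f.1.γ.tr f.1.union.1)⁻¹ • f.2)⟩

lemma footprintMap_src (f : K.Mor) : K.footprintMap (src f) = K.ψ f.1.union f.2 := by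
  simp [footprintMap, src, K.ψ_smul, K.ψ_ρ]

lemma footprintMap_tgt (f : K.Mor) : K.footprintMap (tgt f) = K.ψ f.1.union f.2 := by
  simp [footprintMap, tgt, K.ψ_ρ]

lemma triple_nonempty {f g : K.Mor} (h : tgt f = src g) :
    (⋂ a ∈ f.1.union.1 ∪ g.1.j.1, K.F a).Nonempty := by
  refine ⟨K.ψ f.1.union f.2, ?_⟩
  have h1 := K.ψ_mem f.1.union f.2
  have h2 := K.ψ_mem g.1.union g.2
  rw [← footprintMap_src, ← h, footprintMap_tgt] at h2
  simp only [mem_iInter] at h1 h2 ⊢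
  intro a ha
  rcases Finset.mem_union.1 ha with ha | ha
  · exact h1 a ha
  · exact h2 a (g.1.le_j ha)

/-- The index `I ∪ J ∪ L` for a composable pair of morphisms `W_I → W_J → W_L`. -/
def triple {f g : K.Mor} (h : tgt f = src g) : K.Index :=
  ⟨f.1.union.1 ∪ g.1.j.1, f.1.union.2.1.mono Finset.subset_union_left, triple_nonempty h⟩

lemma le_triple_left {f g : K.Mor} (h : tgt f = src g) : f.1.union ≤ triple h :=
  Finset.subset_union_left (s₁ := f.1.union.1) (s₂ := g.1.j.1)

lemma idx_eq {f g : K.Mor} (h : tgt f = src g) : f.1.j = g.1.i := congrArg Sigma.fst h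

lemma le_triple_right {f g : K.Mor} (h : tgt f = src g) : g.1.union ≤ triple h := by
  have h1 : g.1.i ≤ triple h := (idx_eq h) ▸ f.1.le_j.trans (le_triple_left h)
  exact Finset.union_subset h1 (Finset.subset_union_right (s₁ := f.1.union.1) (s₂ := g.1.j.1))

/-- For `f = (z, γ) : W_I → W_J` and `g = (w, δ) : W_J → W_L`, the condition on a pair
`(v, α) ∈ W_{I ∪ J ∪ L} × Γ_{(I ∩ L) ∖ J}` that
`ρ_{I ∪ J, I ∪ J ∪ L}(v) = γ₀⁻¹ α δ z` and `ρ_{J ∪ L, I ∪ J ∪ L}(v) = γ₀⁻¹ w`,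
where `γ₀` is the part of `γ` in `Γ_{(I ∩ J) ∖ L}`. -/
def IsLift {f g : K.Mor} (h : tgt f = src g)
    (p : K.W (triple h) × ProdGroup K.Γ ((f.1.i.1 ∩ g.1.j.1) \ f.1.j.1)) : Prop :=
  let γ₀ : ProdGroup K.Γ ((f.1.i.1 ∩ f.1.j.1) \ g.1.j.1) := f.1.γ.tr _
  K.ρ (le_triple_left h) p.1 =
      (γ₀.tr f.1.union.1)⁻¹ • p.2.tr f.1.union.1 • g.1.γ.tr f.1.union.1 • f.2 ∧
    K.ρ (le_triple_right h) p.1 = (γ₀.tr g.1.union.1)⁻¹ • g.2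

lemma free_of_trivialOn {I J : K.Index} (h : I ≤ J) (γ : ProdGroup K.Γ J.1)
    (hγ : γ.TrivialOn I.1) (x : K.W J) (hx : γ • x = x) : γ = 1 := by
  obtain ⟨i, hi⟩ := I.2.1
  have hiJ : i ∈ J.1 := h hi
  by_cases hc : 1 < J.1.card
  · refine K.free J hc i hiJ γ (fun j hj => hγ j ?_) x hx
    rwa [Finset.mem_singleton.1 hj]
  · funext j
    have : j.1 = i := Finset.card_le_one.1 (not_lt.1 hc) _ j.2 _ hiJ
    exact hγ j (this ▸ hi)

lemma ψ_mem_triple {f g : K.Mor} (h : tgt f = src g) :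
    K.ψ g.1.union g.2 ∈ ⋂ a ∈ (triple h).1, K.F a := by
  have h1 := K.ψ_mem f.1.union f.2
  have h2 := K.ψ_mem g.1.union g.2
  rw [← footprintMap_tgt, h, footprintMap_src] at h1
  simp only [mem_iInter] at h1 h2 ⊢
  intro a ha
  rcases Finset.mem_union.1 ha with ha | ha
  · exact h1 a ha
  · exact h2 a (g.1.le_j ha)

/-- For every composable pair there is exactly one pair `(v, α)` as in `IsLift`. -/
lemma existsUnique_isLift {f g : K.Mor} (h : tgt f = src g) : ∃! p, IsLift h p := by
  have hψ := ψ_mem_triple h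
  obtain ⟨⟨i, j, hn, γ⟩, z⟩ := f
  obtain ⟨⟨j', l, hn', δ⟩, w⟩ := g
  obtain rfl : j = j' := idx_eq h
  let mf : K.MorIndex := ⟨i, j, hn, γ⟩
  let mg : K.MorIndex := ⟨j, l, hn', δ⟩
  let T := triple h
  have hTf : mf.union ≤ T := le_triple_left h
  have hTg : mg.union ≤ T := le_triple_right h
  have hz : K.ρ mf.le_j z = (δ.tr j.1)⁻¹ • K.ρ mg.le_i w := eq_of_heq (Sigma.mk.inj h).2
  have hz' : K.ρ mf.le_j (δ.tr mf.union.1 • z) = K.ρ mg.le_i w := by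
    rw [K.equivariant_ρ, hz, smul_smul]
    have htr : (δ.tr mf.union.1).tr j.1 = δ.tr j.1 := by
      funext a
      have ha : a.1 ∈ mf.union.1 := mf.le_j a.2
      simp only [ProdGroup.tr_apply]
      rw [dif_pos ha]
    change ((δ.tr mf.union.1).tr j.1 * (δ.tr j.1)⁻¹) • _ = _
    rw [htr, mul_inv_cancel, one_smul]
  let γ₀ : ProdGroup K.Γ ((i.1 ∩ j.1) \ l.1) := γ.tr _
  refine existsUnique_of_exists_of_unique ?_ ?_
  · have hw : w ∈ range (K.ρ hTg) := by
      rw [K.range_ρ]; exact hψ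
    obtain ⟨v, hv⟩ := hw
    have h1 : K.ρ mf.le_j (δ.tr mf.union.1 • z) = K.ρ mf.le_j (K.ρ hTf v) := by
      rw [hz', ← hv, K.ρ_ρ, K.ρ_ρ]
    obtain ⟨β, hβ, hβz⟩ := (K.ρ_eq_iff _ _ _).1 h1
    let β₁ : ProdGroup K.Γ (mf.union.1 \ mg.union.1) := β.tr _
    refine ⟨⟨(γ₀.tr T.1)⁻¹ • (β₁.tr T.1)⁻¹ • v, β.tr _⟩, ?_, ?_⟩
    · change K.ρ hTf ((γ₀.tr T.1)⁻¹ • (β₁.tr T.1)⁻¹ • v) =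
        (γ₀.tr mf.union.1)⁻¹ •
          (β.tr ((i.1 ∩ l.1) \ j.1) : ProdGroup K.Γ _).tr mf.union.1 • δ.tr mf.union.1 • z
      rw [K.equivariant_ρ, K.equivariant_ρ, ← hβz, smul_smul, smul_smul _ β, smul_smul (_⁻¹)]
      congr 1
      funext a
      have ha : a.1 ∈ i.1 ∨ a.1 ∈ j.1 := Finset.mem_union.1 a.2
      have hβa : a.1 ∈ j.1 → β a = 1 := hβ a
      have haT : a.1 ∈ T.1 := hTf a.2
      have ha' := a.2
      simp only [ProdGroup.tr_apply, Pi.mul_apply, Pi.inv_apply, γ₀, β₁]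
      simp only [MorIndex.union, mf, mg, Finset.mem_sdiff, Finset.mem_union,
        Finset.mem_inter] at *
      by_cases h1 : a.1 ∈ i.1 <;> by_cases h2 : a.1 ∈ j.1 <;> by_cases h3 : a.1 ∈ l.1 <;>
        simp_all <;> first | rfl | exact inv_mul_cancel _
    · change K.ρ hTg ((γ₀.tr T.1)⁻¹ • (β₁.tr T.1)⁻¹ • v) = (γ₀.tr mg.union.1)⁻¹ • w
      rw [K.equivariant_ρ, K.equivariant_ρ, hv, smul_smul]
      congr 1
      funext a
      have ha' := a.2
      have haT : a.1 ∈ T.1 := hTg a.2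
      simp only [ProdGroup.tr_apply, Pi.mul_apply, Pi.inv_apply, γ₀, β₁]
      simp only [MorIndex.union, mf, mg, Finset.mem_sdiff, Finset.mem_union,
        Finset.mem_inter] at *
      by_cases h1 : a.1 ∈ i.1 <;> by_cases h2 : a.1 ∈ j.1 <;> by_cases h3 : a.1 ∈ l.1 <;>
        simp_all
  · rintro ⟨v, α⟩ ⟨v', α'⟩ ⟨h1, h2⟩ ⟨h1', h2'⟩
    change ProdGroup K.Γ ((i.1 ∩ l.1) \ j.1) at α α'
    change K.W T at v v'
    change K.ρ hTf v = (γ₀.tr mf.union.1)⁻¹ • α.tr mf.union.1 • δ.tr mf.union.1 • z at h1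
    change K.ρ hTf v' = (γ₀.tr mf.union.1)⁻¹ • α'.tr mf.union.1 • δ.tr mf.union.1 • z at h1'
    obtain ⟨β, hβ, hβv⟩ := (K.ρ_eq_iff hTg v v').1 (h2.trans h2'.symm)
    rw [← hβv, K.equivariant_ρ, h1] at h1'
    set zz := δ.tr mf.union.1 • z
    set a₁ : ProdGroup K.Γ mf.union.1 := α.tr mf.union.1 with ha₁
    set a₂ : ProdGroup K.Γ mf.union.1 := α'.tr mf.union.1 with ha₂
    set c : ProdGroup K.Γ mf.union.1 := γ₀.tr mf.union.1 with hc
    set b : ProdGroup K.Γ mf.union.1 := β.tr mf.union.1 with hb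
    have hβ' : ∀ a (ha : a ∈ T.1), (a ∈ j.1 ∨ a ∈ l.1) → β ⟨a, ha⟩ = 1 :=
      fun a ha h => hβ ⟨a, ha⟩ (Finset.mem_union.2 h)
    have hone : (c⁻¹ * a₂)⁻¹ * (b * (c⁻¹ * a₁)) = 1 := by
      refine free_of_trivialOn mf.le_j _ ?_ zz ?_
      · intro a ha
        change a.1 ∈ j.1 at ha
        have haT : a.1 ∈ T.1 := hTf a.2
        simp [a₁, a₂, c, b, ProdGroup.tr_apply, ha, haT, hβ']
      · rw [mul_smul, inv_smul_eq_iff, mul_smul, mul_smul, mul_smul]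
        exact h1'
    have hcomp : ∀ a, (c a)⁻¹ * a₂ a = b a * ((c a)⁻¹ * a₁ a) := fun a =>
      congrFun (inv_mul_eq_one.1 hone) a
    have hα : α = α' := by
      funext a
      have ha := a.2
      simp only [Finset.mem_sdiff, Finset.mem_inter] at ha
      have haf : a.1 ∈ mf.union.1 := mf.le_i ha.1.1
      have haT : a.1 ∈ T.1 := hTf haf
      have := hcomp ⟨a.1, haf⟩
      simp [a₁, a₂, c, b, ProdGroup.tr_apply, ha, haT, hβ'] at this
      exact this.symm
    have hβ1 : β = 1 := by
      funext a
      by_cases hal : a.1 ∈ j.1 ∨ a.1 ∈ l.1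
      · exact hβ' _ _ hal
      · have haf : a.1 ∈ mf.union.1 := by
          have : a.1 ∈ mf.union.1 ∪ l.1 := a.2
          rcases Finset.mem_union.1 this with h | h
          · exact h
          · exact absurd (Or.inr h) hal
        have := hcomp ⟨a.1, haf⟩
        rw [not_or] at hal
        simp [a₁, a₂, c, b, ProdGroup.tr_apply, hal] at this
        exact this.symm
    rw [hβ1, one_smul] at hβv
    exact Prod.ext hβv hα

/-- The composite `W_I → W_J → W_L` of `f = (z, γ)` and `g = (w, δ)`: it is the pair
`(ρ_{I ∪ L, I ∪ J ∪ L}(v), α δ' γ') ∈ W_{I ∪ L} × Γ_{I ∩ L}`, where `(v, α)` is the unique pair as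
in `IsLift`, and `γ'`, `δ'` are the parts of `γ`, `δ` in `Γ_{I ∩ J ∩ L}`. -/
noncomputable def comp (f g : K.Mor) (h : tgt f = src g) : K.Mor :=
  let p := (existsUnique_isLift h).choose
  have hle : f.1.i.1 ∪ g.1.j.1 ⊆ (triple h).1 :=
    Finset.union_subset (f.1.le_i.trans (le_triple_left h))
      (g.1.le_j.trans (le_triple_right h))
  let m : K.MorIndex :=
    ⟨f.1.i, g.1.j, (triple h).2.2.mono (biInter_subset_biInter_left fun _ ha => hle ha),
      p.2.tr _ * g.1.γ.tr _ * f.1.γ.tr _⟩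
  ⟨m, K.ρ (I := m.union) (J := triple h) hle p.1⟩

lemma continuous_tgt : Continuous (tgt : K.Mor → K.Obj) :=
  continuous_sigma fun m => continuous_sigmaMk.comp (K.continuous_ρ m.le_j)

lemma continuous_inv : Continuous (inv : K.Mor → K.Mor) :=
  continuous_sigma fun m => by
    have h : Continuous fun z : K.W m.union => (m.γ.tr m.union.1)⁻¹ • z :=
      K.continuous_smul m.union _
    let m' : K.MorIndex :=
      ⟨m.j, m.i, by rw [Finset.union_comm]; exact m.nonempty, (m.γ⁻¹).tr _⟩
    have h' : m'.union ≤ m.union := (Finset.union_comm m.j.1 m.i.1).subset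
    exact (continuous_sigmaMk (σ := fun m : K.MorIndex => K.W m.union) (i := m')).comp
      ((K.continuous_ρ h').comp h)

/-- `Λ_Y` at the point of `Y` represented by the object `x`: one over the order of the stabilizer
of `x` in the groupoid completion. -/
noncomputable def weight (x : K.Obj) : ℚ :=
  1 / (Nat.card {f : K.Mor // src f = x ∧ tgt f = x} : ℚ)

/-- A groupoid with objects `O` and morphisms `M` that are mapped to those of the groupoid
completion by injections `ι` and `κ`, compatibly with all structural maps. -/
structure IsSubgroupoid {O M : Type*} [TopologicalSpace O] [TopologicalSpace M]
    (𝒢 : TopologicalGroupoid O M) (ι : O → K.Obj) (κ : M → K.Mor) : Prop where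
  injective_obj : Function.Injective ι
  injective_mor : Function.Injective κ
  map_src : ∀ f, ι (𝒢.src f) = src (κ f)
  map_tgt : ∀ f, ι (𝒢.tgt f) = tgt (κ f)
  map_one : ∀ x, κ (𝒢.one x) = one (ι x)
  map_inv : ∀ f, κ (𝒢.inv f) = inv (κ f)
  map_comp : ∀ f g h h', κ (𝒢.comp f g h) = comp (κ f) (κ g) h'

variable (K) in
/-- A cover reduction of the footprint cover of the atlas. -/
structure Reduction where
  Q : K.Index → Set Y
  isOpen_Q : ∀ I, IsOpen (Q I)
  isCompact_closure : ∀ I, IsCompact (closure (Q I))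
  closure_subset : ∀ I, closure (Q I) ⊆ ⋂ i ∈ I.1, K.F i
  cover : ⋃ I, Q I = univ
  comparable : ∀ I J, (closure (Q I) ∩ closure (Q J)).Nonempty → I ≤ J ∨ J ≤ I

namespace Reduction

variable (R : K.Reduction)

/-- `V_I = ψ_I⁻¹(Q_I)` -/
def V (I : K.Index) : Set (K.W I) := K.ψ I ⁻¹' R.Q I

/-- `Ṽ_{IJ} = V_J ∩ ψ_J⁻¹(Q_I)`, a subset of `W_J` -/
def Vt (I J : K.Index) : Set (K.W J) := R.V J ∩ K.ψ J ⁻¹' R.Q I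

lemma isOpen_V (I : K.Index) : IsOpen (R.V I) := (R.isOpen_Q I).preimage (K.continuous_ψ I)

lemma isOpen_Vt (I J : K.Index) : IsOpen (R.Vt I J) :=
  (R.isOpen_V J).inter ((R.isOpen_Q I).preimage (K.continuous_ψ J))

/-- The objects `⨆_I V_I`. -/
def objV : TopologicalSpace.Opens K.Obj where
  carrier := {x | x.2 ∈ R.V x.1}
  is_open' := isOpen_sigma_iff.2 fun I => R.isOpen_V I

/-- The morphisms from `V_I` to `V_J` for `I ⊆ J`: the union over `∅ ≠ L ⊆ I` of
`(Ṽ_{LJ} ∩ Ṽ_{IJ}) × Γ_{I ∖ L}`. -/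
def directMor : Set K.Mor :=
  {f | f.1.i ≤ f.1.j ∧ ∃ L : K.Index, L ≤ f.1.i ∧
    K.ρ f.1.le_j f.2 ∈ R.Vt L f.1.j ∩ R.Vt f.1.i f.1.j ∧ f.1.γ.TrivialOn L.1}

lemma isOpen_directMor : IsOpen R.directMor := by
  refine isOpen_sigma_iff.2 fun m => ?_
  have : Sigma.mk m ⁻¹' R.directMor = ⋃ (L : K.Index) (_ : m.i ≤ m.j ∧ L ≤ m.i ∧
      m.γ.TrivialOn L.1), K.ρ m.le_j ⁻¹' (R.Vt L m.j ∩ R.Vt m.i m.j) := by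
    ext z
    simp only [directMor, mem_preimage, mem_ofPred_eq, mem_iUnion]
    constructor
    · rintro ⟨h1, L, h2, h3, h4⟩
      exact ⟨L, ⟨h1, h2, h4⟩, h3⟩
    · rintro ⟨L, ⟨h1, h2, h4⟩, h3⟩
      exact ⟨h1, L, h2, h3, h4⟩
  rw [this]
  exact isOpen_iUnion fun L => isOpen_iUnion fun _ =>
    ((R.isOpen_Vt L m.j).inter (R.isOpen_Vt m.i m.j)).preimage (K.continuous_ρ _)

/-- The morphisms of the groupoid `V_K`: those from `V_I` to `V_J` with `I ⊆ J` just described,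
and, if `J ⊊ I`, the inverses of the morphisms from `V_J` to `V_I`. -/
def morV : TopologicalSpace.Opens K.Mor where
  carrier := {f | f ∈ R.directMor ∨ (f.1.j < f.1.i ∧ inv f ∈ R.directMor)}
  is_open' := by
    refine R.isOpen_directMor.union (isOpen_sigma_iff.2 fun m => ?_)
    have h1 := isOpen_sigma_iff.1 (R.isOpen_directMor.preimage continuous_inv) m
    by_cases h : m.j < m.i
    · convert h1 using 1
      ext z
      exact and_iff_right h
    · convert isOpen_empty using 1
      ext z
      exact iff_of_false (fun hz => h hz.1) id

/-- The morphisms of the full subcategory `G_V` of the groupoid completion with objects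
`⨆_I V_I`. -/
def morGV : Set K.Mor := {f | src f ∈ R.objV ∧ tgt f ∈ R.objV}

/-- The closure of the morphisms of `V_K` in the space of morphisms of `G_V`. -/
def morVH : Set K.Mor := closure (R.morV : Set K.Mor) ∩ R.morGV

/-- The realization `|G_V|`. -/
def RealGV := Quot fun x y : R.objV => ∃ f ∈ R.morGV, src f = x.1 ∧ tgt f = y.1

instance : TopologicalSpace R.RealGV :=
  inferInstanceAs (TopologicalSpace (Quot _))

/-- The projection from objects to `|G_V|`. -/
def projGV (x : R.objV) : R.RealGV := Quot.mk _ x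

/-- The map `|ψ| : |G_V| → Y` induced by the footprint maps. -/
def realψ : R.RealGV → Y :=
  Quot.lift (fun x => K.footprintMap x.1) (by
    rintro x y ⟨f, -, hx, hy⟩
    rw [← hx, ← hy, footprintMap_src, footprintMap_tgt])

/-- The points of `V_J` that are mapped to `y` by a map `π` on the objects. -/
def fibre {Z : Type*} (π : R.objV → Z) (J : K.Index) (y : Z) : Set (K.W J) :=
  {x | ∃ hx : (⟨J, x⟩ : K.Obj) ∈ R.objV, π ⟨⟨J, x⟩, hx⟩ = y}

/-- The copy of `V_J` in the space of objects. -/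
def part (J : K.Index) : Set R.objV := {x | x.1.1 = J}

end Reduction

end OrbifoldAtlas

/-- The orientation of the space of objects `⨆_I W_I` given by those of the `W_I`. (The preferred
chart of the disjoint union at `(I, x)` is that of `W_I` at `x`, hence so is the tangent space.) -/
def OrientedOrbifoldAtlas.orientObj {d : ℕ} {A : Type uA} [DecidableEq A] {Y : Type uY}
    [TopologicalSpace Y] (K : OrientedOrbifoldAtlas.{uA, uY, uG, uW} d A Y) :
    OrientationField d K.Obj :=
  fun x => K.orient x.1 x.2

/-- All structural maps are locally homeomorphisms onto their images. -/
structure TopologicalGroupoid.IsLocallyEmbedded {O M : Type*} [TopologicalSpace O]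
    [TopologicalSpace M] (𝒢 : TopologicalGroupoid O M) : Prop where
  src : IsLocallyEmbedding 𝒢.src
  tgt : IsLocallyEmbedding 𝒢.tgt
  one : IsLocallyEmbedding 𝒢.one
  inv : IsLocallyEmbedding 𝒢.inv
  comp : IsLocallyEmbedding
    (fun p : {p : M × M // 𝒢.tgt p.1 = 𝒢.src p.2} => 𝒢.comp p.1.1 p.1.2 p.2)

/-! Everything is governed by one function on `Y`. The indices `L` with `q ∈ closure (Q L)` are
pairwise comparable, so there is a least one, `low q`. Near `q` the value of `low` can only grow,
because finitely many closed sets that miss `q` can be avoided (`exists_nhds_low_le`).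

A morphism of `V_K` over `q` has its group component trivial on some `L` with `q ∈ Q L`. A limit of
such morphisms has its component trivial on `low q`. Conversely, since the footprint maps are open,
each such morphism of `G_V` is a limit (`mem_morVH`). Elements trivial on a nonempty index act
freely, so these morphisms are determined by source and target (`eq_of_src_tgt`). This gives
nonsingularity, and all groupoid laws and continuity statements can be checked on endpoints
(`TopologicalGroupoid.ofIsEmbedding`). Étaleness and orientations follow from the corresponding
properties of source and target.

Inside one chart `W_J`, the closed groupoid identifies `u` with `γ u` for `γ` in `Γ_{J ∖ low}`
(`relH_iff`). These groups shrink near each point, so the largest saturated subset of an open set is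
open (`isOpen_core`), and saturated open subsets of `V_J` have open images in the realization.
Separating finite orbits then shows that the realization of the closed groupoid is Hausdorff
(`IsRealization.t2Space`). A continuous map from the objects to a Hausdorff space that identifies
the endpoints of morphisms of `V_K` also identifies those of their limits in `G_V`, so this
realization is the maximal Hausdorff quotient (`exists_homeomorph`).

Near `x ∈ V_J`, take a small open `O` disjoint from its translates by the nontrivial elements of `G
= Γ_{J ∖ low}`. The translates `γ O` are the local branches, each of weight `1 / |Γ_J|`, and the
number of branches through a point is the number of its representatives in `V_J`. A fibre in `V_J`
is a free `Γ_{J ∖ low}`-orbit, so the total weight is `1 / |Γ_low|`, which does not depend on `J`.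
Summing over the points above `q` counts all points of `W_J` over `q`; orbit-stabilizer turns this
into the reciprocal of the order of the isotropy group (`pushforwardWeight_eq`). -/

/-! ### Étale maps -/

section Etale

variable {d : ℕ} {M N P : Type*} [TopologicalSpace M] [TopologicalSpace N] [TopologicalSpace P]
  [ChartedSpace (EuclideanSpace ℝ (Fin d)) M] [ChartedSpace (EuclideanSpace ℝ (Fin d)) N]
  [ChartedSpace (EuclideanSpace ℝ (Fin d)) P]

/-- Charts of the maximal atlas as partial diffeomorphisms onto open subsets of the model. -/
noncomputable def OpenPartialHomeomorph.toPartialDiffeomorph [IsManifold (𝓡 d) ∞ M]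
    (e : OpenPartialHomeomorph M (EuclideanSpace ℝ (Fin d)))
    (he : e ∈ IsManifold.maximalAtlas (𝓡 d) ∞ M) :
    PartialDiffeomorph (𝓡 d) (𝓡 d) M (EuclideanSpace ℝ (Fin d)) ∞ where
  toPartialEquiv := e.toPartialEquiv
  open_source := e.open_source
  open_target := e.open_target
  contMDiffOn_toFun := contMDiffOn_of_mem_maximalAtlas he
  contMDiffOn_invFun := contMDiffOn_symm_of_mem_maximalAtlas he

/-- A map that is the identity in suitable charts is a local diffeomorphism. -/
lemma isLocalDiffeomorphAt_of_charts [IsManifold (𝓡 d) ∞ M] [IsManifold (𝓡 d) ∞ N]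
    {f : M → N} {x : M} {e : OpenPartialHomeomorph M (EuclideanSpace ℝ (Fin d))}
    {e' : OpenPartialHomeomorph N (EuclideanSpace ℝ (Fin d))}
    (he : e ∈ IsManifold.maximalAtlas (𝓡 d) ∞ M) (he' : e' ∈ IsManifold.maximalAtlas (𝓡 d) ∞ N)
    (hx : x ∈ e.source) (hf : MapsTo f e.source e'.source)
    (hff : ∀ y ∈ e.source, e' (f y) = e y) :
    IsLocalDiffeomorphAt (𝓡 d) (𝓡 d) ∞ f x := by
  refine ⟨(e.toPartialDiffeomorph he).trans (e'.toPartialDiffeomorph he').symm, ?_, ?_⟩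
  · refine ⟨hx, ?_⟩
    change e x ∈ e'.target
    rw [← hff x hx]
    exact e'.map_source (hf hx)
  · rintro y ⟨hy, -⟩
    change f y = e'.symm (e y)
    rw [← hff y hy, e'.left_inv (hf hy)]

instance sigmaIsManifold {ι : Type*} {M : ι → Type*} [∀ i, TopologicalSpace (M i)]
    [∀ i, ChartedSpace (EuclideanSpace ℝ (Fin d)) (M i)] [∀ i, IsManifold (𝓡 d) ∞ (M i)] :
    IsManifold (𝓡 d) ∞ (Σ i, M i) where
  compatible {e} e' he he' := by
    obtain ⟨i, f, hf, rfl⟩ := he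
    obtain ⟨j, f', hf', rfl⟩ := he'
    by_cases hij : i = j
    · subst hij
      rw [f.lift_openEmbedding_trans f' IsOpenEmbedding.sigmaMk]
      exact HasGroupoid.compatible hf hf'
    · apply ContDiffGroupoid.mem_of_source_eq_empty
      ext x
      refine ⟨fun ⟨_, hx₂⟩ ↦ ?_, fun hx ↦ hx.elim⟩
      obtain ⟨y, -, hy⟩ := hx₂
      exact hij (congrArg Sigma.fst hy).symm

lemma isEtale_sigmaMk {ι : Type*} {M : ι → Type*} [∀ i, TopologicalSpace (M i)]
    [∀ i, ChartedSpace (EuclideanSpace ℝ (Fin d)) (M i)] [∀ i, IsManifold (𝓡 d) ∞ (M i)] (i : ι) :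
    IsEtale d (Sigma.mk i : M i → Σ i, M i) := fun x => by
  refine isLocalDiffeomorphAt_of_charts (IsManifold.chart_mem_maximalAtlas x)
    (IsManifold.chart_mem_maximalAtlas (⟨i, x⟩ : Σ i, M i))
    (mem_chart_source _ x) (fun y hy => ⟨y, hy, rfl⟩) fun y _ => ?_
  exact OpenPartialHomeomorph.lift_openEmbedding_apply _ _

lemma isEtale_subtypeVal [IsManifold (𝓡 d) ∞ M] (U : TopologicalSpace.Opens M) :
    IsEtale d (Subtype.val : U → M) := fun x => by
  refine isLocalDiffeomorphAt_of_charts (IsManifold.chart_mem_maximalAtlas x)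
    (IsManifold.chart_mem_maximalAtlas x.1) (mem_chart_source _ x) (fun y hy => ?_) fun y _ => ?_
  · have := (TopologicalSpace.Opens.chartAt_eq (H := EuclideanSpace ℝ (Fin d)) (x := x)) ▸ hy
    simpa using this
  · rw [TopologicalSpace.Opens.chartAt_eq (H := EuclideanSpace ℝ (Fin d))]
    rfl

variable {f : M → N} {g : N → P} {x : M}

/-- The restriction of a partial diffeomorphism to an open set. -/
noncomputable def PartialDiffeomorph.restrOpen (Φ : PartialDiffeomorph (𝓡 d) (𝓡 d) M N ∞) (U : Set M)
    (hU : IsOpen U) : PartialDiffeomorph (𝓡 d) (𝓡 d) M N ∞ where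
  toPartialEquiv := (Φ.toOpenPartialHomeomorph.restrOpen U hU).toPartialEquiv
  open_source := (Φ.toOpenPartialHomeomorph.restrOpen U hU).open_source
  open_target := (Φ.toOpenPartialHomeomorph.restrOpen U hU).open_target
  contMDiffOn_toFun := Φ.contMDiffOn_toFun.mono inter_subset_left
  contMDiffOn_invFun := Φ.contMDiffOn_invFun.mono inter_subset_left

lemma IsLocalDiffeomorphAt.congr_of_eventuallyEq {f' : M → N}
    (hf : IsLocalDiffeomorphAt (𝓡 d) (𝓡 d) ∞ f x) (h : f' =ᶠ[𝓝 x] f) :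
    IsLocalDiffeomorphAt (𝓡 d) (𝓡 d) ∞ f' x := by
  obtain ⟨Φ, hx, hΦ⟩ := hf
  obtain ⟨U, hU, hUo, hxU⟩ := eventually_nhds_iff.1 h
  exact ⟨Φ.restrOpen U hUo, ⟨hx, hxU⟩, fun y hy => (hU y hy.2).trans (hΦ hy.1)⟩

/-- A continuous lift of a local diffeomorphism through a local diffeomorphism is one. -/
lemma IsLocalDiffeomorphAt.of_comp_left (hf : ContinuousAt f x)
    (hg : IsLocalDiffeomorphAt (𝓡 d) (𝓡 d) ∞ g (f x))
    (hgf : IsLocalDiffeomorphAt (𝓡 d) (𝓡 d) ∞ (g ∘ f) x) :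
    IsLocalDiffeomorphAt (𝓡 d) (𝓡 d) ∞ f x := by
  refine (hgf.comp (𝓡 d) N (g := hg.localInverse) hg.localInverse_isLocalDiffeomorphAt).congr_of_eventuallyEq
    ?_
  filter_upwards [hf.eventually hg.localInverse_eventuallyEq_left] with y hy
  exact hy.symm

/-- Near `f x`, the map `g` is `g ∘ f` precomposed with a local inverse of `f`. -/
lemma IsLocalDiffeomorphAt.of_comp_right (hf : IsLocalDiffeomorphAt (𝓡 d) (𝓡 d) ∞ f x)
    (hgf : IsLocalDiffeomorphAt (𝓡 d) (𝓡 d) ∞ (g ∘ f) x) :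
    IsLocalDiffeomorphAt (𝓡 d) (𝓡 d) ∞ g (f x) := by
  have hx : hf.localInverse (f x) = x := hf.localInverse_left_inv hf.localInverse_mem_target
  refine (hf.localInverse_isLocalDiffeomorphAt.comp (𝓡 d) P (g := g ∘ f)
    (by rw [hx]; exact hgf)).congr_of_eventuallyEq ?_
  filter_upwards [hf.localInverse_eventuallyEq_right] with y hy
  exact (congrArg g hy).symm

lemma IsEtale.continuous (hf : IsEtale d f) : Continuous f :=
  (IsLocalDiffeomorph.isLocalHomeomorph hf).continuous

lemma IsEtale.comp (hg : IsEtale d g) (hf : IsEtale d f) : IsEtale d (g ∘ f) :=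
  fun x => (hf x).comp (𝓡 d) P (hg _)

lemma IsEtale.of_comp_left (hf : Continuous f) (hg : IsEtale d g) (hgf : IsEtale d (g ∘ f)) :
    IsEtale d f :=
  fun x => .of_comp_left hf.continuousAt (hg _) (hgf x)

lemma isEtale_id : IsEtale d (id : M → M) :=
  (Diffeomorph.refl (𝓡 d) M ∞).isLocalDiffeomorph

lemma isEtale_sigma {ι : Type*} {M : ι → Type*} [∀ i, TopologicalSpace (M i)]
    [∀ i, ChartedSpace (EuclideanSpace ℝ (Fin d)) (M i)] [∀ i, IsManifold (𝓡 d) ∞ (M i)]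
    {f : (Σ i, M i) → N} (hf : ∀ i, IsEtale d (fun x => f ⟨i, x⟩)) : IsEtale d f :=
  fun x => .of_comp_right (f := Sigma.mk x.1) (isEtale_sigmaMk x.1 x.2) (hf x.1 x.2)

/-- Local inverses of étale maps: near `f x`, a continuous section. -/
lemma IsEtale.isLocalHomeomorph (hf : IsEtale d f) : IsLocalHomeomorph f :=
  IsLocalDiffeomorph.isLocalHomeomorph hf

end Etale

/-! ### Orientations -/

section MapsOrientation

variable {d : ℕ} {T T' T'' : Type*} [AddCommGroup T] [Module ℝ T] [AddCommGroup T'] [Module ℝ T']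
  [AddCommGroup T''] [Module ℝ T'']

lemma Orientation.map_map (e : T ≃ₗ[ℝ] T') (e' : T' ≃ₗ[ℝ] T'') (o : Orientation ℝ T (Fin d)) :
    Orientation.map (Fin d) e' (Orientation.map (Fin d) e o) =
      Orientation.map (Fin d) (e.trans e') o := by
  induction o using Module.Ray.ind with
  | h v hv => rfl

lemma Orientation.eq_map_symm_iff (e : T ≃ₗ[ℝ] T') (o : Orientation ℝ T (Fin d))
    (o' : Orientation ℝ T' (Fin d)) :
    o = Orientation.map (Fin d) e.symm o' ↔ Orientation.map (Fin d) e o = o' := by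
  rw [← Orientation.map_symm, Equiv.eq_symm_apply]

variable [TopologicalSpace T] [TopologicalSpace T'] [TopologicalSpace T'']
  {L : T →L[ℝ] T'} {L' : T' →L[ℝ] T''} {o : Orientation ℝ T (Fin d)}
  {o' : Orientation ℝ T' (Fin d)} {o'' : Orientation ℝ T'' (Fin d)}

lemma MapsOrientation.comp (h' : MapsOrientation L' o' o'') (h : MapsOrientation L o o') :
    MapsOrientation (L'.comp L) o o'' := by
  obtain ⟨e, he, rfl⟩ := h
  obtain ⟨e', he', rfl⟩ := h'
  exact ⟨e.trans e', fun v => by simp [he, he'], (Orientation.map_map _ _ _).symm⟩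

lemma MapsOrientation.of_comp_left (h' : MapsOrientation L' o' o'')
    (h : MapsOrientation (L'.comp L) o o'') : MapsOrientation L o o' := by
  obtain ⟨e, he, rfl⟩ := h
  obtain ⟨e', he', he''⟩ := h'
  refine ⟨e.trans e'.symm, fun v => ?_, ?_⟩
  · simp [LinearEquiv.symm_apply_eq, he, he']
  · rw [← Orientation.map_map]
    exact ((Orientation.eq_map_symm_iff _ _ _).2 he'').symm

lemma MapsOrientation.of_comp_right (h : MapsOrientation L o o')
    (h' : MapsOrientation (L'.comp L) o o'') : MapsOrientation L' o' o'' := by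
  obtain ⟨e, he, rfl⟩ := h
  obtain ⟨e', he', rfl⟩ := h'
  refine ⟨e.symm.trans e', fun v => ?_, ?_⟩
  · have := he (e.symm v)
    simp only [LinearEquiv.apply_symm_apply] at this
    simp [he', ← this]
  · rw [Orientation.map_map]
    congr 2
    ext v
    simp

lemma MapsOrientation.exists_source (h : ∃ e : T ≃ₗ[ℝ] T', ∀ v, e v = L v)
    (o' : Orientation ℝ T' (Fin d)) : ∃ o, MapsOrientation L o o' := by
  obtain ⟨e, he⟩ := h
  exact ⟨Orientation.map (Fin d) e.symm o', e, he, (Orientation.eq_map_symm_iff _ _ _).1 rfl⟩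

/-- The map `B ∘ A⁻¹` has positive determinant, hence fixes every orientation of the model space. -/
lemma MapsOrientation.of_det_pos {A B : EuclideanSpace ℝ (Fin d) →L[ℝ] EuclideanSpace ℝ (Fin d)}
    {o o' : Orientation ℝ (EuclideanSpace ℝ (Fin d)) (Fin d)} (hA : MapsOrientation A o o')
    (h : 0 < A.det * B.det) : MapsOrientation B o o' := by
  obtain ⟨e, he, rfl⟩ := hA
  have hB : IsUnit (LinearMap.det (B : EuclideanSpace ℝ (Fin d) →ₗ[ℝ] _)) :=
    IsUnit.mk0 _ fun h0 => by
      rw [ContinuousLinearMap.det, ContinuousLinearMap.det, h0, mul_zero] at h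
      exact lt_irrefl _ h
  let e' := LinearEquiv.ofIsUnitDet (M := EuclideanSpace ℝ (Fin d))
    (M' := EuclideanSpace ℝ (Fin d)) (v := Module.finBasis ℝ _) (v' := Module.finBasis ℝ _)
    (f := (B : EuclideanSpace ℝ (Fin d) →ₗ[ℝ] EuclideanSpace ℝ (Fin d)))
    (by rw [LinearMap.det_toMatrix]; exact hB)
  have he'B : ∀ v, e' v = B v := fun v => rfl
  refine ⟨e', he'B, ?_⟩
  have h1 : Orientation.map (Fin d) (e.symm.trans e') (Orientation.map (Fin d) e o) =
      Orientation.map (Fin d) e o := by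
    rw [Orientation.map_eq_iff_det_pos _ _ (by simp)]
    have hAe : A.det = LinearMap.det (e : EuclideanSpace ℝ (Fin d) →ₗ[ℝ] _) := by
      rw [ContinuousLinearMap.det]; congr 1; ext v; simp [he]
    have hBe : B.det = LinearMap.det (e' : EuclideanSpace ℝ (Fin d) →ₗ[ℝ] _) := by
      rw [ContinuousLinearMap.det]; congr 1
    have h2 : LinearMap.det ((e.symm.trans e' :
        EuclideanSpace ℝ (Fin d) ≃ₗ[ℝ] EuclideanSpace ℝ (Fin d)) :
          EuclideanSpace ℝ (Fin d) →ₗ[ℝ] _) * A.det = B.det := by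
      rw [hAe, hBe, ← LinearMap.det_comp]
      congr 1
      ext v
      simp
    rw [← h2] at h
    have h3 : A.det ≠ 0 := fun h0 => by simp [h0] at h
    have h4 : 0 < A.det * A.det := mul_self_pos.2 h3
    by_contra hneg
    nlinarith
  rw [Orientation.map_map] at h1
  rw [← h1]
  congr 2
  ext v
  simp

end MapsOrientation

/-! ### Orientation fields under étale maps -/

section OrientationField

variable {d : ℕ} {M N P : Type*} [TopologicalSpace M] [TopologicalSpace N] [TopologicalSpace P]
  [ChartedSpace (EuclideanSpace ℝ (Fin d)) M] [ChartedSpace (EuclideanSpace ℝ (Fin d)) N]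
  [ChartedSpace (EuclideanSpace ℝ (Fin d)) P] {f : M → N} {g : N → P} {x : M}

lemma IsLocalDiffeomorphAt.exists_equiv (hf : IsLocalDiffeomorphAt (𝓡 d) (𝓡 d) ∞ f x) :
    ∃ e : TangentSpace (𝓡 d) x ≃ₗ[ℝ] TangentSpace (𝓡 d) (f x),
      ∀ v, e v = mfderiv (𝓡 d) (𝓡 d) f x v :=
  ⟨(hf.mfderivToContinuousLinearEquiv (by simp)).toLinearEquiv, fun _ => rfl⟩

lemma IsLocalDiffeomorphAt.eventually (hf : IsLocalDiffeomorphAt (𝓡 d) (𝓡 d) ∞ f x) :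
    ∀ᶠ y in 𝓝 x, IsLocalDiffeomorphAt (𝓡 d) (𝓡 d) ∞ f y := by
  obtain ⟨Φ, hx, hΦ⟩ := hf
  filter_upwards [Φ.open_source.mem_nhds hx] with y hy
  exact ⟨Φ, hy, hΦ⟩

lemma IsEtale.mfderiv_comp (hg : IsEtale d g) (hf : IsEtale d f) (x : M) :
    mfderiv (𝓡 d) (𝓡 d) (g ∘ f) x =
      (mfderiv (𝓡 d) (𝓡 d) g (f x)).comp (mfderiv (𝓡 d) (𝓡 d) f x) :=
  _root_.mfderiv_comp x ((hg _).mdifferentiableAt (by simp)) ((hf x).mdifferentiableAt (by simp))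

variable {o : OrientationField d M} {o' : OrientationField d N} {o'' : OrientationField d P}

lemma PreservesOrientation.comp (hg : IsEtale d g) (hf : IsEtale d f)
    (h' : PreservesOrientation o' o'' g) (h : PreservesOrientation o o' f) :
    PreservesOrientation o o'' (g ∘ f) := fun x => by
  rw [hg.mfderiv_comp hf]
  exact (h' _).comp (h x)

lemma PreservesOrientation.of_comp_left (hg : IsEtale d g) (hf : IsEtale d f)
    (h' : PreservesOrientation o' o'' g) (h : PreservesOrientation o o'' (g ∘ f)) :
    PreservesOrientation o o' f := fun x => by
  have := h x
  rw [hg.mfderiv_comp hf] at this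
  exact (h' _).of_comp_left this

lemma preservesOrientation_id (o : OrientationField d M) :
    PreservesOrientation o o id := fun x => by
  refine ⟨LinearEquiv.refl ℝ _, fun v => ?_, ?_⟩
  · rw [mfderiv_id]; rfl
  · rw [Orientation.map_refl]; rfl

/-- The orientation field that makes an étale map orientation preserving. -/
noncomputable def OrientationField.pullback (o' : OrientationField d N) (hf : IsEtale d f) :
    OrientationField d M :=
  fun x => (MapsOrientation.exists_source (hf x).exists_equiv (o' (f x))).choose

lemma preservesOrientation_pullback (o' : OrientationField d N) (hf : IsEtale d f) :
    PreservesOrientation (o'.pullback hf) o' f :=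
  fun x => (MapsOrientation.exists_source (hf x).exists_equiv (o' (f x))).choose_spec

/-- `o` is constant near `x` in terms of the local diffeomorphism `h` to the model space. -/
def OrientationField.ConstantIn (o : OrientationField d M) (h : M → EuclideanSpace ℝ (Fin d))
    (x : M) : Prop :=
  ∃ o' : Orientation ℝ (EuclideanSpace ℝ (Fin d)) (Fin d), ∀ᶠ y in 𝓝 x,
    MapsOrientation (T' := EuclideanSpace ℝ (Fin d)) (mfderiv (𝓡 d) (𝓡 d) h y) (o y) o'

/-- The transition map from `h₁` to `h₂` is smooth, so the determinant of its derivative is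
continuous and keeps its sign near `x`. Local constancy therefore does not depend on the coordinates
in which it is tested. -/
lemma OrientationField.ConstantIn.congr {h₁ h₂ : M → EuclideanSpace ℝ (Fin d)}
    (hh₁ : IsLocalDiffeomorphAt (𝓡 d) (𝓡 d) ∞ h₁ x) (hh₂ : IsLocalDiffeomorphAt (𝓡 d) (𝓡 d) ∞ h₂ x)
    (h : o.ConstantIn h₂ x) : o.ConstantIn h₁ x := by
  obtain ⟨o₂, ho₂⟩ := h
  let g : EuclideanSpace ℝ (Fin d) → EuclideanSpace ℝ (Fin d) := h₂ ∘ hh₁.localInverse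
  have hx : hh₁.localInverse (h₁ x) = x := hh₁.localInverse_left_inv hh₁.localInverse_mem_target
  have hg : IsLocalDiffeomorphAt (𝓡 d) (𝓡 d) ∞ g (h₁ x) :=
    hh₁.localInverse_isLocalDiffeomorphAt.comp (𝓡 d) _ (by rw [hx]; exact hh₂)
  have hgh : h₂ =ᶠ[𝓝 x] g ∘ h₁ := by
    filter_upwards [hh₁.localInverse_eventuallyEq_left] with y hy
    exact (congrArg h₂ hy).symm
  let B : M → EuclideanSpace ℝ (Fin d) →L[ℝ] EuclideanSpace ℝ (Fin d) :=
    fun y => fderiv ℝ g (h₁ y)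
  have hB : ContinuousAt (fun y => (B y).det) x := by
    have h1 : ContDiffAt ℝ ∞ g (h₁ x) := hg.contMDiffAt.contDiffAt
    have h2 : ContinuousAt (fderiv ℝ g) (h₁ x) :=
      (h1.fderiv_right (m := 0) (by simp)).continuousAt
    exact ContinuousLinearMap.continuous_det.continuousAt.comp
      (h2.comp hh₁.contMDiffAt.continuousAt)
  have hder : ∀ᶠ y in 𝓝 x, (mfderiv (𝓡 d) (𝓡 d) h₂ y : _) =
      ContinuousLinearMap.comp (B y) (mfderiv (𝓡 d) (𝓡 d) h₁ y) := by
    filter_upwards [hgh.eventuallyEq_nhds, hh₁.eventually,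
      hh₁.contMDiffAt.continuousAt.eventually hg.eventually] with y hy h1 h2
    have h3 := hy.mfderiv_eq (I := 𝓡 d) (I' := 𝓡 d)
    refine h3.trans ?_
    rw [_root_.mfderiv_comp y (h2.mdifferentiableAt (by simp)) (h1.mdifferentiableAt (by simp)),
      mfderiv_eq_fderiv]
    rfl
  have hunit : ∃ e : EuclideanSpace ℝ (Fin d) ≃ₗ[ℝ] EuclideanSpace ℝ (Fin d),
      ∀ v, e v = B x v := by
    obtain ⟨e, he⟩ := hg.exists_equiv
    rw [mfderiv_eq_fderiv] at he
    exact ⟨e, he⟩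
  have hdet : (B x).det ≠ 0 := by
    obtain ⟨e, he⟩ := hunit
    have : (B x).det = LinearMap.det (e : EuclideanSpace ℝ (Fin d) →ₗ[ℝ] _) := by
      rw [ContinuousLinearMap.det]; congr 1; ext v; simp [he]
    rw [this]
    exact (LinearEquiv.isUnit_det' e).ne_zero
  -- The constant value in the new coordinates: the orientation that the derivative of the
  -- transition map at `x` itself carries to `o₂`.
  obtain ⟨o₁, ho₁⟩ := MapsOrientation.exists_source hunit o₂
  have hpos : ∀ᶠ y in 𝓝 x, 0 < (B x).det * (B y).det :=
    (continuousAt_const.mul hB).eventually (lt_mem_nhds (mul_self_pos.2 hdet))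
  refine ⟨o₁, ?_⟩
  filter_upwards [ho₂, hder, hpos] with y h2 h3 h4
  rw [h3] at h2
  exact (ho₁.of_det_pos h4).of_comp_left h2

lemma isLocalDiffeomorphAt_extChartAt [IsManifold (𝓡 d) ∞ M] (x : M) :
    IsLocalDiffeomorphAt (𝓡 d) (𝓡 d) ∞ (extChartAt (𝓡 d) x : M → EuclideanSpace ℝ (Fin d)) x :=
  ⟨(chartAt _ x).toPartialDiffeomorph (IsManifold.chart_mem_maximalAtlas x),
    mem_chart_source _ x, fun _ _ => rfl⟩

lemma OrientationField.isContinuous_iff [IsManifold (𝓡 d) ∞ M] :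
    o.IsContinuous ↔ ∀ x, ∀ h : M → EuclideanSpace ℝ (Fin d),
      IsLocalDiffeomorphAt (𝓡 d) (𝓡 d) ∞ h x → o.ConstantIn h x :=
  ⟨fun ho x _ hh => .congr hh (isLocalDiffeomorphAt_extChartAt x) (ho x),
    fun ho x => ho x _ (isLocalDiffeomorphAt_extChartAt x)⟩

lemma PreservesOrientation.constantIn_comp_iff (hf : IsEtale d f)
    (ho : PreservesOrientation o o' f) {h : N → EuclideanSpace ℝ (Fin d)}
    (hh : IsLocalDiffeomorphAt (𝓡 d) (𝓡 d) ∞ h (f x)) :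
    o.ConstantIn (h ∘ f) x ↔ o'.ConstantIn h (f x) := by
  refine exists_congr fun o₁ => ?_
  rw [← hf.isLocalHomeomorph.map_nhds_eq x, Filter.eventually_map]
  refine Filter.eventually_congr ?_
  filter_upwards [hf.continuous.continuousAt.eventually hh.eventually] with y hy
  have := _root_.mfderiv_comp y (hy.mdifferentiableAt (by simp))
    ((hf y).mdifferentiableAt (by simp))
  exact ⟨fun h => (ho y).of_comp_right (this ▸ h), fun h => this ▸ h.comp (ho y)⟩

lemma PreservesOrientation.isContinuous [IsManifold (𝓡 d) ∞ M] [IsManifold (𝓡 d) ∞ N]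
    (hf : IsEtale d f) (ho : PreservesOrientation o o' f) (ho' : o'.IsContinuous) :
    o.IsContinuous := fun x => by
  have h := isLocalDiffeomorphAt_extChartAt (d := d) (f x)
  exact OrientationField.ConstantIn.congr (isLocalDiffeomorphAt_extChartAt x) ((hf x).comp (𝓡 d) _ h)
    ((ho.constantIn_comp_iff hf h).2 (ho' (f x)))

end OrientationField

/-! ### Orientations of disjoint unions -/

section Sigma

variable {d : ℕ} {ι : Type*} {M : ι → Type*} [∀ i, TopologicalSpace (M i)]
  [∀ i, ChartedSpace (EuclideanSpace ℝ (Fin d)) (M i)] [∀ i, IsManifold (𝓡 d) ∞ (M i)]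

/-- The orientation field of a disjoint union. -/
def OrientationField.sigma (o : ∀ i, OrientationField d (M i)) : OrientationField d (Σ i, M i) :=
  fun x => o x.1 x.2

/-- The preferred charts of the disjoint union are those of the summands, so the inclusion is the
identity in charts. Both tangent spaces are the model space, which is why the right-hand side
typechecks. -/
lemma mfderiv_sigmaMk (i : ι) (x : M i) :
    mfderiv (𝓡 d) (𝓡 d) (Sigma.mk i : M i → Σ i, M i) x =
      ContinuousLinearMap.id ℝ (EuclideanSpace ℝ (Fin d)) := by
  rw [((isEtale_sigmaMk (d := d) (M := M) i x).mdifferentiableAt (by simp)).mfderiv]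
  rw [ModelWithCorners.range_eq_univ, fderivWithin_univ]
  have : writtenInExtChartAt (𝓡 d) (𝓡 d) x (Sigma.mk i : M i → Σ i, M i) =ᶠ[𝓝
      (extChartAt (𝓡 d) x x)] id := by
    filter_upwards [extChartAt_target_mem_nhds (I := 𝓡 d) x] with y hy
    refine (OpenPartialHomeomorph.lift_openEmbedding_apply _ (IsOpenEmbedding.sigmaMk)).trans ?_
    exact (extChartAt (𝓡 d) x).right_inv hy
  rw [this.fderiv_eq, fderiv_id]

lemma preservesOrientation_sigmaMk (o : ∀ i, OrientationField d (M i)) (i : ι) :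
    PreservesOrientation (o i) (OrientationField.sigma o) (Sigma.mk i) := fun x => by
  rw [mfderiv_sigmaMk]
  exact ⟨LinearEquiv.refl ℝ _, fun v => rfl, DFunLike.congr_fun
    (Orientation.map_refl (R := ℝ) (M := EuclideanSpace ℝ (Fin d)) (ι := Fin d)) (o i x)⟩

lemma OrientationField.isContinuous_sigma {o : ∀ i, OrientationField d (M i)}
    (ho : ∀ i, (o i).IsContinuous) : (OrientationField.sigma o).IsContinuous := by
  rintro ⟨i, x⟩
  have h := isLocalDiffeomorphAt_extChartAt (d := d) (⟨i, x⟩ : Σ i, M i)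
  exact ((preservesOrientation_sigmaMk o i).constantIn_comp_iff (isEtale_sigmaMk i) h).1
    (isContinuous_iff.1 (ho i) x _ ((isEtale_sigmaMk i x).comp (𝓡 d) _ h))

lemma preservesOrientation_sigma {N : Type*} [TopologicalSpace N]
    [ChartedSpace (EuclideanSpace ℝ (Fin d)) N] {o : ∀ i, OrientationField d (M i)}
    {o' : OrientationField d N} {f : (Σ i, M i) → N} (hf : IsEtale d f)
    (h : ∀ i, PreservesOrientation (o i) o' (fun x => f ⟨i, x⟩)) :
    PreservesOrientation (OrientationField.sigma o) o' f := by
  rintro ⟨i, x⟩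
  have h1 := h i x
  change MapsOrientation (mfderiv (𝓡 d) (𝓡 d) (f ∘ Sigma.mk i) x) _ _ at h1
  rw [hf.mfderiv_comp (isEtale_sigmaMk i)] at h1
  exact (preservesOrientation_sigmaMk o i x).of_comp_right h1

end Sigma

/-! ### Constructions of groupoids -/

section Topological

variable {O M : Type*} [TopologicalSpace O] [TopologicalSpace M]

/-- A nonsingular groupoid whose morphisms are embedded in the space of pairs of objects. -/
def TopologicalGroupoid.ofIsEmbedding (src tgt : M → O) (one : O → M) (inv : M → M)
    (comp : ∀ f g : M, tgt f = src g → M) (he : IsEmbedding fun f => (src f, tgt f))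
    (src_one : ∀ x, src (one x) = x) (tgt_one : ∀ x, tgt (one x) = x)
    (src_inv : ∀ f, src (inv f) = tgt f) (tgt_inv : ∀ f, tgt (inv f) = src f)
    (src_comp : ∀ f g h, src (comp f g h) = src f) (tgt_comp : ∀ f g h, tgt (comp f g h) = tgt g) :
    TopologicalGroupoid O M :=
  have hs : Continuous src := continuous_fst.comp he.continuous
  have ht : Continuous tgt := continuous_snd.comp he.continuous
  { src := src
    tgt := tgt
    one := one
    inv := inv
    comp := comp
    src_one := src_one
    tgt_one := tgt_one
    src_inv := src_inv
    tgt_inv := tgt_inv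
    src_comp := src_comp
    tgt_comp := tgt_comp
    -- Each law holds because both sides have the same source and target; continuity is tested on
    -- endpoints in the same way.
    one_comp := fun f => he.injective (by simp [src_comp, tgt_comp, src_one])
    comp_one := fun f => he.injective (by simp [src_comp, tgt_comp, tgt_one])
    comp_inv := fun f => he.injective (by simp [src_comp, tgt_comp, tgt_inv, src_one, tgt_one])
    inv_comp := fun f => he.injective (by simp [src_comp, tgt_comp, src_inv, src_one, tgt_one])
    assoc := fun f g k h h' => he.injective (by simp [src_comp, tgt_comp])
    continuous_src := hs
    continuous_tgt := ht
    continuous_one := he.continuous_iff.2 (by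
      simpa [Function.comp_def, src_one, tgt_one] using continuous_id.prodMk continuous_id)
    continuous_inv := he.continuous_iff.2 (by
      simpa [Function.comp_def, src_inv, tgt_inv] using ht.prodMk hs)
    continuous_comp := he.continuous_iff.2 (by
      simp only [Function.comp_def, src_comp, tgt_comp]
      exact (hs.comp (continuous_fst.comp continuous_subtype_val)).prodMk
        (ht.comp (continuous_snd.comp continuous_subtype_val))) }

lemma IsLocallyEmbedding.of_comp {X Z T : Type*} [TopologicalSpace X] [TopologicalSpace Z]
    [TopologicalSpace T] {f : X → Z} {g : Z → T} (hf : Continuous f) (hg : Continuous g)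
    (hgf : IsLocallyEmbedding (g ∘ f)) : IsLocallyEmbedding f := fun x => by
  obtain ⟨U, hU, hxU, hU'⟩ := hgf x
  exact ⟨U, hU, hxU, .of_comp (hf.comp continuous_subtype_val) hg hU'⟩

lemma Topology.IsEmbedding.isLocallyEmbedding {X Z : Type*} [TopologicalSpace X]
    [TopologicalSpace Z] {f : X → Z} (hf : IsEmbedding f) : IsLocallyEmbedding f :=
  fun _ => ⟨univ, isOpen_univ, mem_univ _, hf.comp .subtypeVal⟩

lemma IsLocallyEmbedding.comp_isEmbedding {X Z T : Type*} [TopologicalSpace X] [TopologicalSpace Z]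
    [TopologicalSpace T] {f : X → Z} {g : Z → T} (hg : IsLocallyEmbedding g) (hf : IsEmbedding f) :
    IsLocallyEmbedding (g ∘ f) := fun x => by
  obtain ⟨U, hU, hxU, hU'⟩ := hg (f x)
  refine ⟨f ⁻¹' U, hU.preimage hf.continuous, hxU, ?_⟩
  have h : IsEmbedding (fun x : f ⁻¹' U => (⟨f x, x.2⟩ : U)) :=
    .of_comp (by fun_prop) continuous_subtype_val (hf.comp .subtypeVal)
  exact hU'.comp h

lemma IsLocalHomeomorph.isLocallyEmbedding {X Z : Type*} [TopologicalSpace X]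
    [TopologicalSpace Z] {f : X → Z} (hf : IsLocalHomeomorph f) :
    IsLocallyEmbedding f := fun x => by
  obtain ⟨e, hx, rfl⟩ := hf x
  exact ⟨e.source, e.open_source, hx, e.isOpenEmbedding_restrict.isEmbedding⟩

/-- If source and target are locally embeddings, so are the other structural maps. -/
lemma TopologicalGroupoid.isLocallyEmbedded (𝒢 : TopologicalGroupoid O M)
    (hs : IsLocallyEmbedding 𝒢.src) (ht : IsLocallyEmbedding 𝒢.tgt) : 𝒢.IsLocallyEmbedded where
  src := hs
  tgt := ht
  one := .of_comp 𝒢.continuous_one 𝒢.continuous_src <| by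
    have : 𝒢.src ∘ 𝒢.one = id := funext 𝒢.src_one
    rw [this]
    exact IsEmbedding.id.isLocallyEmbedding
  inv := .of_comp 𝒢.continuous_inv 𝒢.continuous_src <| by
    have : 𝒢.src ∘ 𝒢.inv = 𝒢.tgt := funext 𝒢.src_inv
    rwa [this]
  comp := .of_comp 𝒢.continuous_comp 𝒢.continuous_src <| by
    rintro ⟨⟨f, g⟩, hfg⟩
    obtain ⟨U, hU, hfU, hU'⟩ := hs f
    obtain ⟨V, hV, hgV, hV'⟩ := hs g
    refine ⟨{p | p.1.1 ∈ U ∧ p.1.2 ∈ V},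
      (hU.preimage (continuous_fst.comp continuous_subtype_val)).inter
        (hV.preimage (continuous_snd.comp continuous_subtype_val)), ⟨hfU, hgV⟩, ?_⟩
    set X : Set {p : M × M // 𝒢.tgt p.1 = 𝒢.src p.2} := {p | p.1.1 ∈ U ∧ p.1.2 ∈ V}
    have hc1 : Continuous fun p : X => p.1.1.1 :=
      continuous_fst.comp (continuous_subtype_val.comp continuous_subtype_val)
    have hc2 : Continuous fun p : X => p.1.1.2 :=
      continuous_snd.comp (continuous_subtype_val.comp continuous_subtype_val)
    have h1 : IsEmbedding fun p : X => ((⟨p.1.1.1, p.2.1⟩, ⟨p.1.1.2, p.2.2⟩) : U × V) :=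
      .of_comp ((hc1.subtype_mk _).prodMk (hc2.subtype_mk _))
        (g := fun q : U × V => (q.1.1, q.2.1)) (by fun_prop)
        ((IsEmbedding.subtypeVal (p := fun p : M × M => 𝒢.tgt p.1 = 𝒢.src p.2)).comp
          .subtypeVal)
    -- Locally a composable pair is determined by its first entry: `src` is an embedding near `g`,
    -- and the source of the second entry is the target of the first.
    have h2 : IsEmbedding fun p : X => (⟨p.1.1.1, p.2.1⟩ : U) := by
      refine .of_comp (hc1.subtype_mk _)
        (g := fun u : U => (u, 𝒢.tgt u.1))
        (continuous_id.prodMk (𝒢.continuous_tgt.comp continuous_subtype_val)) ?_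
      have h3 := ((IsEmbedding.id (X := U)).prodMap hV').comp h1
      convert h3 using 1
      funext p
      exact Prod.ext rfl p.1.2
    have h4 := hU'.comp h2
    convert h4 using 1
    funext p
    exact 𝒢.src_comp _ _ _

end Topological

/-! ### Étale groupoids from étale source and target maps -/

section Etale

variable {d : ℕ} {O M : Type*} [TopologicalSpace O] [TopologicalSpace M]
  [ChartedSpace (EuclideanSpace ℝ (Fin d)) O] [ChartedSpace (EuclideanSpace ℝ (Fin d)) M]
  (𝒢 : TopologicalGroupoid O M)

namespace TopologicalGroupoid

lemma isEtale_one (hs : IsEtale d 𝒢.src) : IsEtale d 𝒢.one :=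
  .of_comp_left 𝒢.continuous_one hs <| by
    have : 𝒢.src ∘ 𝒢.one = id := funext 𝒢.src_one
    rw [this]
    exact isEtale_id

lemma isEtale_inv (hs : IsEtale d 𝒢.src) (ht : IsEtale d 𝒢.tgt) : IsEtale d 𝒢.inv :=
  .of_comp_left 𝒢.continuous_inv hs <| by
    have : 𝒢.src ∘ 𝒢.inv = 𝒢.tgt := funext 𝒢.src_inv
    rwa [this]

/-- Take for `φ` the target near `f` followed by a local section of `src` through `g`, and for `χ`
the source near `f` followed by a local section of `src` through the composite. The two descriptions
of the composite agree since it has the source of its first factor. -/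
lemma exists_partialDiffeomorph_comp (hs : IsEtale d 𝒢.src) (ht : IsEtale d 𝒢.tgt) (f g : M)
    (h : 𝒢.tgt f = 𝒢.src g) : ∃ φ χ : PartialDiffeomorph (𝓡 d) (𝓡 d) M M ∞,
      f ∈ φ.source ∧ f ∈ χ.source ∧ φ f = g ∧
        ∀ u ∈ φ.source ∩ χ.source, ∃ h : 𝒢.tgt u = 𝒢.src (φ u), χ u = 𝒢.comp u (φ u) h := by
  obtain ⟨T, hfT, hT⟩ := ht f
  obtain ⟨S, hgS, hS⟩ := hs g
  obtain ⟨R, hfR, hR⟩ := hs f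
  obtain ⟨C, hcC, hC⟩ := hs (𝒢.comp f g h)
  let φ := T.trans S.symm
  let χ := R.trans C.symm
  have hφ : ∀ u ∈ φ.source, 𝒢.tgt u = 𝒢.src (φ u) := by
    rintro u ⟨hu, hu'⟩
    change T u ∈ S.target at hu'
    rw [hT hu]
    refine Eq.trans ?_ (hS (S.map_target hu')).symm
    exact (S.right_inv hu').symm
  have hfφ : f ∈ φ.source := by
    refine ⟨hfT, ?_⟩
    change T f ∈ S.target
    rw [← hT hfT, h, hS hgS]
    exact S.map_source hgS
  have hφf : φ f = g := by
    change S.symm (T f) = g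
    rw [← hT hfT, h, hS hgS]
    exact S.left_inv hgS
  have hfχ : f ∈ χ.source := by
    refine ⟨hfR, ?_⟩
    change R f ∈ C.target
    rw [← hR hfR, ← 𝒢.src_comp f g h, hC hcC]
    exact C.map_source hcC
  let k : φ.source → M := fun u => 𝒢.comp u (φ u) (hφ u u.2)
  have hk : Continuous k := by
    have h1 : Continuous fun u : φ.source => φ u :=
      continuousOn_iff_continuous_domRestrict.1 φ.contMDiffOn.continuousOn
    exact 𝒢.continuous_comp.comp ((continuous_subtype_val.prodMk h1).subtype_mk fun u => hφ u u.2)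
  -- The domain is shrunk so that the composites stay where the section `C.symm` inverts `src`.
  have hU : IsOpen (Subtype.val '' (k ⁻¹' C.source)) :=
    φ.open_source.isOpenMap_subtype_val _ (C.open_source.preimage hk)
  refine ⟨φ.restrOpen _ hU, χ, ⟨hfφ, ⟨f, hfφ⟩, ?_, rfl⟩, hfχ, hφf, ?_⟩
  · change 𝒢.comp f (φ f) _ ∈ C.source
    convert hcC
  · rintro u ⟨⟨hu, ⟨u', hu'⟩, hkC, rfl⟩, huR, -⟩
    refine ⟨hφ _ hu, ?_⟩
    change 𝒢.comp u' (φ u') _ ∈ C.source at hkC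
    change C.symm (R u') = 𝒢.comp u' (φ u') _
    rw [← hR huR, ← 𝒢.src_comp u' (φ u') (hφ _ hu), hC hkC]
    exact C.left_inv hkC

/-- An étale topological groupoid with an orientation of the objects that is preserved by all
morphisms. -/
noncomputable def toOrientedEtaleGroupoid [T2Space O] [T2Space M] [ParacompactSpace O]
    [ParacompactSpace M] [IsManifold (𝓡 d) ∞ O] [IsManifold (𝓡 d) ∞ M]
    (hs : IsEtale d 𝒢.src) (ht : IsEtale d 𝒢.tgt) (o : OrientationField d O)
    (oM : OrientationField d M) (ho : o.IsContinuous) (hos : PreservesOrientation oM o 𝒢.src)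
    (hot : PreservesOrientation oM o 𝒢.tgt) : OrientedEtaleGroupoid d O M :=
  { 𝒢 with
    t2_obj := inferInstance
    t2_mor := inferInstance
    paracompact_obj := inferInstance
    paracompact_mor := inferInstance
    manifold_obj := inferInstance
    manifold_mor := inferInstance
    etale_src := hs
    etale_tgt := ht
    etale_one := 𝒢.isEtale_one hs
    etale_inv := 𝒢.isEtale_inv hs ht
    etale_comp := 𝒢.exists_partialDiffeomorph_comp hs ht
    orientObj := o
    orientMor := oM
    continuous_orientObj := ho
    continuous_orientMor := hos.isContinuous hs ho
    orient_src := hos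
    orient_tgt := hot
    orient_one := .of_comp_left hs (𝒢.isEtale_one hs) hos <| by
      have : 𝒢.src ∘ 𝒢.one = id := funext 𝒢.src_one
      rw [this]
      exact preservesOrientation_id o
    orient_inv := .of_comp_left hs (𝒢.isEtale_inv hs ht) hos <| by
      have : 𝒢.src ∘ 𝒢.inv = 𝒢.tgt := funext 𝒢.src_inv
      rwa [this] }

end TopologicalGroupoid

end Etale

/-! ### The groupoid completion -/

namespace ProdGroup

variable {A : Type uA} [DecidableEq A] {Γ : A → Type uG} [∀ i, Group (Γ i)] {I : Finset A}

@[simp] lemma tr_one (J : Finset A) : (1 : ProdGroup Γ I).tr J = 1 := by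
  funext j
  simp [tr_apply]

@[simp] lemma tr_self (γ : ProdGroup Γ I) : γ.tr I = γ := by
  funext j
  simp [tr_apply]

lemma tr_tr {J L : Finset A} (γ : ProdGroup Γ I) (h : ∀ a ∈ L, a ∈ I → a ∈ J) :
    (γ.tr J).tr L = γ.tr L := by
  funext a
  have := h a a.2
  simp only [tr_apply]
  split_ifs <;> tauto

end ProdGroup

namespace ProdGroup.TrivialOn

variable {A : Type uA} {Γ : A → Type uG} [∀ i, Group (Γ i)] {I L : Finset A}
  {γ δ : ProdGroup Γ I}

lemma one : (1 : ProdGroup Γ I).TrivialOn L := fun _ _ => rfl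

lemma mul (hγ : γ.TrivialOn L) (hδ : δ.TrivialOn L) : (γ * δ).TrivialOn L := fun j hj => by
  simp [hγ j hj, hδ j hj]

lemma inv (hγ : γ.TrivialOn L) : (γ⁻¹).TrivialOn L := fun j hj => by
  simp [hγ j hj]

lemma mono {L' : Finset A} (hγ : γ.TrivialOn L) (h : L' ⊆ L) : γ.TrivialOn L' :=
  fun j hj => hγ j (h hj)

variable [DecidableEq A]

lemma tr (hγ : γ.TrivialOn L) (J : Finset A) : (γ.tr J).TrivialOn L := fun j hj => by
  rw [tr_apply]
  split_ifs with h
  · exact hγ _ hj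
  · rfl

lemma of_tr {J : Finset A} (h : I ⊆ J) (hγ : (γ.tr J).TrivialOn L) : γ.TrivialOn L := fun j hj => by
  simpa [tr_apply] using hγ ⟨j.1, h j.2⟩ hj

end ProdGroup.TrivialOn

namespace ProdGroup

variable {A : Type uA} [DecidableEq A] {Γ : A → Type uG} [∀ i, Group (Γ i)] {I : Finset A}

lemma trivialOn_tr_of_disjoint {J L : Finset A} (γ : ProdGroup Γ I) (h : ∀ a ∈ L, a ∉ I) :
    (γ.tr J).TrivialOn L := fun j hj => by
  rw [tr_apply, dif_neg (h j hj)]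

variable (Γ) in
/-- The subgroup `Γ_{J ∖ I}` of `Γ_J`. -/
def trivialOnSubgroup (I J : Finset A) : Subgroup (ProdGroup Γ J) where
  carrier := {γ | γ.TrivialOn I}
  one_mem' := .one
  mul_mem' := .mul
  inv_mem' := .inv

end ProdGroup

namespace OrbifoldAtlas

variable {d : ℕ} {A : Type uA} [DecidableEq A] {Y : Type uY} [TopologicalSpace Y]
  {K : OrbifoldAtlas.{uA, uY, uG, uW} d A Y}

lemma exists_ρ_eq {I J : K.Index} (h : I ≤ J) (x : K.W I) (hx : ∀ a ∈ J.1, K.ψ I x ∈ K.F a) :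
    ∃ z, K.ρ h z = x := by
  have : x ∈ range (K.ρ h) := by rw [K.range_ρ]; simpa using hx
  exact this

lemma ψ_mem_F (I : K.Index) (x : K.W I) {a : A} (ha : a ∈ I.1) : K.ψ I x ∈ K.F a := by
  have := K.ψ_mem I x
  simp only [mem_iInter] at this
  exact this a ha

/-- Elements of `W_J` with the same footprint are in the same orbit. -/
lemma ψ_eq_iff {J : K.Index} (x y : K.W J) :
    K.ψ J x = K.ψ J y ↔ ∃ γ : ProdGroup K.Γ J.1, γ • x = y := by
  constructor
  · intro h
    obtain ⟨e, he⟩ := K.footprint J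
    rw [← he, ← he] at h
    obtain ⟨γ, hγ⟩ := Quotient.exact (e.injective (Subtype.ext h)).symm
    exact ⟨γ, hγ⟩
  · rintro ⟨γ, rfl⟩
    exact (K.ψ_smul _ _ _).symm

@[simp] lemma src_one (x : K.Obj) : src (one x) = x := by
  obtain ⟨I, x⟩ := x
  have key : ∀ {U : K.Index} (h : I ≤ U) (h' : U ≤ I) (γ : ProdGroup K.Γ I.1), γ = 1 →
      γ⁻¹ • K.ρ h (K.ρ h' x) = x := by
    rintro U h h' _ rfl
    rw [inv_one, one_smul, K.ρ_ρ, K.ρ_self]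
  exact congrArg (Sigma.mk I) (key _ _ _ (ProdGroup.tr_one _))

@[simp] lemma tgt_one (x : K.Obj) : tgt (one x) = x := by
  obtain ⟨I, x⟩ := x
  exact congrArg (Sigma.mk I) ((K.ρ_ρ _ _ _).trans (K.ρ_self _ _))

@[simp] lemma src_inv (f : K.Mor) : src (inv f) = tgt f := by
  obtain ⟨⟨i, j, hn, γ⟩, z⟩ := f
  have key : ∀ {U U' : K.Index} (h : j ≤ U) (h' : j ≤ U') (h'' : U' ≤ U) (δ : ProdGroup K.Γ j.1)
      (ε : ProdGroup K.Γ U.1) (z : K.W U), δ = ε.tr j.1 →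
      δ⁻¹ • K.ρ h' (K.ρ h'' (ε • z)) = K.ρ h z := by
    rintro U U' h h' h'' _ ε z rfl
    rw [K.ρ_ρ, K.equivariant_ρ, inv_smul_smul]
  refine congrArg (Sigma.mk j) (key _ _ _ _ _ _ ?_)
  change ((γ⁻¹).tr (j.1 ∩ i.1) : ProdGroup K.Γ _).tr j.1 =
    ((γ.tr (i.1 ∪ j.1) : ProdGroup K.Γ _)⁻¹).tr j.1
  rw [ProdGroup.tr_tr _ (by simp +contextual), ProdGroup.tr_inv, ProdGroup.tr_inv,
    ProdGroup.tr_tr _ (by simp +contextual)]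

@[simp] lemma tgt_inv (f : K.Mor) : tgt (inv f) = src f := by
  obtain ⟨⟨i, j, hn, γ⟩, z⟩ := f
  have key : ((γ.tr (i.1 ∪ j.1) : ProdGroup K.Γ _)⁻¹).tr i.1 = (γ.tr i.1)⁻¹ := by
    rw [ProdGroup.tr_inv, ProdGroup.tr_tr _ (by simp +contextual)]
  exact congrArg (Sigma.mk i) ((K.ρ_ρ _ _ _).trans ((K.equivariant_ρ _ _ _).trans
    (congrArg (fun δ : ProdGroup K.Γ i.1 => δ • K.ρ (MorIndex.le_i ⟨i, j, hn, γ⟩) z) key)))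

/-- The point of `Y` over which a morphism lies. -/
def pt (f : K.Mor) : Y := K.ψ f.1.union f.2

lemma continuous_pt : Continuous (pt : K.Mor → Y) :=
  continuous_sigma fun m => K.continuous_ψ m.union

lemma footprintMap_src' (f : K.Mor) : K.footprintMap (src f) = pt f := footprintMap_src f

lemma footprintMap_tgt' (f : K.Mor) : K.footprintMap (tgt f) = pt f := footprintMap_tgt f

/-- Gives access to the lift `(v, α)` that defines the composite, with the projections out of `W_{I
∪ L}` already rewritten as projections from `W_{I ∪ J ∪ L}`. -/
lemma comp_spec {f g : K.Mor} (h : tgt f = src g) :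
    ∃ p : K.W (triple h) × ProdGroup K.Γ ((f.1.i.1 ∩ g.1.j.1) \ f.1.j.1), IsLift h p ∧
      (comp f g h).1.γ = p.2.tr _ * g.1.γ.tr _ * f.1.γ.tr _ ∧
      ∀ (I : K.Index) (hI : I ≤ (comp f g h).1.union) (hI' : I ≤ triple h),
        K.ρ hI (comp f g h).2 = K.ρ hI' p.1 :=
  ⟨_, (existsUnique_isLift h).choose_spec.1, rfl, fun _ _ _ => K.ρ_ρ _ _ _⟩

lemma comp_i {f g : K.Mor} (h : tgt f = src g) : (comp f g h).1.i = f.1.i := rfl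

lemma comp_j {f g : K.Mor} (h : tgt f = src g) : (comp f g h).1.j = g.1.j := rfl

@[simp] lemma tgt_comp (f g : K.Mor) (h : tgt f = src g) : tgt (comp f g h) = tgt g := by
  obtain ⟨p, ⟨-, hp⟩, -, hρ⟩ := comp_spec h
  have h1 := hρ g.1.j (comp f g h).1.le_j (g.1.le_j.trans (le_triple_right h))
  refine congrArg (Sigma.mk g.1.j) (h1.trans ?_)
  rw [← K.ρ_ρ g.1.le_j (le_triple_right h), hp, K.equivariant_ρ, ProdGroup.tr_inv]
  -- The element `γ₀` has no components in `L`, so it disappears in `Γ_L`.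
  convert one_smul (ProdGroup K.Γ g.1.j.1) _
  rw [inv_eq_one]
  funext a
  simp [ProdGroup.tr_apply]

@[simp] lemma src_comp (f g : K.Mor) (h : tgt f = src g) : src (comp f g h) = src f := by
  obtain ⟨p, ⟨hp, -⟩, hγ, hρ⟩ := comp_spec h
  have h1 := hρ f.1.i (comp f g h).1.le_i (f.1.le_i.trans (le_triple_left h))
  refine congrArg (Sigma.mk f.1.i) ?_
  have hj : ∀ a, a ∈ f.1.j.1 ↔ a ∈ g.1.i.1 := fun a => by rw [idx_eq h]
  have h2 : K.ρ (f.1.le_i.trans (le_triple_left h)) p.1 =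
      ((((f.1.γ.tr ((f.1.i.1 ∩ f.1.j.1) \ g.1.j.1)).tr f.1.union.1)⁻¹).tr f.1.i.1 *
        (p.2.tr f.1.union.1).tr f.1.i.1 * (g.1.γ.tr f.1.union.1).tr f.1.i.1) •
          K.ρ f.1.le_i f.2 := by
    rw [← K.ρ_ρ f.1.le_i (le_triple_left h), hp, K.equivariant_ρ, K.equivariant_ρ,
      K.equivariant_ρ, smul_smul, smul_smul]
  have key : ∀ (δ ε γ : ProdGroup K.Γ f.1.i.1) (w : K.W f.1.i), ε = δ * γ⁻¹ →
      δ⁻¹ • ε • w = γ⁻¹ • w := by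
    rintro δ _ γ w rfl
    rw [smul_smul, inv_mul_cancel_left]
  refine (congrArg (fun w : K.W f.1.i => ((comp f g h).1.γ.tr f.1.i.1)⁻¹ • w)
    (h1.trans h2)).trans (key _ _ _ _ ?_)
  -- What remains is the identity `γ₀⁻¹ α δ = (α δ' γ') γ⁻¹` in `Γ_I`. It is checked on each
  -- component, according to membership in `J` and `L`.
  rw [hγ, eq_mul_inv_iff_mul_eq, mul_assoc, mul_assoc, ProdGroup.tr_inv, inv_mul_eq_iff_eq_mul]
  funext a
  obtain ⟨a, ha⟩ := a
  simp only [ProdGroup.tr_apply, Pi.mul_apply]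
  by_cases h1 : a ∈ f.1.j.1 <;> by_cases h2 : a ∈ g.1.j.1 <;>
    simp [ha, h1, h2, (hj a).1, (hj a).not.1, comp_i, comp_j, MorIndex.union]

lemma pt_comp (f g : K.Mor) (h : tgt f = src g) : pt (comp f g h) = pt f := by
  rw [← footprintMap_src', src_comp, footprintMap_src']

lemma pt_inv (f : K.Mor) : pt (inv f) = pt f := by
  rw [← footprintMap_src', src_inv, footprintMap_tgt']

lemma pt_one (x : K.Obj) : pt (one x) = K.footprintMap x := by
  rw [← footprintMap_src', src_one]

lemma trivialOn_inv {f : K.Mor} {L : Finset A} (h : f.1.γ.TrivialOn L) :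
    (inv f).1.γ.TrivialOn L := h.inv.tr _

lemma trivialOn_inv_iff {f : K.Mor} {L : Finset A} :
    (inv f).1.γ.TrivialOn L ↔ f.1.γ.TrivialOn L := by
  refine ⟨fun h => ?_, trivialOn_inv⟩
  have h1 : (f.1.γ⁻¹).TrivialOn L := by
    refine ProdGroup.TrivialOn.of_tr (J := f.1.j.1 ∩ f.1.i.1) ?_ h
    rw [Finset.inter_comm]
  simpa using h1.inv

/-- The part `α` of the composite has no components in `J`, hence none in `L`; the other two factors
are trivial on `L` by assumption. -/
lemma trivialOn_comp {f g : K.Mor} (h : tgt f = src g) {L : Finset A} (hL : L ⊆ f.1.j.1)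
    (hf : f.1.γ.TrivialOn L) (hg : g.1.γ.TrivialOn L) : (comp f g h).1.γ.TrivialOn L := by
  obtain ⟨p, -, hγ, -⟩ := comp_spec h
  rw [hγ]
  refine ((ProdGroup.trivialOn_tr_of_disjoint _ fun a ha => ?_).mul (hg.tr _)).mul (hf.tr _)
  simp [hL ha]

/-- Morphisms with components in `Γ_{(I ∩ J) ∖ L}`, for some nonempty `L ⊆ I ∩ J`, are determined
by source and target. -/
lemma eq_of_src_tgt {f g : K.Mor} {L : K.Index} (hi : L ≤ f.1.i) (hj : L ≤ f.1.j)
    (hf : f.1.γ.TrivialOn L.1) (hg : g.1.γ.TrivialOn L.1) (hs : src f = src g)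
    (ht : tgt f = tgt g) : f = g := by
  obtain ⟨⟨i, j, hn, γ⟩, z⟩ := f
  obtain ⟨⟨i', j', hn', γ'⟩, z'⟩ := g
  obtain rfl : i = i' := congrArg Sigma.fst hs
  obtain rfl : j = j' := congrArg Sigma.fst ht
  have hs' := eq_of_heq (Sigma.mk.inj hs).2
  have ht' := eq_of_heq (Sigma.mk.inj ht).2
  let m : K.MorIndex := ⟨i, j, hn, γ⟩
  change K.W m.union at z z'
  change (γ.tr i.1)⁻¹ • K.ρ m.le_i z = (γ'.tr i.1)⁻¹ • K.ρ m.le_i z' at hs'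
  change K.ρ m.le_j z = K.ρ m.le_j z' at ht'
  change γ.TrivialOn L.1 at hf
  change γ'.TrivialOn L.1 at hg
  obtain ⟨β, hβ, rfl⟩ := (K.ρ_eq_iff _ _ _).1 ht'
  rw [K.equivariant_ρ, inv_smul_eq_iff, smul_smul, smul_smul] at hs'
  -- Equal endpoints make `γ γ'⁻¹ β` fix a point, and it is trivial on `L`, so it is `1`. Since `β`
  -- has no components in `J` and `γ γ'⁻¹` only components in `I ∩ J`, both parts vanish separately.
  have h1 := K.free_of_trivialOn hi _
    (((hf.tr i.1).mul (hg.tr i.1).inv).mul ((hβ.mono hj).tr i.1)) _ hs'.symm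
  have h2 : ∀ a (ha : a ∈ i.1), _ := fun a ha => congrFun h1 ⟨a, ha⟩
  have hγ : γ = γ' := by
    funext a
    obtain ⟨a, ha⟩ := a
    have ha' := Finset.mem_inter.1 ha
    have h3 := h2 a ha'.1
    have h4 : β ⟨a, m.le_j ha'.2⟩ = 1 := hβ _ ha'.2
    have h5 : a ∈ m.union.1 := m.le_j ha'.2
    simp only [Pi.mul_apply, ProdGroup.tr_apply, Pi.inv_apply, dif_pos ha, dif_pos h5, h4, mul_one,
      Pi.one_apply] at h3
    exact mul_inv_eq_one.1 h3
  subst hγ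
  have hβ' : β = 1 := by
    funext a
    obtain ⟨a, ha⟩ := a
    by_cases haj : a ∈ j.1
    · exact hβ _ haj
    · have hai : a ∈ i.1 := (Finset.mem_union.1 ha).resolve_right haj
      have h3 := h2 a hai
      simpa [ProdGroup.tr_apply, haj, ha] using h3
  rw [hβ', one_smul]

instance [Finite A] : Finite K.Index := inferInstanceAs (Finite (Subtype _))

instance [Finite A] : Finite K.MorIndex :=
  Finite.of_injective
    (β := Σ p : K.Index × K.Index, ProdGroup K.Γ (p.1.1 ∩ p.2.1))
    (fun m => ⟨(m.i, m.j), m.γ⟩) fun m m' h => by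
      obtain ⟨i, j, hn, γ⟩ := m
      obtain ⟨i', j', hn', γ'⟩ := m'
      simp only [Sigma.mk.injEq, Prod.mk.injEq] at h
      obtain ⟨⟨rfl, rfl⟩, h⟩ := h
      rw [eq_of_heq h]

end OrbifoldAtlas

/-! ### The groupoids of a cover reduction -/

namespace OrbifoldAtlas

variable {d : ℕ} {A : Type uA} [DecidableEq A] {Y : Type uY} [TopologicalSpace Y]
  {K : OrbifoldAtlas.{uA, uY, uG, uW} d A Y}

/-- A quotient by a group of homeomorphisms is an open map, and `F_I` is open in `Y`. -/
lemma isOpenMap_ψ (I : K.Index) : IsOpenMap (K.ψ I) := by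
  obtain ⟨e, he⟩ := K.footprint I
  have hF : IsOpen (⋂ i ∈ I.1, K.F i) := isOpen_biInter_finset fun i _ => K.isOpen_F i
  have : ContinuousConstSMul (ProdGroup K.Γ I.1) (K.W I) := ⟨K.continuous_smul I⟩
  have h : K.ψ I = Subtype.val ∘ e ∘ Quotient.mk _ := funext fun x => (he x).symm
  rw [h]
  exact hF.isOpenMap_subtype_val.comp (e.isOpenMap.comp (isOpenMap_quotient_mk'_mul))

lemma isEtale_smul (I : K.Index) (γ : ProdGroup K.Γ I.1) : IsEtale d (fun x : K.W I => γ • x) :=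
  Diffeomorph.isLocalDiffeomorph (I := 𝓡 d) (J := 𝓡 d) (n := ∞)
    { toEquiv := MulAction.toPerm γ
      contMDiff_toFun := K.smooth_action I γ
      contMDiff_invFun := K.smooth_action I γ⁻¹ }

lemma isEtale_src : IsEtale d (src : K.Mor → K.Obj) :=
  isEtale_sigma fun m =>
    (isEtale_sigmaMk m.i).comp ((isEtale_smul m.i (m.γ.tr m.i.1)⁻¹).comp (K.etale_ρ m.le_i))

lemma isEtale_tgt : IsEtale d (tgt : K.Mor → K.Obj) :=
  isEtale_sigma fun m => (isEtale_sigmaMk m.j).comp (K.etale_ρ m.le_j)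

lemma isClosed_setOf_fst (P : K.MorIndex → Prop) : IsClosed {f : K.Mor | P f.1} :=
  isClosed_sigma_iff.2 fun m => by
    by_cases h : P m
    · convert isClosed_univ using 1
      exact eq_univ_of_forall fun _ => h
    · convert isClosed_empty using 1
      exact eq_empty_of_forall_notMem fun _ => h

/-- When `I` and `J` are comparable, `I ∪ J` is one of them, so the source or the target is a
homeomorphism from `W_{I ∪ J}`. The image of `D` is then the graph of a continuous map over a closed
set. -/
lemma isClosed_image_src_tgt_component (m : K.MorIndex) (hm : m.i ≤ m.j ∨ m.j ≤ m.i)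
    {D : Set (K.W m.union)} (hD : IsClosed D) :
    IsClosed ((fun z => (src ⟨m, z⟩, tgt ⟨m, z⟩) : K.W m.union → K.Obj × K.Obj) '' D) := by
  let s : K.W m.union → K.W m.i := fun z => (m.γ.tr m.i.1)⁻¹ • K.ρ m.le_i z
  let t : K.W m.union → K.W m.j := K.ρ m.le_j
  have hs : Continuous s := (K.continuous_smul _ _).comp (K.continuous_ρ _)
  have ht : Continuous t := K.continuous_ρ _
  have himage : (fun z => (src ⟨m, z⟩, tgt ⟨m, z⟩) : K.W m.union → K.Obj × K.Obj) '' D =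
      Prod.map (Sigma.mk m.i) (Sigma.mk m.j) '' ((fun z => (s z, t z)) '' D) := by
    rw [image_image]; rfl
  rw [himage]
  refine (IsClosedEmbedding.sigmaMk.prodMap IsClosedEmbedding.sigmaMk).isClosedMap _ ?_
  rcases hm with hm | hm
  · have h' : m.union ≤ m.j := Finset.union_subset hm subset_rfl
    have h1 : ∀ z, K.ρ h' (t z) = z := fun z => (K.ρ_ρ _ _ _).trans (K.ρ_self _ _)
    have h2 : ∀ y, t (K.ρ h' y) = y := fun z => (K.ρ_ρ _ _ _).trans (K.ρ_self _ _)
    have : (fun z => (s z, t z)) '' D =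
        (fun p : K.W m.i × K.W m.j => K.ρ h' p.2) ⁻¹' D ∩ {p | p.1 = s (K.ρ h' p.2)} := by
      ext ⟨x, y⟩
      simp only [mem_image, Prod.mk.injEq, mem_inter_iff, mem_preimage, mem_ofPred_eq]
      constructor
      · rintro ⟨z, hz, rfl, rfl⟩
        exact ⟨(h1 z).symm ▸ hz, by rw [h1]⟩
      · rintro ⟨hz, rfl⟩
        exact ⟨_, hz, rfl, h2 y⟩
    rw [this]
    have hc : Continuous fun p : K.W m.i × K.W m.j => K.ρ h' p.2 :=
      (K.continuous_ρ h').comp continuous_snd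
    exact (hD.preimage hc).inter (isClosed_eq continuous_fst (hs.comp hc))
  · have h' : m.union ≤ m.i := Finset.union_subset subset_rfl hm
    let r : K.W m.i → K.W m.union := fun x => K.ρ h' (m.γ.tr m.i.1 • x)
    have h1 : ∀ z, r (s z) = z := fun z =>
      (congrArg (K.ρ h') (smul_inv_smul _ _)).trans ((K.ρ_ρ _ _ _).trans (K.ρ_self _ _))
    have h2 : ∀ x, s (r x) = x := fun x => by
      have : K.ρ m.le_i (K.ρ h' (m.γ.tr m.i.1 • x)) = m.γ.tr m.i.1 • x :=
        (K.ρ_ρ _ _ _).trans (K.ρ_self _ _)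
      simp only [s, r, this, inv_smul_smul]
    have hr : Continuous r := (K.continuous_ρ _).comp (K.continuous_smul _ _)
    have : (fun z => (s z, t z)) '' D =
        (fun p : K.W m.i × K.W m.j => r p.1) ⁻¹' D ∩ {p | p.2 = t (r p.1)} := by
      ext ⟨x, y⟩
      simp only [mem_image, Prod.mk.injEq, mem_inter_iff, mem_preimage, mem_ofPred_eq]
      constructor
      · rintro ⟨z, hz, rfl, rfl⟩
        exact ⟨(h1 z).symm ▸ hz, by rw [h1]⟩
      · rintro ⟨hz, rfl⟩
        exact ⟨_, hz, h2 x, rfl⟩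
    rw [this]
    have hc : Continuous fun p : K.W m.i × K.W m.j => r p.1 := hr.comp continuous_fst
    exact (hD.preimage hc).inter (isClosed_eq continuous_snd (ht.comp hc))

lemma isClosed_image_src_tgt [Finite A] {D : Set K.Mor} (hD : IsClosed D)
    (hD' : ∀ f ∈ D, f.1.i ≤ f.1.j ∨ f.1.j ≤ f.1.i) :
    IsClosed ((fun f => (src f, tgt f)) '' D) := by
  have : (fun f => (src f, tgt f)) '' D = ⋃ m : K.MorIndex,
      (fun z => (src ⟨m, z⟩, tgt ⟨m, z⟩) : K.W m.union → K.Obj × K.Obj) ''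
        {z | (⟨m, z⟩ : K.Mor) ∈ D} := by
    ext p
    simp only [mem_image, mem_iUnion, mem_ofPred_eq]
    exact ⟨fun ⟨f, hf, h⟩ => ⟨f.1, f.2, hf, h⟩, fun ⟨m, z, hz, h⟩ => ⟨⟨m, z⟩, hz, h⟩⟩
  rw [this]
  refine isClosed_iUnion_of_finite fun m => ?_
  by_cases hm : m.i ≤ m.j ∨ m.j ≤ m.i
  · exact isClosed_image_src_tgt_component m hm (isClosed_sigma_iff.1 hD m)
  · have : {z | (⟨m, z⟩ : K.Mor) ∈ D} = ∅ := eq_empty_of_forall_notMem fun z hz => hm (hD' _ hz)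
    rw [this, image_empty]
    exact isClosed_empty

namespace Reduction

variable {R : K.Reduction}

lemma mem_objV {x : K.Obj} : x ∈ R.objV ↔ K.footprintMap x ∈ R.Q x.1 := Iff.rfl

lemma src_mem_objV {f : K.Mor} : src f ∈ R.objV ↔ pt f ∈ R.Q f.1.i := by
  rw [mem_objV, footprintMap_src']; rfl

lemma tgt_mem_objV {f : K.Mor} : tgt f ∈ R.objV ↔ pt f ∈ R.Q f.1.j := by
  rw [mem_objV, footprintMap_tgt']; rfl

lemma le_or_le {I J : K.Index} {q : Y} (hI : q ∈ closure (R.Q I)) (hJ : q ∈ closure (R.Q J)) :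
    I ≤ J ∨ J ≤ I := R.comparable I J ⟨q, hI, hJ⟩

lemma mem_directMor {f : K.Mor} : f ∈ R.directMor ↔ f.1.i ≤ f.1.j ∧ ∃ L ≤ f.1.i,
    pt f ∈ R.Q L ∧ pt f ∈ R.Q f.1.i ∧ pt f ∈ R.Q f.1.j ∧ f.1.γ.TrivialOn L.1 := by
  refine and_congr_right fun _ => exists_congr fun L => and_congr_right fun _ => ?_
  simp only [Vt, V, mem_inter_iff, mem_preimage, K.ψ_ρ]
  change (((pt f ∈ _ ∧ pt f ∈ _) ∧ (pt f ∈ _ ∧ pt f ∈ _)) ∧ _) ↔ _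
  tauto

/-- A description symmetric in source and target. Comparability of the two indices need not be
demanded, as the footprint point lies in both `Q I` and `Q J`. -/
lemma mem_morV {f : K.Mor} : f ∈ R.morV ↔ ∃ L, L ≤ f.1.i ∧ L ≤ f.1.j ∧
    pt f ∈ R.Q L ∧ pt f ∈ R.Q f.1.i ∧ pt f ∈ R.Q f.1.j ∧ f.1.γ.TrivialOn L.1 := by
  change (f ∈ R.directMor ∨ (f.1.j < f.1.i ∧ inv f ∈ R.directMor)) ↔ _
  rw [mem_directMor, mem_directMor, pt_inv]
  simp only [trivialOn_inv_iff]
  change (_ ∨ (_ ∧ f.1.j ≤ f.1.i ∧ ∃ L ≤ f.1.j, pt f ∈ R.Q L ∧ pt f ∈ R.Q f.1.j ∧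
    pt f ∈ R.Q f.1.i ∧ _)) ↔ _
  constructor
  · rintro (⟨h, L, hL, h1, h2, h3, h4⟩ | ⟨-, h, L, hL, h1, h2, h3, h4⟩)
    · exact ⟨L, hL, hL.trans h, h1, h2, h3, h4⟩
    · exact ⟨L, hL.trans h, hL, h1, h3, h2, h4⟩
  · rintro ⟨L, hi, hj, h1, h2, h3, h4⟩
    rcases le_or_le (subset_closure h2) (subset_closure h3) with h | h
    · exact .inl ⟨h, L, hi, h1, h2, h3, h4⟩
    · rcases h.lt_or_eq with h' | h'
      · exact .inr ⟨h', h, L, hj, h1, h3, h2, h4⟩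
      · exact .inl ⟨h'.symm.le, L, hi, h1, h2, h3, h4⟩

lemma one_mem_morV {x : K.Obj} (hx : x ∈ R.objV) : one x ∈ R.morV :=
  mem_morV.2 ⟨x.1, le_rfl, le_rfl, by rw [pt_one]; exact ⟨hx, hx, hx, .one⟩⟩

lemma inv_mem_morV {f : K.Mor} (hf : f ∈ R.morV) : inv f ∈ R.morV := by
  obtain ⟨L, hi, hj, h1, h2, h3, h4⟩ := mem_morV.1 hf
  exact mem_morV.2 ⟨L, hj, hi, by rw [pt_inv]; exact ⟨h1, h3, h2, trivialOn_inv h4⟩⟩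

lemma pt_eq {f g : K.Mor} (h : tgt f = src g) : pt f = pt g := by
  rw [← footprintMap_tgt', h, footprintMap_src']

/-- The witnesses `L` and `L'` of the two factors have a common point in `Q L` and `Q L'`, so they
are comparable, and the smaller one is a witness for the composite. -/
lemma comp_mem_morV {f g : K.Mor} (h : tgt f = src g) (hf : f ∈ R.morV) (hg : g ∈ R.morV) :
    comp f g h ∈ R.morV := by
  obtain ⟨L, hi, hj, h1, h2, h3, h4⟩ := mem_morV.1 hf
  obtain ⟨L', hi', hj', h1', h2', h3', h4'⟩ := mem_morV.1 hg
  rw [← pt_eq h] at h1' h2' h3'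
  rw [← idx_eq h] at hi'
  rcases le_or_le (subset_closure h1) (subset_closure h1') with hL | hL
  · exact mem_morV.2 ⟨L, hi, hL.trans hj', by
      rw [pt_comp]; exact ⟨h1, h2, h3', trivialOn_comp h hj h4 (h4'.mono hL)⟩⟩
  · exact mem_morV.2 ⟨L', hL.trans hi, hj', by
      rw [pt_comp]; exact ⟨h1', h2, h3', trivialOn_comp h hi' (h4.mono hL) h4'⟩⟩

/-! ### The least index over a point and the closed groupoid -/

section Low

variable [Finite A]

/-- The set is finite, nonempty and a chain by comparability, so a minimal element is least. -/
lemma exists_isLeast_closure (R : K.Reduction) (q : Y) :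
    ∃ L, IsLeast {L | q ∈ closure (R.Q L)} L := by
  have hne : {L | q ∈ closure (R.Q L)}.Nonempty := by
    have := R.cover.symm ▸ mem_univ q
    obtain ⟨L, hL⟩ := mem_iUnion.1 this
    exact ⟨L, subset_closure hL⟩
  obtain ⟨L, hL⟩ := (Set.toFinite {L | q ∈ closure (R.Q L)}).exists_minimal hne
  exact ⟨L, hL.1, fun L' hL' => (le_or_le hL.1 hL').elim id fun h => hL.2 hL' h⟩

/-- The least `L` with `q ∈ closure (Q L)`. -/
noncomputable def low (R : K.Reduction) (q : Y) : K.Index := (exists_isLeast_closure R q).choose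

lemma mem_closure_low (R : K.Reduction) (q : Y) : q ∈ closure (R.Q (R.low q)) :=
  (exists_isLeast_closure R q).choose_spec.1

lemma low_le {q : Y} {L : K.Index} (h : q ∈ closure (R.Q L)) : R.low q ≤ L :=
  (exists_isLeast_closure R q).choose_spec.2 h

lemma low_le' {q : Y} {L : K.Index} (h : q ∈ R.Q L) : R.low q ≤ L := low_le (subset_closure h)

/-- The morphisms of `V_K` lie in the finite union over `L` of the closed conditions "footprint in
`closure (Q L)` and `γ` trivial on `L`". Conversely, with `γ` held fixed, the point can be moved so
that its footprint enters `Q (low q)`, where `low q` becomes a witness. -/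
lemma mem_morVH {f : K.Mor} : f ∈ R.morVH ↔
    pt f ∈ R.Q f.1.i ∧ pt f ∈ R.Q f.1.j ∧ f.1.γ.TrivialOn (R.low (pt f)).1 := by
  constructor
  · rintro ⟨hcl, hs, ht⟩
    refine ⟨src_mem_objV.1 hs, tgt_mem_objV.1 ht, ?_⟩
    have hS : IsClosed (⋃ L : K.Index,
        pt ⁻¹' closure (R.Q L) ∩ {f : K.Mor | f.1.γ.TrivialOn L.1}) :=
      isClosed_iUnion_of_finite fun L =>
        (isClosed_closure.preimage continuous_pt).inter (isClosed_setOf_fst fun m => m.γ.TrivialOn L.1)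
    have hsub : (R.morV : Set K.Mor) ⊆ ⋃ L : K.Index,
        pt ⁻¹' closure (R.Q L) ∩ {f : K.Mor | f.1.γ.TrivialOn L.1} := fun f hf => by
      obtain ⟨L, -, -, h1, -, -, h4⟩ := mem_morV.1 hf
      exact mem_iUnion.2 ⟨L, subset_closure h1, h4⟩
    obtain ⟨L, h1, h2⟩ := mem_iUnion.1 (closure_minimal hsub hS hcl)
    exact ProdGroup.TrivialOn.mono h2 (low_le h1)
  · rintro ⟨hi, hj, hγ⟩
    refine ⟨?_, src_mem_objV.2 hi, tgt_mem_objV.2 hj⟩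
    obtain ⟨m, z⟩ := f
    refine mem_closure_iff.2 fun U hU hz => ?_
    have hU' : IsOpen (Sigma.mk m ⁻¹' U ∩ K.ψ m.union ⁻¹' (R.Q m.i ∩ R.Q m.j)) :=
      (isOpen_sigma_iff.1 hU m).inter
        (((R.isOpen_Q m.i).inter (R.isOpen_Q m.j)).preimage (K.continuous_ψ _))
    -- The footprints of a neighbourhood of `z` form an open set around a point of `closure (Q (low
    -- q))`.
    obtain ⟨_, ⟨z', ⟨hz', hi', hj'⟩, rfl⟩, hL⟩ := mem_closure_iff.1 (R.mem_closure_low (pt ⟨m, z⟩)) _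
      (isOpenMap_ψ _ _ hU') ⟨z, ⟨hz, hi, hj⟩, rfl⟩
    exact ⟨⟨m, z'⟩, hz', mem_morV.2 ⟨_, low_le' hi, low_le' hj, hL, hi', hj', hγ⟩⟩

lemma morV_subset_morVH : (R.morV : Set K.Mor) ⊆ R.morVH := fun f hf => by
  obtain ⟨L, -, -, h1, h2, h3, h4⟩ := mem_morV.1 hf
  exact mem_morVH.2 ⟨h2, h3, h4.mono (low_le' h1)⟩

lemma inv_mem_morVH {f : K.Mor} (hf : f ∈ R.morVH) : inv f ∈ R.morVH := by
  obtain ⟨h2, h3, h4⟩ := mem_morVH.1 hf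
  exact mem_morVH.2 (by rw [pt_inv]; exact ⟨h3, h2, trivialOn_inv h4⟩)

lemma comp_mem_morVH {f g : K.Mor} (h : tgt f = src g) (hf : f ∈ R.morVH) (hg : g ∈ R.morVH) :
    comp f g h ∈ R.morVH := by
  obtain ⟨h2, h3, h4⟩ := mem_morVH.1 hf
  obtain ⟨h2', h3', h4'⟩ := mem_morVH.1 hg
  rw [← pt_eq h] at h3' h4'
  exact mem_morVH.2 (by rw [pt_comp]; exact ⟨h2, h3', trivialOn_comp h (low_le' h3) h4 h4'⟩)

lemma eq_of_mem_morVH {f g : K.Mor} (hf : f ∈ R.morVH) (hg : g ∈ R.morVH) (hs : src f = src g)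
    (ht : tgt f = tgt g) : f = g := by
  obtain ⟨h2, h3, h4⟩ := mem_morVH.1 hf
  obtain ⟨-, -, h4'⟩ := mem_morVH.1 hg
  have : pt f = pt g := by rw [← footprintMap_src', hs, footprintMap_src']
  rw [← this] at h4'
  exact eq_of_src_tgt (low_le' h2) (low_le' h3) h4 h4' hs ht

/-- Source and target of the morphisms in the closed groupoid. -/
def endpoints (R : K.Reduction) (f : R.morVH) : R.objV × R.objV :=
  (⟨src f.1, f.2.2.1⟩, ⟨tgt f.1, f.2.2.2⟩)

/-- Injectivity is nonsingularity. The map is closed because the morphisms are the trace over `G_V`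
of a closed subset of `Mor`, and only finitely many components with comparable indices occur. In
particular the morphisms carry the topology induced by their endpoints. -/
lemma isClosedEmbedding_endpoints : IsClosedEmbedding R.endpoints := by
  refine .of_continuous_injective_isClosedMap ?_ ?_ ?_
  · exact ((isEtale_src.continuous.comp continuous_subtype_val).subtype_mk _).prodMk
      ((isEtale_tgt.continuous.comp continuous_subtype_val).subtype_mk _)
  · intro f g h
    have h1 := congrArg (fun p => p.1.1) h
    have h2 := congrArg (fun p => p.2.1) h
    exact Subtype.ext (eq_of_mem_morVH f.2 g.2 h1 h2)
  · rintro _ hC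
    obtain ⟨D, hD, rfl⟩ := isClosed_induced_iff.1 hC
    have h := isClosed_image_src_tgt
      ((hD.inter (isClosed_closure (s := (R.morV : Set K.Mor)))).inter
        (isClosed_setOf_fst (K := K) fun m => m.i ≤ m.j ∨ m.j ≤ m.i)) fun f hf => hf.2
    convert h.preimage (f := fun p : R.objV × R.objV => (p.1.1, p.2.1)) (by fun_prop) using 1
    ext ⟨x, y⟩
    constructor
    · rintro ⟨f, hf, hxy⟩
      obtain ⟨h2, h3, -⟩ := mem_morVH.1 f.2
      refine ⟨f.1, ⟨⟨hf, f.2.1⟩, le_or_le (subset_closure h2) (subset_closure h3)⟩, ?_⟩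
      rw [← hxy]; rfl
    · rintro ⟨f, ⟨⟨hf, hf'⟩, -⟩, hxy⟩
      obtain ⟨h1, h2⟩ := Prod.mk.inj hxy
      exact ⟨⟨f, hf', (h1 ▸ x.2 : src f ∈ R.objV), (h2 ▸ y.2 : tgt f ∈ R.objV)⟩, hf,
        Prod.ext (Subtype.ext h1) (Subtype.ext h2)⟩

/-- The groupoid given by a set of morphisms of the closed groupoid that contains the identities
and is closed under inversion and composition. -/
noncomputable def subgroupoid (R : K.Reduction) (p : K.Mor → Prop) (hp : ∀ f, p f → f ∈ R.morVH)
    (hone : ∀ x ∈ R.objV, p (one x)) (hinv : ∀ f, p f → p (inv f))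
    (hcomp : ∀ f g h, p f → p g → p (comp f g h)) : TopologicalGroupoid R.objV (Subtype p) :=
  .ofIsEmbedding (fun f => ⟨src f.1, (hp _ f.2).2.1⟩) (fun f => ⟨tgt f.1, (hp _ f.2).2.2⟩)
    (fun x => ⟨one x.1, hone _ x.2⟩) (fun f => ⟨inv f.1, hinv _ f.2⟩)
    (fun f g h => ⟨comp f.1 g.1 (congrArg Subtype.val h), hcomp _ _ _ f.2 g.2⟩)
    ((isClosedEmbedding_endpoints (R := R)).isEmbedding.comp
      (f := fun f : Subtype p => (⟨f.1, hp _ f.2⟩ : R.morVH))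
      (.of_comp (continuous_subtype_val.subtype_mk _) continuous_subtype_val .subtypeVal))
    (fun x => Subtype.ext (src_one x.1)) (fun x => Subtype.ext (tgt_one x.1))
    (fun f => Subtype.ext (src_inv f.1)) (fun f => Subtype.ext (tgt_inv f.1))
    (fun _ _ _ => Subtype.ext (src_comp _ _ _)) (fun _ _ _ => Subtype.ext (tgt_comp _ _ _))

section Subgroupoid

variable {p : K.Mor → Prop} {hp : ∀ f, p f → f ∈ R.morVH}
    {hone : ∀ x ∈ R.objV, p (one x)} {hinv : ∀ f, p f → p (inv f)}
    {hcomp : ∀ f g h, p f → p g → p (comp f g h)}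

lemma isSubgroupoid_subgroupoid :
    IsSubgroupoid (R.subgroupoid p hp hone hinv hcomp) Subtype.val Subtype.val where
  injective_obj := Subtype.val_injective
  injective_mor := Subtype.val_injective
  map_src _ := rfl
  map_tgt _ := rfl
  map_one _ := rfl
  map_inv _ := rfl
  map_comp _ _ _ _ := rfl

lemma nonsingular_subgroupoid : (R.subgroupoid p hp hone hinv hcomp).Nonsingular :=
  fun f g hs ht => Subtype.ext (eq_of_mem_morVH (hp _ f.2) (hp _ g.2)
    (congrArg Subtype.val hs) (congrArg Subtype.val ht))

/-- The morphisms need not form an open set here, so source and target are merely restrictions of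
étale maps to a subspace. -/
lemma isLocallyEmbedded_subgroupoid :
    (R.subgroupoid p hp hone hinv hcomp).IsLocallyEmbedded :=
  TopologicalGroupoid.isLocallyEmbedded _
    (.of_comp (TopologicalGroupoid.continuous_src _) continuous_subtype_val
      (isEtale_src.isLocalHomeomorph.isLocallyEmbedding.comp_isEmbedding .subtypeVal))
    (.of_comp (TopologicalGroupoid.continuous_tgt _) continuous_subtype_val
      (isEtale_tgt.isLocalHomeomorph.isLocallyEmbedding.comp_isEmbedding .subtypeVal))

end Subgroupoid

/-- The groupoid `V_K` as a topological groupoid. -/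
noncomputable def topGroupoidV (R : K.Reduction) : TopologicalGroupoid R.objV R.morV :=
  R.subgroupoid (· ∈ R.morV) (fun _ h => morV_subset_morVH h) (fun _ => one_mem_morV)
    (fun _ => inv_mem_morV) fun _ _ => comp_mem_morV

lemma isSubgroupoid_topGroupoidV :
    IsSubgroupoid R.topGroupoidV Subtype.val Subtype.val := isSubgroupoid_subgroupoid

lemma nonsingular_topGroupoidV : R.topGroupoidV.Nonsingular := nonsingular_subgroupoid

/-- The closed groupoid. -/
noncomputable def groupoidVH (R : K.Reduction) : TopologicalGroupoid R.objV R.morVH :=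
  R.subgroupoid (· ∈ R.morVH) (fun _ h => h) (fun _ h => morV_subset_morVH (one_mem_morV h))
    (fun _ => inv_mem_morVH) fun _ _ => comp_mem_morVH

end Low

lemma isEtale_src_topGroupoidV [Finite A] : IsEtale d (R.topGroupoidV).src :=
  .of_comp_left R.topGroupoidV.continuous_src (isEtale_subtypeVal R.objV)
    (isEtale_src.comp (isEtale_subtypeVal R.morV))

lemma isEtale_tgt_topGroupoidV [Finite A] : IsEtale d (R.topGroupoidV).tgt :=
  .of_comp_left R.topGroupoidV.continuous_tgt (isEtale_subtypeVal R.objV)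
    (isEtale_tgt.comp (isEtale_subtypeVal R.morV))

end Reduction

lemma paracompactSpace_opens {d : ℕ} {ι : Type*} [Countable ι] {M : ι → Type*}
    [∀ i, TopologicalSpace (M i)] [∀ i, ChartedSpace (EuclideanSpace ℝ (Fin d)) (M i)]
    [∀ i, T2Space (M i)] [∀ i, SecondCountableTopology (M i)]
    (U : TopologicalSpace.Opens (Σ i, M i)) : ParacompactSpace U := by
  have : LocallyCompactSpace U := ChartedSpace.locallyCompactSpace (EuclideanSpace ℝ (Fin d)) U
  infer_instance

end OrbifoldAtlas

/-! ### Orientation of `V_K` -/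

namespace OrientedOrbifoldAtlas

open OrbifoldAtlas

variable {d : ℕ} {A : Type uA} [DecidableEq A] {Y : Type uY} [TopologicalSpace Y]
  (K : OrientedOrbifoldAtlas.{uA, uY, uG, uW} d A Y)

/-- The orientation of the space of morphisms of the groupoid completion. -/
def orientMor : OrientationField d K.Mor :=
  OrientationField.sigma fun m : K.MorIndex => K.orient m.union

lemma isContinuous_orientObj : K.orientObj.IsContinuous :=
  OrientationField.isContinuous_sigma K.continuous_orient

lemma preservesOrientation_src : PreservesOrientation K.orientMor K.orientObj src :=
  preservesOrientation_sigma isEtale_src fun m =>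
    .comp (isEtale_sigmaMk m.i) ((isEtale_smul m.i (m.γ.tr m.i.1)⁻¹).comp (K.etale_ρ m.le_i))
      (preservesOrientation_sigmaMk K.orient m.i)
      (.comp (isEtale_smul m.i (m.γ.tr m.i.1)⁻¹) (K.etale_ρ m.le_i)
        (K.orient_action m.i _) (K.orient_ρ m.le_i))

lemma preservesOrientation_tgt : PreservesOrientation K.orientMor K.orientObj tgt :=
  preservesOrientation_sigma isEtale_tgt fun m =>
    .comp (isEtale_sigmaMk m.j) (K.etale_ρ m.le_j)
      (preservesOrientation_sigmaMk K.orient m.j) (K.orient_ρ m.le_j)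

variable {K} [Finite A] (R : K.Reduction)

lemma preservesOrientation_src_topGroupoidV :
    PreservesOrientation (K.orientMor.pullback (isEtale_subtypeVal R.morV))
      (K.orientObj.pullback (isEtale_subtypeVal R.objV)) R.topGroupoidV.src := by
  have h : Subtype.val ∘ R.topGroupoidV.src = src ∘ (Subtype.val : R.morV → K.Mor) := rfl
  refine .of_comp_left (isEtale_subtypeVal R.objV) Reduction.isEtale_src_topGroupoidV
    (preservesOrientation_pullback _ (isEtale_subtypeVal R.objV)) ?_
  rw [h]
  exact K.preservesOrientation_src.comp isEtale_src (isEtale_subtypeVal R.morV)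
    (preservesOrientation_pullback _ _)

lemma preservesOrientation_tgt_topGroupoidV :
    PreservesOrientation (K.orientMor.pullback (isEtale_subtypeVal R.morV))
      (K.orientObj.pullback (isEtale_subtypeVal R.objV)) R.topGroupoidV.tgt := by
  have h : Subtype.val ∘ R.topGroupoidV.tgt = tgt ∘ (Subtype.val : R.morV → K.Mor) := rfl
  refine .of_comp_left (isEtale_subtypeVal R.objV) Reduction.isEtale_tgt_topGroupoidV
    (preservesOrientation_pullback _ (isEtale_subtypeVal R.objV)) ?_
  rw [h]
  exact K.preservesOrientation_tgt.comp isEtale_tgt (isEtale_subtypeVal R.morV)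
    (preservesOrientation_pullback _ _)

/-- The groupoid `V_K`. -/
noncomputable def groupoidV : OrientedEtaleGroupoid d R.objV R.morV :=
  have : ParacompactSpace R.objV := paracompactSpace_opens (d := d) _
  have : ParacompactSpace R.morV := paracompactSpace_opens (d := d) _
  R.topGroupoidV.toOrientedEtaleGroupoid Reduction.isEtale_src_topGroupoidV
    Reduction.isEtale_tgt_topGroupoidV
    (K.orientObj.pullback (isEtale_subtypeVal R.objV))
    (K.orientMor.pullback (isEtale_subtypeVal R.morV))
    ((preservesOrientation_pullback _ _).isContinuous (isEtale_subtypeVal R.objV)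
      K.isContinuous_orientObj)
    (preservesOrientation_src_topGroupoidV R) (preservesOrientation_tgt_topGroupoidV R)

end OrientedOrbifoldAtlas

/-! ### The realization of the closed groupoid -/

namespace OrbifoldAtlas.Reduction

variable {d : ℕ} {A : Type uA} [DecidableEq A] {Y : Type uY} [TopologicalSpace Y]
  {K : OrbifoldAtlas.{uA, uY, uG, uW} d A Y}

/-- Two objects are related if there is a morphism of the closed groupoid between them. -/
def RelH (R : K.Reduction) (x y : K.Obj) : Prop := ∃ f ∈ R.morVH, src f = x ∧ tgt f = y

lemma RelH.footprintMap_eq {R : K.Reduction} {x y : K.Obj} (h : R.RelH x y) :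
    K.footprintMap x = K.footprintMap y := by
  obtain ⟨f, -, rfl, rfl⟩ := h
  rw [footprintMap_src', footprintMap_tgt']

lemma RelH.mem_left {R : K.Reduction} {x y : K.Obj} (h : R.RelH x y) : x ∈ R.objV := by
  obtain ⟨f, hf, rfl, rfl⟩ := h
  exact hf.2.1

lemma RelH.mem_right {R : K.Reduction} {x y : K.Obj} (h : R.RelH x y) : y ∈ R.objV := by
  obtain ⟨f, hf, rfl, rfl⟩ := h
  exact hf.2.2

variable {R : K.Reduction}

/-- Objects over `Q J` are isomorphic in `V_K` to objects in `V_J`. -/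
lemma exists_morV_to {I J : K.Index} {x : K.W I} (hI : K.ψ I x ∈ R.Q I) (hJ : K.ψ I x ∈ R.Q J) :
    ∃ x' : K.W J, K.ψ J x' = K.ψ I x ∧ ∃ f ∈ R.morV, src f = ⟨I, x⟩ ∧ tgt f = ⟨J, x'⟩ := by
  have hF : ∀ a ∈ I.1 ∪ J.1, K.ψ I x ∈ K.F a := fun a ha => by
    rcases Finset.mem_union.1 ha with h | h
    · exact ψ_mem_F I x h
    · have := R.closure_subset J (subset_closure hJ)
      simp only [mem_iInter] at this
      exact this a h
  let m : K.MorIndex := ⟨I, J, ⟨K.ψ I x, by simpa using fun a ha => hF a (Finset.mem_union.2 ha)⟩, 1⟩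
  obtain ⟨z, hz⟩ := exists_ρ_eq m.le_i x hF
  have hψz : K.ψ m.union z = K.ψ I x := by rw [← hz]; exact (K.ψ_ρ m.le_i z).symm
  have hpt : pt (⟨m, z⟩ : K.Mor) = K.ψ I x := hψz
  refine ⟨K.ρ m.le_j z, (K.ψ_ρ _ _).trans hψz, ⟨m, z⟩, mem_morV.2 ?_, ?_, rfl⟩
  · rw [hpt]
    -- The smaller of `I` and `J` is a witness, as the group component is `1`.
    rcases le_or_le (subset_closure hI) (subset_closure hJ) with h | h
    · exact ⟨I, le_rfl, h, hI, hI, hJ, .one⟩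
    · exact ⟨J, h, le_rfl, hJ, hI, hJ, .one⟩
  · refine congrArg (Sigma.mk I) ?_
    have h1 : ((1 : ProdGroup K.Γ (I.1 ∩ J.1)).tr I.1)⁻¹ = 1 := by rw [ProdGroup.tr_one, inv_one]
    exact (congrArg (fun δ : ProdGroup K.Γ I.1 => δ • K.ρ m.le_i z) h1).trans
      ((one_smul _ _).trans hz)

/-- The subset of the space of objects given by a subset of `W_J`. -/
def inPart (R : K.Reduction) (J : K.Index) (O : Set (K.W J)) : Set R.objV :=
  {x | x.1 ∈ Sigma.mk J '' O}

lemma isOpen_inPart {J : K.Index} {O : Set (K.W J)} (hO : IsOpen O) : IsOpen (R.inPart J O) :=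
  (IsOpenEmbedding.sigmaMk.isOpenMap _ hO).preimage continuous_subtype_val

lemma mem_image_inPart {J : K.Index} {O : Set (K.W J)} {Z : Type*} {π : R.objV → Z} {p : Z} :
    p ∈ π '' R.inPart J O ↔ ∃ u ∈ O, ∃ hu : (⟨J, u⟩ : K.Obj) ∈ R.objV, π ⟨⟨J, u⟩, hu⟩ = p := by
  constructor
  · rintro ⟨⟨_, hu⟩, ⟨u, huO, rfl⟩, h⟩
    exact ⟨u, huO, hu, h⟩
  · rintro ⟨u, huO, hu, h⟩
    exact ⟨_, ⟨u, huO, rfl⟩, h⟩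

/-- A map that identifies exactly the objects that are isomorphic in the closed groupoid. -/
structure IsRealization {Z : Type*} [TopologicalSpace Z] (π : R.objV → Z) : Prop where
  isQuotientMap : IsQuotientMap π
  eq_iff : ∀ x y, π x = π y ↔ R.RelH x.1 y.1

namespace IsRealization

variable {Z : Type*} [TopologicalSpace Z] {π : R.objV → Z}

lemma exists_continuous_footprint (hπ : IsRealization π) :
    ∃ φ : Z → Y, Continuous φ ∧ ∀ x, φ (π x) = K.footprintMap x.1 := by
  let g : C(R.objV, Y) :=
    ⟨fun x => K.footprintMap x.1, K.continuous_footprintMap.comp continuous_subtype_val⟩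
  have hg : Function.FactorsThrough g π := fun x y h =>
    ((hπ.eq_iff _ _).1 h).footprintMap_eq
  refine ⟨hπ.isQuotientMap.lift (f := ⟨π, hπ.isQuotientMap.continuous⟩) g hg,
    ContinuousMap.continuous _, fun x => ?_⟩
  exact DFunLike.congr_fun
    (hπ.isQuotientMap.lift_comp (f := ⟨π, hπ.isQuotientMap.continuous⟩) g hg) x

end IsRealization

variable [Finite A]

/-- Lifting both endpoints to a common chart `W_J` turns the closed groupoid into the action of
`Γ_{J ∖ low}`. The choice of lifts is harmless: two lifts to `W_J` of a point of `W_I` differ by an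
element of `Γ_{J ∖ I}`, and `low ⊆ I`. -/
lemma relH_iff {I I' J : K.Index} (h : I ≤ J) (h' : I' ≤ J) {w w' : K.W J}
    (hw : K.ψ J w ∈ R.Q I) (hw' : K.ψ J w' ∈ R.Q I') :
    R.RelH ⟨I, K.ρ h w⟩ ⟨I', K.ρ h' w'⟩ ↔
      ∃ γ : ProdGroup K.Γ J.1, γ.TrivialOn (R.low (K.ψ J w)).1 ∧ γ • w = w' := by
  constructor
  · rintro ⟨⟨⟨i, j, hn, γ⟩, z⟩, hf, hs, ht⟩
    obtain rfl : i = I := congrArg Sigma.fst hs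
    obtain rfl : j = I' := congrArg Sigma.fst ht
    obtain ⟨-, -, hγ⟩ := mem_morVH.1 hf
    have hpt : pt ⟨⟨i, j, hn, γ⟩, z⟩ = K.ψ J w := by
      rw [← footprintMap_src', hs]; exact K.ψ_ρ _ _
    rw [hpt] at hγ
    let m : K.MorIndex := ⟨i, j, hn, γ⟩
    have hU : m.union ≤ J := Finset.union_subset h h'
    obtain ⟨u, rfl⟩ := exists_ρ_eq hU z fun a ha => by
      have : K.ψ m.union z = K.ψ J w := hpt
      rw [this]
      exact ψ_mem_F J w ha
    have hs' : (γ.tr i.1)⁻¹ • K.ρ m.le_i (K.ρ hU u) = K.ρ h w := eq_of_heq (Sigma.mk.inj hs).2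
    have ht' : K.ρ m.le_j (K.ρ hU u) = K.ρ h' w' := eq_of_heq (Sigma.mk.inj ht).2
    have hs'' : K.ρ h (γ.tr J.1 • w) = K.ρ h u := by
      rw [K.equivariant_ρ, ProdGroup.tr_tr _ fun a ha _ => h ha, ← hs', smul_inv_smul]
      exact K.ρ_ρ _ _ _
    have ht'' : K.ρ h' u = K.ρ h' w' := (K.ρ_ρ _ _ _).symm.trans ht'
    obtain ⟨β, hβ, hβu⟩ := (K.ρ_eq_iff _ _ _).1 hs''
    obtain ⟨β', hβ', rfl⟩ := (K.ρ_eq_iff _ _ _).1 ht''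
    -- The group component of the morphism, corrected by the ambiguities `β`, `β'` of the lifts of
    -- source and target.
    refine ⟨β' * β * γ.tr J.1, ((hβ'.mono ?_).mul (hβ.mono ?_)).mul (hγ.tr _), ?_⟩
    · have : K.ψ J (β' • u) = K.ψ J w := by rw [K.ψ_smul, ← hβu, K.ψ_smul, K.ψ_smul]
      exact low_le' (this ▸ hw')
    · exact low_le' hw
    · rw [mul_smul, mul_smul, hβu]
  · rintro ⟨γ, hγ, rfl⟩
    rw [K.ψ_smul] at hw'
    have hU : I.1 ∪ I'.1 ⊆ J.1 := Finset.union_subset h h'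
    let m : K.MorIndex := ⟨I, I', ⟨K.ψ J w, by
      simpa using fun a ha => ψ_mem_F J w (hU (Finset.mem_union.2 ha))⟩, γ.tr _⟩
    have hUJ : m.union ≤ J := hU
    have hz : ∀ {L : K.Index} (hL : L ≤ m.union) (hLJ : L ≤ J),
        K.ρ hL (K.ρ hUJ ((γ.tr I'.1).tr J.1 • w)) = ((γ.tr I'.1).tr J.1).tr L.1 • K.ρ hLJ w :=
      fun hL hLJ => (K.ρ_ρ _ _ _).trans (K.equivariant_ρ _ _ _)
    -- The part of `γ` in `Γ_{I'}` moves the lift so that the target is the image of `γ w`; the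
    -- component in `Γ_{I ∩ I'}` undoes its effect on the source.
    let f : K.Mor := ⟨m, K.ρ hUJ ((γ.tr I'.1).tr J.1 • w)⟩
    have hpt : pt f = K.ψ J w := (K.ψ_ρ _ _).trans (K.ψ_smul _ _ _)
    refine ⟨f, mem_morVH.2 ?_, ?_, ?_⟩
    · rw [hpt]
      exact ⟨hw, hw', hγ.tr _⟩
    · refine congrArg (Sigma.mk I) ?_
      have h1 : ((γ.tr I'.1).tr J.1).tr I.1 = (γ.tr (I.1 ∩ I'.1)).tr I.1 := by
        funext a
        have haJ := h a.2
        simp [ProdGroup.tr_apply, haJ]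
      have h2 := hz m.le_i h
      rw [h1] at h2
      exact (congrArg (fun x : K.W I => ((γ.tr (I.1 ∩ I'.1)).tr I.1)⁻¹ • x) h2).trans
        (inv_smul_smul _ _)
    · refine congrArg (Sigma.mk I') ((hz m.le_j h').trans ?_)
      rw [K.equivariant_ρ, ProdGroup.tr_tr _ fun a ha _ => h' ha, ProdGroup.tr_self]

lemma relH_iff_same {J : K.Index} {w w' : K.W J} (hw : K.ψ J w ∈ R.Q J) (hw' : K.ψ J w' ∈ R.Q J) :
    R.RelH ⟨J, w⟩ ⟨J, w'⟩ ↔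
      ∃ γ : ProdGroup K.Γ J.1, γ.TrivialOn (R.low (K.ψ J w)).1 ∧ γ • w = w' := by
  have := relH_iff le_rfl le_rfl hw hw'
  rwa [K.ρ_self, K.ρ_self] at this

/-! #### Saturated sets -/

/-- `O ⊆ W_J` is saturated for the relation induced by the closed groupoid. -/
def Saturated (R : K.Reduction) {J : K.Index} (O : Set (K.W J)) : Prop :=
  ∀ u ∈ O, ∀ γ : ProdGroup K.Γ J.1, γ.TrivialOn (R.low (K.ψ J u)).1 → γ • u ∈ O

/-- The largest saturated subset of `O ⊆ W_J`. -/
def core (R : K.Reduction) {J : K.Index} (O : Set (K.W J)) : Set (K.W J) :=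
  {u | ∀ γ : ProdGroup K.Γ J.1, γ.TrivialOn (R.low (K.ψ J u)).1 → γ • u ∈ O}

lemma core_subset {J : K.Index} (O : Set (K.W J)) : R.core O ⊆ O := fun u hu => by
  simpa using hu 1 .one

lemma saturated_core {J : K.Index} (O : Set (K.W J)) :
    R.Saturated (R.core O) := fun u hu γ hγ δ hδ => by
  rw [K.ψ_smul] at hδ
  rw [← mul_smul]
  exact hu _ (hδ.mul hγ)

/-- A point is outside the core when some `γ ∈ Γ_{J ∖ L}` with `q ∈ closure (Q L)` moves it out of
`O`. It suffices to consider all such `L`, because `low q ⊆ L`; this exhibits the complement as a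
finite union of closed sets. -/
lemma isOpen_core {J : K.Index} {O : Set (K.W J)} (hO : IsOpen O) : IsOpen (R.core O) := by
  have : (R.core O)ᶜ = ⋃ (γ : ProdGroup K.Γ J.1) (L : {L : K.Index // γ.TrivialOn L.1}),
      K.ψ J ⁻¹' closure (R.Q L.1) ∩ (fun u => γ • u) ⁻¹' Oᶜ := by
    ext u
    simp only [core, mem_compl_iff, mem_ofPred_eq, not_forall, mem_iUnion, mem_inter_iff,
      mem_preimage, exists_prop]
    constructor
    · rintro ⟨γ, hγ, hu⟩
      exact ⟨γ, ⟨_, hγ⟩, R.mem_closure_low _, hu⟩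
    · rintro ⟨γ, ⟨L, hγ⟩, hL, hu⟩
      exact ⟨γ, hγ.mono (low_le hL), hu⟩
  rw [← isClosed_compl_iff, this]
  exact isClosed_iUnion_of_finite fun γ => isClosed_iUnion_of_finite fun L =>
    (isClosed_closure.preimage (K.continuous_ψ J)).inter
      (hO.isClosed_compl.preimage (K.continuous_smul J γ))

lemma Saturated.inter_preimage {J : K.Index} {O : Set (K.W J)} (hO : R.Saturated O) (N : Set Y) :
    R.Saturated (O ∩ K.ψ J ⁻¹' N) := fun u hu γ hγ =>
  ⟨hO u hu.1 γ hγ, by rw [mem_preimage, K.ψ_smul]; exact hu.2⟩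

/-- In `W_I` the set is the image under `ρ_{IJ}` of an open set if `I ⊆ J`, the preimage of `O`
under `ρ_{JI}` within `V_I` if `J ⊆ I`, and empty otherwise. -/
lemma isOpen_setOf_relH {J : K.Index} {O : Set (K.W J)} (hO : IsOpen O) (hOV : O ⊆ R.V J)
    (hsat : R.Saturated O) : IsOpen {x : K.Obj | ∃ u ∈ O, R.RelH x ⟨J, u⟩} := by
  refine isOpen_sigma_iff.2 fun I => ?_
  by_cases hIJ : I ≤ J
  · convert IsLocalHomeomorph.isOpenMap ((K.etale_ρ hIJ).isLocalHomeomorph) _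
      (hO.inter ((R.isOpen_Q I).preimage (K.continuous_ψ J))) using 1
    ext v
    simp only [mem_preimage, mem_ofPred_eq, mem_image, mem_inter_iff]
    constructor
    · rintro ⟨u, hu, h⟩
      have hψ : K.ψ I v = K.ψ J u := h.footprintMap_eq
      obtain ⟨w, rfl⟩ := exists_ρ_eq hIJ v fun a ha => by rw [hψ]; exact ψ_mem_F J u ha
      have hw : K.ψ J w ∈ R.Q I := by
        rw [← K.ψ_ρ hIJ]; exact h.mem_left
      have hwu : K.ψ J w = K.ψ J u := by rw [← hψ, K.ψ_ρ]
      rw [← K.ρ_self (le_refl J) u, relH_iff hIJ le_rfl hw (hOV hu)] at h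
      obtain ⟨γ, hγ, rfl⟩ := h
      refine ⟨w, ⟨?_, hw⟩, rfl⟩
      have := hsat _ hu γ⁻¹ (by rw [K.ψ_smul]; exact hγ.inv)
      rwa [inv_smul_smul] at this
    · rintro ⟨w, ⟨hwO, hw⟩, rfl⟩
      refine ⟨w, hwO, ?_⟩
      have := (relH_iff hIJ le_rfl hw (hOV hwO)).2 ⟨1, .one, one_smul _ _⟩
      rwa [K.ρ_self] at this
  · by_cases hJI : J ≤ I
    · convert (hO.preimage (K.continuous_ρ hJI)).inter (R.isOpen_V I) using 1
      ext v
      simp only [mem_preimage, mem_ofPred_eq, mem_inter_iff]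
      constructor
      · rintro ⟨u, hu, h⟩
        have hψ : K.ψ I v = K.ψ J u := h.footprintMap_eq
        obtain ⟨w, rfl⟩ := exists_ρ_eq hJI u fun a ha => by rw [← hψ]; exact ψ_mem_F I v ha
        have hv : K.ψ I v ∈ R.Q I := h.mem_left
        have hw : K.ψ I w ∈ R.Q J := by rw [← K.ψ_ρ hJI]; exact hOV hu
        rw [← K.ρ_self (le_refl I) v, relH_iff le_rfl hJI hv hw] at h
        obtain ⟨γ, hγ, rfl⟩ := h
        refine ⟨?_, hv⟩
        have := hsat _ hu (γ⁻¹.tr J.1) (by rw [← hψ]; exact hγ.inv.tr _)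
        rwa [← K.equivariant_ρ, inv_smul_smul] at this
      · rintro ⟨hv, hv'⟩
        refine ⟨_, hv, ?_⟩
        have := (relH_iff (w := v) (w' := v) le_rfl hJI hv'
          (by rw [← K.ψ_ρ hJI]; exact hOV hv)).2 ⟨1, .one, one_smul _ _⟩
        rwa [K.ρ_self] at this
    · convert isOpen_empty using 1
      refine eq_empty_of_forall_notMem ?_
      rintro v ⟨u, hu, h⟩
      have hψ : K.ψ I v = K.ψ J u := h.footprintMap_eq
      have hv : K.ψ I v ∈ R.Q I := h.mem_left
      rw [hψ] at hv
      exact (le_or_le (subset_closure hv) (subset_closure (hOV hu))).elim hIJ hJI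

/-! ### Open images and the Hausdorff property -/

namespace IsRealization

variable {Z : Type*} [TopologicalSpace Z] {π : R.objV → Z}

lemma eq_iff_same (hπ : IsRealization π) {J : K.Index} {w w' : K.W J}
    (hw : (⟨J, w⟩ : K.Obj) ∈ R.objV) (hw' : (⟨J, w'⟩ : K.Obj) ∈ R.objV) :
    π ⟨⟨J, w⟩, hw⟩ = π ⟨⟨J, w'⟩, hw'⟩ ↔
      ∃ γ : ProdGroup K.Γ J.1, γ.TrivialOn (R.low (K.ψ J w)).1 ∧ γ • w = w' := by
  rw [hπ.eq_iff, relH_iff_same hw hw']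

lemma isOpen_image_inPart (hπ : IsRealization π) {J : K.Index} {O : Set (K.W J)} (hO : IsOpen O)
    (hOV : O ⊆ R.V J) (hsat : R.Saturated O) : IsOpen (π '' R.inPart J O) := by
  rw [← hπ.isQuotientMap.isOpen_preimage]
  convert (isOpen_setOf_relH hO hOV hsat).preimage
    (continuous_subtype_val (p := fun x => x ∈ R.objV)) using 1
  ext x
  simp only [mem_preimage, mem_image, mem_ofPred_eq]
  constructor
  · rintro ⟨⟨_, hu⟩, ⟨u, huO, rfl⟩, h⟩
    exact ⟨u, huO, (hπ.eq_iff _ _).1 h.symm⟩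
  · rintro ⟨u, huO, h⟩
    exact ⟨⟨⟨J, u⟩, h.mem_right⟩, ⟨u, huO, rfl⟩, ((hπ.eq_iff _ _).2 h).symm⟩

/-- Every point over `Q J` is represented in `V_J`. -/
lemma exists_rep (hπ : IsRealization π) (x : R.objV) {J : K.Index}
    (hJ : K.footprintMap x.1 ∈ R.Q J) : ∃ (u : K.W J) (hu : (⟨J, u⟩ : K.Obj) ∈ R.objV),
      π ⟨⟨J, u⟩, hu⟩ = π x ∧ K.ψ J u = K.footprintMap x.1 ∧
        ∃ f ∈ R.morV, src f = x.1 ∧ tgt f = ⟨J, u⟩ := by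
  obtain ⟨⟨I, v⟩, hv⟩ := x
  obtain ⟨u, hu, f, hf, hs, ht⟩ := exists_morV_to hv hJ
  exact ⟨u, mem_objV.2 (hu.symm ▸ hJ : K.ψ J u ∈ R.Q J),
    ((hπ.eq_iff _ _).2 ⟨f, morV_subset_morVH hf, hs, ht⟩).symm, hu, f, hf, hs, ht⟩

/-- Points with different footprints are separated by `Y`. Otherwise both have representatives in
the same `V_J`, whose classes are disjoint finite orbits of one group. Disjoint neighbourhoods of
the orbits have saturated open cores with disjoint images. -/
lemma t2Space [T2Space Y] (hπ : IsRealization π) : T2Space Z := by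
  obtain ⟨φ, hφ, hφπ⟩ := hπ.exists_continuous_footprint
  refine ⟨fun p p' hp => ?_⟩
  by_cases hpp : φ p = φ p'
  swap
  · exact separated_by_continuous hφ hpp
  obtain ⟨⟨⟨J, w⟩, hw⟩, rfl⟩ := hπ.isQuotientMap.surjective p
  obtain ⟨x', rfl⟩ := hπ.isQuotientMap.surjective p'
  rw [hφπ, hφπ] at hpp
  obtain ⟨w', hw', hπw', hψ, -⟩ := hπ.exists_rep x' (J := J) (hpp ▸ hw)
  rw [← hπw', Ne, hπ.eq_iff_same hw hw'] at hp
  rw [← hπw']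
  have hfin : ∀ u : K.W J, ((fun γ : ProdGroup K.Γ J.1 => γ • u) ''
      {γ | γ.TrivialOn (R.low (K.ψ J u)).1}).Finite := fun u => toFinite _
  have hψ' : K.ψ J w = K.ψ J w' := hpp.trans hψ.symm
  obtain ⟨B, B', hB, hB', hwB, hwB', hBB'⟩ := SeparatedNhds.of_isCompact_isCompact
    (hfin w).isCompact (hfin w').isCompact (by
      rw [Set.disjoint_left]
      rintro _ ⟨γ, hγ, rfl⟩ ⟨γ', hγ', h⟩
      rw [← hψ'] at hγ'
      refine hp ⟨γ'⁻¹ * γ, ProdGroup.TrivialOn.mul (ProdGroup.TrivialOn.inv hγ') hγ, ?_⟩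
      rw [mul_smul, inv_smul_eq_iff]
      exact h.symm)
  have hmem : ∀ {u : K.W J} {B : Set (K.W J)}, (fun γ : ProdGroup K.Γ J.1 => γ • u) ''
      {γ | γ.TrivialOn (R.low (K.ψ J u)).1} ⊆ B → u ∈ R.core B :=
    fun h γ hγ => h ⟨γ, hγ, rfl⟩
  have hopen : ∀ {B : Set (K.W J)}, IsOpen B →
      IsOpen (π '' R.inPart J (R.core B ∩ K.ψ J ⁻¹' R.Q J)) := fun hB =>
    hπ.isOpen_image_inPart ((isOpen_core hB).inter (R.isOpen_V J)) inter_subset_right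
      ((saturated_core _).inter_preimage _)
  refine ⟨_, _, hopen hB, hopen hB', mem_image_inPart.2 ⟨w, ⟨hmem hwB, hw⟩, hw, rfl⟩,
    mem_image_inPart.2 ⟨w', ⟨hmem hwB', hw'⟩, hw', rfl⟩, ?_⟩
  rw [Set.disjoint_left]
  rintro p hp hp'
  obtain ⟨u, ⟨huB, -⟩, hu, rfl⟩ := mem_image_inPart.1 hp
  obtain ⟨u', ⟨huB', -⟩, hu', h⟩ := mem_image_inPart.1 hp'
  obtain ⟨γ, hγ, rfl⟩ := (hπ.eq_iff_same hu hu').1 h.symm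
  exact Set.disjoint_left.1 hBB' (huB γ hγ) (core_subset _ huB')

end IsRealization

end OrbifoldAtlas.Reduction

/-! ### Local branches -/

namespace OrbifoldAtlas.Reduction

variable {d : ℕ} {A : Type uA} [DecidableEq A] {Y : Type uY} [TopologicalSpace Y]
  {K : OrbifoldAtlas.{uA, uY, uG, uW} d A Y} {R : K.Reduction}

/-- The translate `γ O`. -/
def translate {J : K.Index} {G : Subgroup (ProdGroup K.Γ J.1)} (O : Set (K.W J)) (γ : G) :
    Set (K.W J) := (fun u => (γ.1)⁻¹ • u) ⁻¹' O

/-- The union of the translates of `O` by the elements of `G`. -/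
def sweep {J : K.Index} (G : Subgroup (ProdGroup K.Γ J.1)) (O : Set (K.W J)) : Set (K.W J) :=
  ⋃ γ : G, translate O γ

lemma smul_mem_translate {J : K.Index} {G : Subgroup (ProdGroup K.Γ J.1)} {O : Set (K.W J)}
    {γ : G} {u : K.W J} (δ : G) (hu : u ∈ translate O γ) : δ.1 • u ∈ translate O (δ * γ) := by
  change (δ.1 * γ.1)⁻¹ • δ.1 • u ∈ O
  rw [mul_inv_rev, mul_smul, inv_smul_smul]
  exact hu

lemma mem_inPart {J : K.Index} {O : Set (K.W J)} {y : R.objV} :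
    y ∈ R.inPart J O ↔ ∃ u ∈ O, ∃ hu : (⟨J, u⟩ : K.Obj) ∈ R.objV, y = ⟨⟨J, u⟩, hu⟩ := by
  constructor
  · obtain ⟨_, hy⟩ := y
    rintro ⟨u, huO, rfl⟩
    exact ⟨u, huO, hy, rfl⟩
  · rintro ⟨u, huO, hu, rfl⟩
    exact ⟨u, huO, rfl⟩

variable [Finite A]

/-- Near `q`, all `low q'` contain `low q`. -/
lemma exists_nhds_low_le (R : K.Reduction) (q : Y) :
    ∃ N : Set Y, IsOpen N ∧ q ∈ N ∧ ∀ q' ∈ N, R.low q ≤ R.low q' := by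
  refine ⟨⋂ L : {L : K.Index // q ∉ closure (R.Q L)}, (closure (R.Q L.1))ᶜ,
    isOpen_iInter_of_finite fun L => isClosed_closure.isOpen_compl, mem_iInter.2 fun L => L.2,
    fun q' hq' => low_le ?_⟩
  by_contra h
  exact mem_iInter.1 hq' ⟨_, h⟩ (R.mem_closure_low q')

lemma eq_one_of_smul_eq {J : K.Index} {x : K.W J} (hx : K.ψ J x ∈ R.Q J) {γ : ProdGroup K.Γ J.1}
    (hγ : γ.TrivialOn (R.low (K.ψ J x)).1) (h : γ • x = x) : γ = 1 :=
  K.free_of_trivialOn (low_le' hx) γ hγ x h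

/-- An open subset `O ⊆ V_J` that is disjoint from its translates by the elements of `G` other than
`1`, where `G` contains all `γ ∈ Γ_J` that act as morphisms of the closed groupoid over `O`. -/
structure IsSlice (R : K.Reduction) {J : K.Index} (G : Subgroup (ProdGroup K.Γ J.1))
    (O : Set (K.W J)) : Prop where
  isOpen : IsOpen O
  subset_V : O ⊆ R.V J
  mem_of_trivialOn : ∀ u ∈ O, ∀ δ : ProdGroup K.Γ J.1, δ.TrivialOn (R.low (K.ψ J u)).1 → δ ∈ G
  eq_one : ∀ γ ∈ G, ∀ u ∈ O, γ • u ∈ O → γ = 1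

/-- The group `Γ_{J ∖ low}` of `x` acts freely at `x`, so `x` can be separated from its other
translates. Shrinking `O` so that `low` does not drop keeps the groups at nearby points inside this
one. -/
lemma exists_isSlice [T2Space Y] {J : K.Index} {x : K.W J} (hx : K.ψ J x ∈ R.Q J) :
    ∃ O, x ∈ O ∧ R.IsSlice (ProdGroup.trivialOnSubgroup K.Γ (R.low (K.ψ J x)).1 J.1) O := by
  obtain ⟨N, hN, hqN, hNlow⟩ := R.exists_nhds_low_le (K.ψ J x)
  let G := {γ : ProdGroup K.Γ J.1 // γ.TrivialOn (R.low (K.ψ J x)).1 ∧ γ ≠ 1}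
  have hG : ∀ γ : G, ∃ B B' : Set (K.W J), IsOpen B ∧ IsOpen B' ∧ x ∈ B ∧ γ.1 • x ∈ B' ∧
      Disjoint B B' := fun γ =>
    t2_separation fun h => γ.2.2 (eq_one_of_smul_eq hx γ.2.1 h.symm)
  choose B B' hB hB' hxB hxB' hBB' using hG
  refine ⟨K.ψ J ⁻¹' (N ∩ R.Q J) ∩ ⋂ γ : G, (B γ ∩ (fun u => γ.1 • u) ⁻¹' B' γ),
    ⟨⟨hqN, hx⟩, mem_iInter.2 fun γ => ⟨hxB γ, hxB' γ⟩⟩,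
    ((hN.inter (R.isOpen_Q J)).preimage (K.continuous_ψ J)).inter
      (isOpen_iInter_of_finite fun γ => (hB γ).inter ((hB' γ).preimage (K.continuous_smul J γ.1))),
    fun u hu => hu.1.2, fun u hu δ hδ => hδ.mono (hNlow _ hu.1.1), fun γ hγ u hu hγu => ?_⟩
  by_contra h1
  have h2 := (mem_iInter.1 hu.2 ⟨γ, hγ, h1⟩).2
  have h3 := (mem_iInter.1 hγu.2 ⟨γ, hγ, h1⟩).1
  exact Set.disjoint_left.1 (hBB' _) h3 h2

namespace IsSlice

variable {J : K.Index} {G : Subgroup (ProdGroup K.Γ J.1)} {O : Set (K.W J)}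

lemma isOpen_translate (h : R.IsSlice G O) (γ : G) : IsOpen (translate O γ) :=
  h.isOpen.preimage (K.continuous_smul J _)

lemma isOpen_sweep (h : R.IsSlice G O) : IsOpen (sweep G O) := isOpen_iUnion h.isOpen_translate

lemma sweep_subset (h : R.IsSlice G O) : sweep G O ⊆ R.V J := iUnion_subset fun γ u hu => by
  have : K.ψ J ((γ.1)⁻¹ • u) ∈ R.Q J := h.subset_V hu
  rwa [K.ψ_smul] at this

lemma eq_of_mem (h : R.IsSlice G O) {γ γ' : G} {u : K.W J} (hu : u ∈ translate O γ)
    (hu' : u ∈ translate O γ') : γ = γ' := by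
  have h1 : ((γ'.1)⁻¹ * γ.1) • (γ.1)⁻¹ • u ∈ O := by
    rw [mul_smul, smul_inv_smul]; exact hu'
  have h2 := h.eq_one _ ((γ'⁻¹ * γ).2) _ hu h1
  exact Subtype.ext (inv_mul_eq_one.1 h2).symm

lemma mem_of_mem_sweep (h : R.IsSlice G O) {u : K.W J} {δ : ProdGroup K.Γ J.1}
    (hu : u ∈ sweep G O) (hδ : δ.TrivialOn (R.low (K.ψ J u)).1) : δ ∈ G := by
  obtain ⟨γ, hγ⟩ := mem_iUnion.1 hu
  refine h.mem_of_trivialOn _ hγ δ ?_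
  rwa [K.ψ_smul]

lemma saturated_sweep (h : R.IsSlice G O) : R.Saturated (sweep G O) := fun u hu δ hδ => by
  obtain ⟨γ, hγ⟩ := mem_iUnion.1 hu
  exact mem_iUnion.2 ⟨_, smul_mem_translate ⟨δ, h.mem_of_mem_sweep hu hδ⟩ hγ⟩

variable {Z : Type*} [TopologicalSpace Z] {π : R.objV → Z}

lemma isOpen_image (h : R.IsSlice G O) (hπ : IsRealization π) :
    IsOpen (π '' R.inPart J (sweep G O)) :=
  hπ.isOpen_image_inPart h.isOpen_sweep h.sweep_subset h.saturated_sweep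

lemma mem_sweep (h : R.IsSlice G O) (hπ : IsRealization π) {u : K.W J}
    (hu : (⟨J, u⟩ : K.Obj) ∈ R.objV) (hπu : π ⟨⟨J, u⟩, hu⟩ ∈ π '' R.inPart J (sweep G O)) :
    u ∈ sweep G O := by
  obtain ⟨t, htT, ht, ht'⟩ := mem_image_inPart.1 hπu
  obtain ⟨δ, hδ, rfl⟩ := (hπ.eq_iff_same ht hu).1 ht'
  exact h.saturated_sweep t htT δ hδ

/-- Equivalent points of a branch agree. -/
lemma eq_of_π_eq (h : R.IsSlice G O) (hπ : IsRealization π) {γ : G} {u u' : K.W J}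
    (hu : (⟨J, u⟩ : K.Obj) ∈ R.objV) (hu' : (⟨J, u'⟩ : K.Obj) ∈ R.objV)
    (hγ : u ∈ translate O γ) (hγ' : u' ∈ translate O γ) (hπu : π ⟨⟨J, u⟩, hu⟩ = π ⟨⟨J, u'⟩, hu'⟩) :
    u = u' := by
  obtain ⟨δ, hδ, rfl⟩ := (hπ.eq_iff_same hu hu').1 hπu
  have hδG := h.mem_of_mem_sweep (mem_iUnion.2 ⟨γ, hγ⟩) hδ
  have h1 : (⟨δ, hδG⟩ * γ : G) = γ := h.eq_of_mem (smul_mem_translate ⟨δ, hδG⟩ hγ) hγ'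
  have h2 : δ = 1 := congrArg Subtype.val (mul_eq_right.1 h1)
  rw [h2, one_smul]

/-- The images of relatively closed subsets of a branch are relatively closed. -/
lemma exists_isClosed (h : R.IsSlice G O) (hπ : IsRealization π) (γ : G) (E : Set K.Obj)
    (hE : IsOpen E) : ∃ C : Set Z, IsClosed C ∧
      π '' (R.inPart J (translate O γ) ∩ Subtype.val ⁻¹' Eᶜ) =
        C ∩ π '' R.inPart J (sweep G O) := by
  have hEJ : IsOpen {u : K.W J | (⟨J, u⟩ : K.Obj) ∈ E} := isOpen_sigma_iff.1 hE J
  -- The set `D` is the swept set minus the part of the branch outside `E`. A class avoids that part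
  -- exactly when it lies in the core of `D`, so the required closed set is the complement of the
  -- image of that open core.
  obtain ⟨D, hDdef⟩ : ∃ D : Set (K.W J), D = (⋃ γ' : G, ⋃ _ : γ' ≠ γ, translate O γ') ∪
    (translate O γ ∩ {u | (⟨J, u⟩ : K.Obj) ∈ E}) := ⟨_, rfl⟩
  have hD : IsOpen D := by
    rw [hDdef]
    exact (isOpen_iUnion fun γ' => isOpen_iUnion fun _ => h.isOpen_translate γ').union
      ((h.isOpen_translate γ).inter hEJ)
  have hDT : D ⊆ sweep G O := by
    rw [hDdef]
    exact union_subset (iUnion_subset fun γ' => iUnion_subset fun _ =>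
      subset_iUnion (translate O) γ') (inter_subset_left.trans (subset_iUnion (translate O) γ))
  have hDne : ∀ γ', γ' ≠ γ → translate O γ' ⊆ D := fun γ' hne u hu => by
    rw [hDdef]
    exact .inl (mem_iUnion₂.2 ⟨γ', hne, hu⟩)
  have hDE : ∀ u ∈ translate O γ, (⟨J, u⟩ : K.Obj) ∈ E → u ∈ D := fun u hu hE' => by
    rw [hDdef]
    exact .inr ⟨hu, hE'⟩
  have hDγ : ∀ u ∈ translate O γ, u ∈ D → (⟨J, u⟩ : K.Obj) ∈ E := by
    rw [hDdef]
    rintro u hu (hu' | hu')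
    · obtain ⟨γ', hne, hγ'⟩ := mem_iUnion₂.1 hu'
      exact absurd (h.eq_of_mem hγ' hu) hne
    · exact hu'.2
  clear hDdef
  have hcore : IsOpen (π '' R.inPart J (R.core D)) := hπ.isOpen_image_inPart (isOpen_core hD)
    ((core_subset D).trans (hDT.trans h.sweep_subset)) (saturated_core D)
  refine ⟨(π '' R.inPart J (R.core D))ᶜ, hcore.isClosed_compl, ?_⟩
  ext p
  constructor
  · rintro ⟨y, ⟨hy, hcE⟩, rfl⟩
    obtain ⟨c, hcB, hc, rfl⟩ := mem_inPart.1 hy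
    refine ⟨fun hp => hcE ?_, mem_image_inPart.2 ⟨c, mem_iUnion.2 ⟨γ, hcB⟩, hc, rfl⟩⟩
    obtain ⟨b, hbD, hb, hπb⟩ := mem_image_inPart.1 hp
    obtain ⟨δ, hδ, rfl⟩ := (hπ.eq_iff_same hb hc).1 hπb
    exact hDγ _ hcB (hbD δ hδ)
  · rintro ⟨hp, hpT⟩
    obtain ⟨u, huT, hu, rfl⟩ := mem_image_inPart.1 hpT
    have hucore : u ∉ R.core D := fun hu' => hp (mem_image_inPart.2 ⟨u, hu', hu, rfl⟩)
    simp only [core, mem_ofPred_eq, not_forall] at hucore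
    -- An equivalent point lies in the swept set but not in `D`: it must be on the branch `γ` and
    -- outside `E`.
    obtain ⟨δ, hδ, hδu⟩ := hucore
    have hδT := h.saturated_sweep u huT δ hδ
    obtain ⟨γ', hγ'⟩ := mem_iUnion.1 hδT
    have hγγ' : γ' = γ := by
      by_contra hne
      exact hδu (hDne γ' hne hγ')
    rw [hγγ'] at hγ'
    have hδuV : (⟨J, δ • u⟩ : K.Obj) ∈ R.objV := h.sweep_subset hδT
    exact ⟨⟨⟨J, δ • u⟩, hδuV⟩, ⟨⟨_, hγ', rfl⟩, fun hE' => hδu (hDE _ hγ' hE')⟩,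
      ((hπ.eq_iff_same hu hδuV).2 ⟨δ, hδ, rfl⟩).symm⟩

/-- Onto the open image of all branches, the projection of one branch is continuous, closed by
`exists_isClosed`, and injective since equivalent points of a branch coincide. -/
lemma isEmbedding (h : R.IsSlice G O) (hπ : IsRealization π) (γ : G) :
    IsEmbedding ((R.inPart J (translate O γ)).domRestrict π) := by
  have hmaps : ∀ y : R.inPart J (translate O γ), π y.1 ∈ π '' R.inPart J (sweep G O) := by
    rintro ⟨y, hy⟩
    obtain ⟨u, huB, hu, rfl⟩ := mem_inPart.1 hy
    exact mem_image_inPart.2 ⟨u, mem_iUnion.2 ⟨γ, huB⟩, hu, rfl⟩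
  have hce : IsClosedEmbedding fun y : R.inPart J (translate O γ) =>
      (⟨π y.1, hmaps y⟩ : π '' R.inPart J (sweep G O)) := by
    refine .of_continuous_injective_isClosedMap
      ((hπ.isQuotientMap.continuous.comp continuous_subtype_val).subtype_mk _) ?_ ?_
    · rintro ⟨y, hy⟩ ⟨y', hy'⟩ heq
      obtain ⟨u, huB, hu, rfl⟩ := mem_inPart.1 hy
      obtain ⟨u', huB', hu', rfl⟩ := mem_inPart.1 hy'
      obtain rfl := h.eq_of_π_eq hπ hu hu' huB huB' (congrArg Subtype.val heq)
      rfl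
    · intro C hC
      obtain ⟨C', hC', rfl⟩ := isClosed_induced_iff.1 hC
      obtain ⟨C'', hC'', rfl⟩ := isClosed_induced_iff.1 hC'
      obtain ⟨D, hD, hD'⟩ := h.exists_isClosed hπ γ C''ᶜ hC''.isOpen_compl
      convert hD.preimage continuous_subtype_val using 1
      ext ⟨p, hp⟩
      have h' := Set.ext_iff.1 hD' p
      rw [compl_compl] at h'
      constructor
      · rintro ⟨y, hy, hyp⟩
        exact (h'.1 ⟨y.1, ⟨y.2, hy⟩, congrArg Subtype.val hyp⟩).1
      · intro hpD
        obtain ⟨y, hy, hyp⟩ := h'.2 ⟨hpD, hp⟩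
        exact ⟨⟨y, hy.1⟩, hy.2, Subtype.ext hyp⟩
  exact IsEmbedding.subtypeVal.comp hce.isEmbedding

/-- Each representative in `V_J` lies on exactly one branch, and a branch contains at most one
representative. -/
lemma ncard_fibre (h : R.IsSlice G O) (hπ : IsRealization π) {p : Z}
    (hp : p ∈ π '' R.inPart J (sweep G O)) : (R.fibre π J p).ncard =
      ({γ | p ∈ π '' R.inPart J (translate O γ)} : Set G).ncard := by
  have hmem : ∀ u ∈ R.fibre π J p, ∃ γ : G, u ∈ translate O γ := by
    rintro u ⟨hu, rfl⟩
    exact mem_iUnion.1 (h.mem_sweep hπ hu hp)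
  choose c hc using hmem
  refine Set.ncard_congr c ?_ ?_ ?_
  · intro u hu
    exact mem_image_inPart.2 ⟨u, hc u hu, hu.1, hu.2⟩
  · rintro u u' hu hu' heq
    exact h.eq_of_π_eq hπ hu.1 hu'.1 (hc u hu) (heq ▸ hc u' hu') (hu.2.trans hu'.2.symm)
  · intro γ hγ
    obtain ⟨u, huB, hu, hp⟩ := mem_image_inPart.1 hγ
    exact ⟨u, ⟨hu, hp⟩, h.eq_of_mem (hc u ⟨hu, hp⟩) huB⟩

end IsSlice

namespace IsRealization

variable {Z : Type*} [TopologicalSpace Z] {π : R.objV → Z}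

lemma fibre_eq (hπ : IsRealization π) {J : K.Index} {x : K.W J}
    (hx : (⟨J, x⟩ : K.Obj) ∈ R.objV) : R.fibre π J (π ⟨⟨J, x⟩, hx⟩) =
      {x' | ∃ γ : ProdGroup K.Γ J.1, γ.TrivialOn (R.low (K.ψ J x)).1 ∧ γ • x = x'} := by
  ext x'
  constructor
  · rintro ⟨hx', h⟩
    exact (hπ.eq_iff_same hx hx').1 h.symm
  · rintro ⟨γ, hγ, rfl⟩
    have hx' : (⟨J, γ • x⟩ : K.Obj) ∈ R.objV := by
      rw [mem_objV]
      change K.ψ J (γ • x) ∈ R.Q J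
      rw [K.ψ_smul]
      exact hx
    exact ⟨hx', ((hπ.eq_iff_same hx hx').2 ⟨γ, hγ, rfl⟩).symm⟩

/-- The local branches of the realization. -/
lemma exists_branches [T2Space Y] (hπ : IsRealization π) {J : K.Index} {x : K.W J}
    (hx : (⟨J, x⟩ : K.Obj) ∈ R.objV) :
    ∃ (N : Set Z) (U : ProdGroup.trivialOnSubgroup K.Γ (R.low (K.ψ J x)).1 J.1 → Set R.objV),
      IsOpen N ∧ π ⟨⟨J, x⟩, hx⟩ ∈ N ∧ (∀ γ, IsOpen (U γ)) ∧ (∀ γ, U γ ⊆ π ⁻¹' N) ∧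
      (∀ γ γ', γ ≠ γ' → Disjoint (U γ) (U γ')) ∧
      (∀ y, π y ∈ N → ∃ γ, ∃ y' ∈ U γ, ∃ f ∈ R.morV, src f = y.1 ∧ tgt f = y'.1) ∧
      (∀ γ, IsEmbedding ((U γ).domRestrict π)) ∧ (∀ γ, ∃ C, IsClosed C ∧ π '' U γ = C ∩ N) ∧
      ∀ p ∈ N, p ∈ π '' R.part J ∧ (R.fibre π J p).ncard = {γ | p ∈ π '' U γ}.ncard := by
  obtain ⟨O, hxO, hO⟩ := exists_isSlice (R := R) hx
  set G := ProdGroup.trivialOnSubgroup K.Γ (R.low (K.ψ J x)).1 J.1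
  refine ⟨π '' R.inPart J (sweep G O), fun γ => R.inPart J (translate O γ), hO.isOpen_image hπ, ?_,
    fun γ => isOpen_inPart (hO.isOpen_translate γ), ?_, ?_, ?_, hO.isEmbedding hπ, ?_, ?_⟩
  · refine mem_image_inPart.2 ⟨x, mem_iUnion.2 ⟨1, ?_⟩, hx, rfl⟩
    change ((1 : G).1)⁻¹ • x ∈ O
    simpa using hxO
  · rintro γ ⟨_, hu⟩ ⟨u, huB, rfl⟩
    exact mem_image_inPart.2 ⟨u, mem_iUnion.2 ⟨γ, huB⟩, hu, rfl⟩
  · intro γ γ' hne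
    rw [Set.disjoint_left]
    rintro ⟨_, hu⟩ ⟨u, huB, rfl⟩ ⟨u', huB', h⟩
    obtain rfl : u' = u := eq_of_heq (Sigma.mk.inj h).2
    exact hne (hO.eq_of_mem huB huB')
  · intro y hy
    have hyJ : K.footprintMap y.1 ∈ R.Q J := by
      obtain ⟨t, htT, ht, h⟩ := mem_image_inPart.1 hy
      rw [← ((hπ.eq_iff _ _).1 h).footprintMap_eq]
      exact ht
    obtain ⟨u, hu, hπu, -, f, hf, hs, ht⟩ := hπ.exists_rep y hyJ
    obtain ⟨γ, hγ⟩ := mem_iUnion.1 (hO.mem_sweep hπ hu (hπu ▸ hy))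
    exact ⟨γ, ⟨⟨J, u⟩, hu⟩, ⟨u, hγ, rfl⟩, f, hf, hs, ht⟩
  · intro γ
    obtain ⟨C, hC, h⟩ := hO.exists_isClosed hπ γ ∅ isOpen_empty
    rw [compl_empty, preimage_univ, inter_univ] at h
    exact ⟨C, hC, h⟩
  · intro p hp
    refine ⟨?_, hO.ncard_fibre hπ hp⟩
    obtain ⟨u, huT, hu, rfl⟩ := mem_image_inPart.1 hp
    exact ⟨⟨⟨J, u⟩, hu⟩, rfl, rfl⟩

end IsRealization

end OrbifoldAtlas.Reduction

/-! ### Orders of stabilizers -/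

namespace ProdGroup

variable {A : Type uA} [DecidableEq A] {Γ : A → Type uG} [∀ i, Group (Γ i)] {I : Finset A}

lemma tr_eq_one_iff {J : Finset A} (h : I ⊆ J) (γ : ProdGroup Γ J) :
    γ.tr I = 1 ↔ γ.TrivialOn I := by
  constructor
  · intro h1 j hj
    simpa [tr_apply] using congrFun h1 ⟨j.1, hj⟩
  · intro h1
    funext i
    simpa [tr_apply, h i.2] using h1 ⟨i.1, h i.2⟩ i.2

lemma card_trivialOnSubgroup_mul {J : Finset A} (h : I ⊆ J) :
    Nat.card (trivialOnSubgroup Γ I J) * Nat.card (ProdGroup Γ I) = Nat.card (ProdGroup Γ J) := by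
  let f : ProdGroup Γ J →* ProdGroup Γ I := MonoidHom.mk' (fun γ => γ.tr I) (tr_mul I)
  have hker : f.ker = trivialOnSubgroup Γ I J := Subgroup.ext fun γ => tr_eq_one_iff h γ
  have hsurj : Function.Surjective f := fun γ => ⟨γ.tr J, by
    change (γ.tr J).tr I = γ
    rw [tr_tr _ fun a ha _ => h ha, tr_self]⟩
  rw [← hker, ← Subgroup.card_mul_index f.ker, Subgroup.index_ker,
    MonoidHom.range_eq_top.2 hsurj, Subgroup.card_top]

end ProdGroup

namespace OrbifoldAtlas

variable {d : ℕ} {A : Type uA} [DecidableEq A] {Y : Type uY} [TopologicalSpace Y]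
  {K : OrbifoldAtlas.{uA, uY, uG, uW} d A Y}

lemma exists_common_chart {I J : K.Index} (x : K.W I) (h : ∀ a ∈ J.1, K.ψ I x ∈ K.F a) :
    ∃ (U : K.Index) (hI : I ≤ U) (_ : J ≤ U) (z : K.W U), K.ρ hI z = x := by
  have hF : ∀ a ∈ I.1 ∪ J.1, K.ψ I x ∈ K.F a := fun a ha =>
    (Finset.mem_union.1 ha).elim (ψ_mem_F I x) (h a)
  let U : K.Index := ⟨I.1 ∪ J.1, I.2.1.mono Finset.subset_union_left, K.ψ I x, by
    simpa using fun a ha => hF a (Finset.mem_union.2 ha)⟩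
  have hI : I ≤ U := Finset.subset_union_left (s₁ := I.1) (s₂ := J.1)
  obtain ⟨z, hz⟩ := exists_ρ_eq hI x hF
  exact ⟨U, hI, Finset.subset_union_right (s₁ := I.1) (s₂ := J.1), z, hz⟩

/-- The projection `Γ_J → Γ_I` is a bijection of stabilizers: it is injective since `Γ_{J ∖ I}` acts
freely, and surjective since the fibres of `ρ` are `Γ_{J ∖ I}`-orbits. -/
lemma card_stabilizer_ρ {I J : K.Index} (h : I ≤ J) (z : K.W J) :
    Nat.card (MulAction.stabilizer (ProdGroup K.Γ I.1) (K.ρ h z)) =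
      Nat.card (MulAction.stabilizer (ProdGroup K.Γ J.1) z) := by
  have hmem : ∀ γ : MulAction.stabilizer (ProdGroup K.Γ J.1) z,
      γ.1.tr I.1 ∈ MulAction.stabilizer (ProdGroup K.Γ I.1) (K.ρ h z) := fun γ => by
    have := γ.2
    rw [MulAction.mem_stabilizer_iff] at this ⊢
    rw [← K.equivariant_ρ, this]
  refine (Nat.card_congr (Equiv.ofBijective (fun γ => ⟨_, hmem γ⟩) ⟨?_, ?_⟩)).symm
  · intro γ γ' hγ
    have h1 : γ.1.tr I.1 = γ'.1.tr I.1 := congrArg Subtype.val hγ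
    have h2 : (γ'.1⁻¹ * γ.1).TrivialOn I.1 := by
      rw [← ProdGroup.tr_eq_one_iff h, ProdGroup.tr_mul, ProdGroup.tr_inv, h1, inv_mul_cancel]
    exact Subtype.ext (inv_mul_eq_one.1 (K.free_of_trivialOn h _ h2 z (γ'⁻¹ * γ).2)).symm
  · rintro ⟨δ, hδ⟩
    rw [MulAction.mem_stabilizer_iff] at hδ
    have hδ' : (δ.tr J.1).tr I.1 = δ := by
      rw [ProdGroup.tr_tr _ fun a ha _ => h ha, ProdGroup.tr_self]
    obtain ⟨β, hβ, hβz⟩ := (K.ρ_eq_iff h (δ.tr J.1 • z) z).1 (by rw [K.equivariant_ρ, hδ', hδ])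
    refine ⟨⟨β * δ.tr J.1, ?_⟩, Subtype.ext ?_⟩
    · rw [MulAction.mem_stabilizer_iff, mul_smul, hβz]
    · change (β * δ.tr J.1).tr I.1 = δ
      rw [ProdGroup.tr_mul, hδ', (ProdGroup.tr_eq_one_iff h β).2 hβ, one_mul]

/-- After passing to a common chart both points are images of points in one orbit, whose stabilizers
are conjugate. -/
lemma card_stabilizer_eq {I J : K.Index} {x : K.W I} {y : K.W J} (h : K.ψ I x = K.ψ J y) :
    Nat.card (MulAction.stabilizer (ProdGroup K.Γ I.1) x) =
      Nat.card (MulAction.stabilizer (ProdGroup K.Γ J.1) y) := by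
  obtain ⟨U, hI, hJ, z, rfl⟩ := exists_common_chart x fun a (ha : a ∈ J.1) => h ▸ ψ_mem_F J y ha
  rw [K.ψ_ρ, ← K.ψ_ρ hJ] at h
  obtain ⟨γ, rfl⟩ := (ψ_eq_iff _ _).1 h
  rw [card_stabilizer_ρ, ← card_stabilizer_ρ hJ]
  exact Nat.card_congr (MulAction.stabilizerEquivStabilizer (a := K.ρ hJ z) (g := γ) rfl).toEquiv

/-- The isotropy group of `x ∈ W_I` in the groupoid completion has the order of the stabilizer of
`x` in `Γ_I`. -/
lemma weight_mk (I : K.Index) (x : K.W I) : weight (⟨I, x⟩ : K.Obj) =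
    1 / (Nat.card (MulAction.stabilizer (ProdGroup K.Γ I.1) x) : ℚ) := by
  let F : MulAction.stabilizer (ProdGroup K.Γ I.1) x → K.Mor := fun γ =>
    let m : K.MorIndex := ⟨I, I, by simpa using I.2.2, γ.1.tr _⟩
    ⟨m, K.ρ (I := m.union) (J := I) (Finset.union_subset subset_rfl subset_rfl) x⟩
  have htr : ∀ γ : ProdGroup K.Γ I.1, (γ.tr (I.1 ∩ I.1)).tr I.1 = γ := fun γ => by
    rw [ProdGroup.tr_tr _ (by simp), ProdGroup.tr_self]
  have htgt : ∀ γ, tgt (F γ) = ⟨I, x⟩ := fun γ =>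
    congrArg (Sigma.mk I) ((K.ρ_ρ _ _ _).trans (K.ρ_self _ _))
  have hsrc : ∀ γ, src (F γ) = ⟨I, x⟩ := fun γ => by
    have key : ∀ {U : K.Index} (h : I ≤ U) (h' : U ≤ I) (δ : ProdGroup K.Γ I.1), δ = γ.1 →
        δ⁻¹ • K.ρ h (K.ρ h' x) = x := by
      rintro U h h' _ rfl
      rw [K.ρ_ρ, K.ρ_self]
      exact (γ⁻¹).2
    exact congrArg (Sigma.mk I) (key _ _ _ (htr _))
  have hcard := Nat.card_congr (Equiv.ofBijective
    (β := {f : K.Mor // src f = ⟨I, x⟩ ∧ tgt f = ⟨I, x⟩})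
    (fun γ => ⟨F γ, hsrc γ, htgt γ⟩) ⟨?_, ?_⟩)
  · rw [weight, hcard]
  · intro γ γ' h
    have h1 : (F γ).1.γ.tr I.1 = (F γ').1.γ.tr I.1 :=
      congrArg (fun f : {f : K.Mor // src f = ⟨I, x⟩ ∧ tgt f = ⟨I, x⟩} =>
        (f.1.1.γ.tr I.1 : ProdGroup K.Γ I.1)) h
    exact Subtype.ext ((htr _).symm.trans (h1.trans (htr _)))
  · rintro ⟨⟨⟨i, j, hn, γ⟩, z⟩, hs, ht⟩
    obtain rfl : i = I := congrArg Sigma.fst hs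
    obtain rfl : j = i := congrArg Sigma.fst ht
    have hs' : (γ.tr j.1)⁻¹ • K.ρ (MorIndex.le_i ⟨j, j, hn, γ⟩) z = x :=
      eq_of_heq (Sigma.mk.inj hs).2
    have ht' : K.ρ (MorIndex.le_j ⟨j, j, hn, γ⟩) z = x := eq_of_heq (Sigma.mk.inj ht).2
    rw [ht', inv_smul_eq_iff] at hs'
    refine ⟨⟨γ.tr j.1, hs'.symm⟩, Subtype.ext ?_⟩
    have key : ∀ (γ' : ProdGroup K.Γ (j.1 ∩ j.1)) (hU : MorIndex.union ⟨j, j, hn, γ'⟩ ≤ j),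
        γ' = γ → (⟨⟨j, j, hn, γ'⟩, K.ρ hU x⟩ : K.Mor) = ⟨⟨j, j, hn, γ⟩, z⟩ := by
      rintro _ hU rfl
      refine congrArg (Sigma.mk _) ?_
      rw [← ht', K.ρ_ρ, K.ρ_self]
    exact key _ _ (by rw [ProdGroup.tr_tr _ (by simp), ProdGroup.tr_self])

lemma setOf_ψ_eq {J : K.Index} (u : K.W J) :
    {v | K.ψ J v = K.ψ J u} = MulAction.orbit (ProdGroup K.Γ J.1) u := by
  ext v
  exact eq_comm.trans (ψ_eq_iff u v)

lemma finite_setOf_ψ_eq {J : K.Index} (u : K.W J) : {v | K.ψ J v = K.ψ J u}.Finite := by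
  rw [setOf_ψ_eq]
  exact finite_range _

/-- The number of points of `W_J` over a point of `Y`, divided by the order of `Γ_J`. -/
lemma ncard_setOf_ψ_eq_div {J : K.Index} (u : K.W J) {x : K.Obj}
    (h : K.footprintMap x = K.ψ J u) :
    ({v | K.ψ J v = K.ψ J u}.ncard : ℚ) / (Nat.card (ProdGroup K.Γ J.1) : ℚ) = weight x := by
  obtain ⟨I, x⟩ := x
  rw [weight_mk, card_stabilizer_eq h, setOf_ψ_eq, ← MulAction.index_stabilizer,
    ← Subgroup.card_mul_index (MulAction.stabilizer (ProdGroup K.Γ J.1) u)]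
  have h1 : (Nat.card (MulAction.stabilizer (ProdGroup K.Γ J.1) u) : ℚ) ≠ 0 := by
    exact_mod_cast Nat.card_pos.ne'
  have h2 : ((MulAction.stabilizer (ProdGroup K.Γ J.1) u).index : ℚ) ≠ 0 := by
    exact_mod_cast Subgroup.index_ne_zero_of_finite
  push_cast
  field_simp

end OrbifoldAtlas

lemma TopologicalGroupoid.continuous_projH {O M : Type*} [TopologicalSpace O] [TopologicalSpace M]
    (𝒢 : TopologicalGroupoid O M) : Continuous 𝒢.projH :=
  (T2Quotient.continuous_mk _).comp continuous_quotient_mk'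

/-! ### The weighting function -/

namespace OrbifoldAtlas.Reduction

variable {d : ℕ} {A : Type uA} [DecidableEq A] {Y : Type uY} [TopologicalSpace Y]
  {K : OrbifoldAtlas.{uA, uY, uG, uW} d A Y} [Finite A] {R : K.Reduction}

namespace IsRealization

variable {Z : Type*} [TopologicalSpace Z] {π : R.objV → Z}

lemma finite_fibre (hπ : IsRealization π) {J : K.Index} {x : K.W J}
    (hx : (⟨J, x⟩ : K.Obj) ∈ R.objV) : (R.fibre π J (π ⟨⟨J, x⟩, hx⟩)).Finite := by
  rw [hπ.fibre_eq hx]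
  exact (finite_range fun γ : ProdGroup K.Γ J.1 => γ • x).subset
    fun _ ⟨γ, _, h⟩ => ⟨γ, h⟩

lemma ncard_fibre (hπ : IsRealization π) {J : K.Index} {x : K.W J}
    (hx : (⟨J, x⟩ : K.Obj) ∈ R.objV) : (R.fibre π J (π ⟨⟨J, x⟩, hx⟩)).ncard =
      Nat.card (ProdGroup.trivialOnSubgroup K.Γ (R.low (K.ψ J x)).1 J.1) := by
  have h : R.fibre π J (π ⟨⟨J, x⟩, hx⟩) =
      range fun γ : ProdGroup.trivialOnSubgroup K.Γ (R.low (K.ψ J x)).1 J.1 => γ.1 • x := by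
    rw [hπ.fibre_eq hx]
    ext x'
    exact ⟨fun ⟨γ, hγ, h⟩ => ⟨⟨γ, hγ⟩, h⟩, fun ⟨γ, h⟩ => ⟨γ.1, γ.2, h⟩⟩
  rw [h, ← Nat.card_coe_set_eq]
  refine Nat.card_congr (Equiv.ofInjective _ fun γ γ' hγ => ?_).symm
  have hγ' : γ.1 • x = γ'.1 • x := hγ
  have h1 := eq_one_of_smul_eq hx (γ := γ'.1⁻¹ * γ.1) (γ'⁻¹ * γ).2
    (by rw [mul_smul, hγ', inv_smul_smul])
  exact Subtype.ext (inv_mul_eq_one.1 h1).symm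

/-- The fibre has `|Γ_{J ∖ low}|` points and `|Γ_J| = |Γ_{J ∖ low}| |Γ_low|`. The quotient depends
on the footprint only, which makes the weighting function independent of `J`. -/
lemma ncard_fibre_div (hπ : IsRealization π) {J : K.Index} {x : K.W J}
    (hx : (⟨J, x⟩ : K.Obj) ∈ R.objV) :
    ((R.fibre π J (π ⟨⟨J, x⟩, hx⟩)).ncard : ℚ) / (Nat.card (ProdGroup K.Γ J.1) : ℚ) =
      1 / (Nat.card (ProdGroup K.Γ (R.low (K.ψ J x)).1) : ℚ) := by
  rw [hπ.ncard_fibre hx, ← ProdGroup.card_trivialOnSubgroup_mul (low_le' hx)]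
  have h1 : (Nat.card (ProdGroup.trivialOnSubgroup K.Γ (R.low (K.ψ J x)).1 J.1) : ℚ) ≠ 0 := by
    exact_mod_cast Nat.card_pos.ne'
  have h2 : (Nat.card (ProdGroup K.Γ (R.low (K.ψ J x)).1) : ℚ) ≠ 0 := by
    exact_mod_cast Nat.card_pos.ne'
  push_cast
  field_simp

/-- Being in `closure (Q (low q))`, the footprint can be moved into `Q (low q)` by moving `x`
slightly in `V_J`, and the moved point is represented in `V_low`. Minimality follows by mapping
closures to `Y`. -/
lemma isLeast_low (hπ : IsRealization π) {J : K.Index} {x : K.W J}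
    (hx : (⟨J, x⟩ : K.Obj) ∈ R.objV) :
    IsLeast {I | I ≤ J ∧ π ⟨⟨J, x⟩, hx⟩ ∈ closure (π '' R.part I)} (R.low (K.ψ J x)) := by
  refine ⟨⟨low_le' hx, mem_closure_iff.2 fun N hN hxN => ?_⟩, ?_⟩
  · have hO : IsOpen (Sigma.mk J ⁻¹' (Subtype.val '' (π ⁻¹' N)) : Set (K.W J)) :=
      ((R.objV.isOpen.isOpenMap_subtype_val _ (hN.preimage hπ.isQuotientMap.continuous))).preimage
        continuous_sigmaMk
    obtain ⟨_, ⟨u, ⟨⟨_, hu⟩, huN, rfl⟩, rfl⟩, hq⟩ := mem_closure_iff.1 (R.mem_closure_low (K.ψ J x)) _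
      (isOpenMap_ψ J _ hO) ⟨x, ⟨_, hxN, rfl⟩, rfl⟩
    obtain ⟨v, hv, hπv, -⟩ := hπ.exists_rep ⟨⟨J, u⟩, hu⟩ hq
    exact ⟨_, huN, ⟨⟨_, v⟩, hv⟩, rfl, hπv⟩
  · rintro I ⟨-, hI⟩
    obtain ⟨φ, hφ, hφπ⟩ := hπ.exists_continuous_footprint
    have h := map_mem_closure (t := R.Q I) hφ hI ?_
    · rw [hφπ] at h
      exact low_le h
    · rintro _ ⟨⟨⟨_, v⟩, hv⟩, rfl, rfl⟩
      rw [hφπ]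
      exact hv

open Classical in
/-- The pushforward to `Y` of a weighting function on the realization. -/
lemma pushforwardWeight_eq (hπ : IsRealization π) {φ : Z → Y}
    (hφ : ∀ x, φ (π x) = K.footprintMap x.1) {Λ : Z → ℚ}
    (hΛ : ∀ (J : K.Index), ∀ p ∈ π '' R.part J,
      Λ p = ((R.fibre π J p).ncard : ℚ) / (Nat.card (ProdGroup K.Γ J.1) : ℚ)) (x : K.Obj) :
    (φ ⁻¹' {K.footprintMap x}).Finite ∧
      pushforwardWeight φ Λ (K.footprintMap x) = weight x := by
  obtain ⟨J, hJ⟩ := mem_iUnion.1 (R.cover ▸ mem_univ (K.footprintMap x))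
  obtain ⟨u₀, hu₀⟩ : ∃ u : K.W J, K.footprintMap x = K.ψ J u := by
    obtain ⟨I, x⟩ := x
    have hF := R.closure_subset J (subset_closure hJ)
    simp only [mem_iInter] at hF
    obtain ⟨U, hI, hJU, z, rfl⟩ := exists_common_chart x hF
    exact ⟨K.ρ hJU z, (K.ψ_ρ _ _).trans (K.ψ_ρ _ _).symm⟩
  have hfin := finite_setOf_ψ_eq u₀
  have hV : ∀ u : K.W J, K.ψ J u = K.ψ J u₀ → (⟨J, u⟩ : K.Obj) ∈ R.objV := fun u hu => by
    rw [mem_objV]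
    change K.ψ J u ∈ R.Q J
    rw [hu, ← hu₀]
    exact hJ
  -- The default value never matters: every point of `W_J` over the given point of `Y` lies in
  -- `V_J`.
  let f : K.W J → Z := fun u =>
    if hu : (⟨J, u⟩ : K.Obj) ∈ R.objV then π ⟨⟨J, u⟩, hu⟩ else π ⟨⟨J, u₀⟩, hV u₀ rfl⟩
  have hf : ∀ u (hu : (⟨J, u⟩ : K.Obj) ∈ R.objV), f u = π ⟨⟨J, u⟩, hu⟩ := fun u hu => dif_pos hu
  have himage : φ ⁻¹' {K.footprintMap x} = f '' {u | K.ψ J u = K.ψ J u₀} := by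
    ext p
    constructor
    · intro hp
      obtain ⟨y, rfl⟩ := hπ.isQuotientMap.surjective p
      rw [mem_preimage, hφ, mem_singleton_iff] at hp
      obtain ⟨u, hu, hπu, hψ, -⟩ := hπ.exists_rep y (hp.symm ▸ hJ)
      exact ⟨u, hψ.trans (hp.trans hu₀), (hf u hu).trans hπu⟩
    · rintro ⟨u, hu, rfl⟩
      rw [mem_preimage, hf u (hV u hu), hφ, hu₀]
      exact hu
  have hS : (φ ⁻¹' {K.footprintMap x}).Finite := himage ▸ hfin.image f
  refine ⟨hS, ?_⟩
  have hmem : ∀ p, p ∈ hS.toFinset ↔ p ∈ f '' {u | K.ψ J u = K.ψ J u₀} := fun p => by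
    rw [hS.mem_toFinset, himage]
  have hfibre : ∀ p ∈ hS.toFinset, (R.fibre π J p).ncard =
      (hfin.toFinset.filter fun u => f u = p).card := fun p hp => by
    rw [← Set.ncard_coe_finset]
    congr 1
    ext u
    rw [Finset.mem_coe, Finset.mem_filter, hfin.mem_toFinset]
    constructor
    · rintro ⟨hu, rfl⟩
      rw [hS.mem_toFinset, mem_preimage, hφ, mem_singleton_iff] at hp
      exact ⟨hp.trans hu₀, hf u hu⟩
    · rintro ⟨hu, rfl⟩
      exact ⟨hV u hu, (hf u _).symm⟩
  have hpart : ∀ p ∈ hS.toFinset, p ∈ π '' R.part J := fun p hp => by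
    obtain ⟨u, hu, rfl⟩ := (hmem p).1 hp
    exact ⟨⟨⟨J, u⟩, hV u hu⟩, rfl, (hf u _).symm⟩
  -- With the common denominator `|Γ_J|` taken out, the fibre counts add up to the number of points
  -- of `W_J` over the given point.
  rw [pushforwardWeight, finsum_mem_eq_finite_toFinset_sum _ hS,
    Finset.sum_congr rfl fun p hp => hΛ J p (hpart p hp), ← Finset.sum_div,
    ← ncard_setOf_ψ_eq_div u₀ hu₀, Set.ncard_eq_toFinset_card _ hfin,
    Finset.card_eq_sum_card_fiberwise (f := f) (t := hS.toFinset)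
      fun u hu => (hmem _).2 ⟨u, hfin.mem_toFinset.1 hu, rfl⟩, Nat.cast_sum]
  congr 1
  exact Finset.sum_congr rfl fun p hp => congrArg Nat.cast (hfibre p hp)

end IsRealization

/-! ### The maximal Hausdorff quotient -/

lemma isRealization_proj (R : K.Reduction) : IsRealization R.groupoidVH.proj where
  isQuotientMap := isQuotientMap_quotient_mk'
  eq_iff x y := by
    rw [TopologicalGroupoid.proj, TopologicalGroupoid.proj, Quotient.eq]
    constructor
    · rintro ⟨f, rfl, rfl⟩
      exact ⟨f.1, f.2, rfl, rfl⟩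
    · rintro ⟨f, hf, hs, ht⟩
      exact ⟨⟨f, hf⟩, Subtype.ext hs, Subtype.ext ht⟩

/-- In a Hausdorff space, having endpoints with equal image is a closed condition on morphisms of
`G_V`, so it passes from `V_K` to the closure. -/
lemma projH_eq_of_mem_morVH {f : K.Mor} (hf : f ∈ R.morVH) :
    R.topGroupoidV.projH ⟨src f, hf.2.1⟩ = R.topGroupoidV.projH ⟨tgt f, hf.2.2⟩ := by
  have hc := R.topGroupoidV.continuous_projH
  let S : Set R.morGV := {f | R.topGroupoidV.projH ⟨src f.1, f.2.1⟩ =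
    R.topGroupoidV.projH ⟨tgt f.1, f.2.2⟩}
  have hS : IsClosed S := isClosed_eq
    (hc.comp ((isEtale_src.continuous.comp continuous_subtype_val).subtype_mk _))
    (hc.comp ((isEtale_tgt.continuous.comp continuous_subtype_val).subtype_mk _))
  have hsub : (Subtype.val ⁻¹' (R.morV : Set K.Mor) : Set R.morGV) ⊆ S := fun g hg =>
    congrArg T2Quotient.mk (Quotient.sound ⟨⟨g.1, hg⟩, rfl, rfl⟩)
  refine closure_minimal hsub hS (a := ⟨f, hf.2⟩) (closure_subtype.2 ?_)
  rw [Subtype.image_preimage_coe, inter_eq_right.2 fun g hg => (morV_subset_morVH hg).2]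
  exact hf.1

/-- The realization of the closed groupoid is the maximal Hausdorff quotient of the realization
of `V_K`. -/
lemma exists_homeomorph [T2Space Y] (R : K.Reduction) :
    ∃ θ : R.topGroupoidV.HausdorffRealization ≃ₜ R.groupoidVH.Realization,
      ∀ x, θ (R.topGroupoidV.projH x) = R.groupoidVH.proj x := by
  have : T2Space R.groupoidVH.Realization := R.isRealization_proj.t2Space
  let f : R.topGroupoidV.Realization → R.groupoidVH.Realization :=
    Quotient.lift R.groupoidVH.proj (by
      rintro _ _ ⟨g, rfl, rfl⟩
      exact (R.isRealization_proj.eq_iff _ _).2 ⟨g.1, morV_subset_morVH g.2, rfl, rfl⟩)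
  have hf : Continuous f := R.isRealization_proj.isQuotientMap.continuous.quotient_lift _
  -- The inverse exists because the Hausdorff quotient already identifies the endpoints of the limit
  -- morphisms.
  let g : R.groupoidVH.Realization → R.topGroupoidV.HausdorffRealization :=
    Quotient.lift R.topGroupoidV.projH (by
      rintro _ _ ⟨g, rfl, rfl⟩
      exact projH_eq_of_mem_morVH g.2)
  have hg : Continuous g :=
    R.topGroupoidV.continuous_projH.quotient_lift _
  refine ⟨⟨⟨T2Quotient.lift hf, g, ?_, ?_⟩, T2Quotient.continuous_lift hf, hg⟩, fun x => rfl⟩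
  · intro p
    obtain ⟨⟨x⟩, rfl⟩ := T2Quotient.surjective_mk _ p
    rfl
  · rintro ⟨x⟩
    rfl

end OrbifoldAtlas.Reduction

/-! ### Weighted branched structure and the main theorem -/

namespace OrbifoldAtlas.Reduction

variable {d : ℕ} {A : Type uA} [DecidableEq A] {Y : Type uY} [TopologicalSpace Y] [T2Space Y]
  {K : OrientedOrbifoldAtlas.{uA, uY, uG, uW} d A Y} [Finite A] {R : K.Reduction}

open OrientedOrbifoldAtlas in
/-- The local branches of the realization make `V_K` a weighted nonsingular branched groupoid. -/
lemma isWnb_groupoidV (hπ : IsRealization (groupoidV R).projH)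
    {Λ : (groupoidV R).HausdorffRealization → ℚ} (hpos : ∀ p, 0 < Λ p)
    (hΛ : ∀ (J : K.Index), ∀ p ∈ (groupoidV R).projH '' R.part J,
      Λ p = ((R.fibre (groupoidV R).projH J p).ncard : ℚ) /
        (Nat.card (ProdGroup K.Γ J.1) : ℚ)) :
    (groupoidV R).IsWnb Λ where
  nonsingular := nonsingular_topGroupoidV
  pos := hpos
  branches p := by
    classical
    obtain ⟨⟨⟨J, x⟩, hx⟩, rfl⟩ := hπ.isQuotientMap.surjective p
    obtain ⟨N, U, hN, hxN, hU, hUN, hdisj, hcover, hemb, hcl, hcard⟩ := hπ.exists_branches hx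
    let e := (Finite.equivFin (ProdGroup.trivialOnSubgroup K.Γ (R.low (K.ψ J x)).1 J.1)).symm
    refine ⟨N, hN, hxN, _, fun i => U (e i), fun _ => 1 / (Nat.card (ProdGroup K.Γ J.1) : ℚ),
      fun i => hU _, fun i => hUN _, fun i j hij => hdisj _ _ (e.injective.ne hij), fun _ => ?_,
      ?_, fun i => ⟨hemb _, hcl _⟩, fun q hq => ?_⟩
    · have : 0 < Nat.card (ProdGroup K.Γ J.1) := Nat.card_pos
      positivity
    · ext q
      obtain ⟨y, rfl⟩ := Quotient.mk_surjective q
      constructor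
      · intro hy
        obtain ⟨γ, y', hy', f, hf, hs, ht⟩ := hcover y hy
        refine mem_iUnion.2 ⟨e.symm γ, y', by
          change y' ∈ U (e (e.symm γ))
          rwa [e.apply_symm_apply], ?_⟩
        exact (Quotient.sound ⟨⟨f, hf⟩, Subtype.ext hs, Subtype.ext ht⟩ :
          (groupoidV R).proj y = (groupoidV R).proj y').symm
      · intro hy
        obtain ⟨i, y', hy', h⟩ := mem_iUnion.1 hy
        rw [mem_preimage, ← h]
        exact hUN _ hy'
    · obtain ⟨h1, h2⟩ := hcard q hq
      rw [hΛ J q h1, h2, Finset.sum_const, nsmul_eq_mul, mul_one_div]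
      congr 2
      -- All branches have the same weight, so the sum only counts the branches through `q`,
      -- reindexed from `G` to `Fin`.
      rw [← Set.ncard_coe_finset]
      refine Set.ncard_congr (fun γ _ => e.symm γ) ?_ (fun _ _ _ _ h => e.symm.injective h) ?_
      · intro γ hγ
        simpa using hγ
      · intro i hi
        exact ⟨e i, by simpa using hi, e.symm_apply_apply i⟩

end OrbifoldAtlas.Reduction

theorem proposition4p4 {A : Type uA} [Fintype A] [DecidableEq A] {Y : Type uY} [TopologicalSpace Y]
    [CompactSpace Y] [T2Space Y] {d : ℕ}
    (K : OrientedOrbifoldAtlas.{uA, uY, uG, uW} d A Y) (R : K.Reduction) :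
    ∃ (𝒱 : OrientedEtaleGroupoid d R.objV R.morV) (𝒱H : TopologicalGroupoid R.objV R.morVH),
      -- the groupoid `V_K` is well defined and nonsingular
      (OrbifoldAtlas.IsSubgroupoid 𝒱.toTopologicalGroupoid Subtype.val Subtype.val ∧
        𝒱.Nonsingular ∧
        PreservesOrientation 𝒱.orientObj K.orientObj Subtype.val) ∧
      -- the closed groupoid, sitting inside `G_V`, and an extension of `V_K`
      ((R.morV : Set K.Mor) ⊆ R.morVH ∧
        OrbifoldAtlas.IsSubgroupoid 𝒱H Subtype.val Subtype.val ∧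
        IsEtale d (OrbifoldAtlas.src : K.Mor → K.Obj) ∧
        IsEtale d (OrbifoldAtlas.tgt : K.Mor → K.Obj) ∧
        𝒱H.IsLocallyEmbedded) ∧
      -- its realization is the maximal Hausdorff quotient
      ∃ θ : 𝒱.HausdorffRealization ≃ₜ 𝒱H.Realization, (∀ x, θ (𝒱.projH x) = 𝒱H.proj x) ∧
      -- the weighting function
      ∃ Λ : 𝒱.HausdorffRealization → ℚ, 𝒱.IsWnb Λ ∧
        (∀ (J : K.Index), ∀ y ∈ 𝒱.projH '' R.part J,
          (R.fibre 𝒱.projH J y).Finite ∧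
          Λ y = ((R.fibre 𝒱.projH J y).ncard : ℚ) / (Nat.card (ProdGroup K.Γ J.1) : ℚ) ∧
          ∃ Iy : K.Index, IsLeast {I | I ≤ J ∧ y ∈ closure (𝒱.projH '' R.part I)} Iy ∧
            ∀ x ∈ R.fibre 𝒱.projH J y,
              R.fibre 𝒱.projH J y =
                {x' | ∃ γ : ProdGroup K.Γ J.1, γ.TrivialOn Iy.1 ∧ γ • x = x'} ∧
              ∀ γ : ProdGroup K.Γ J.1, γ.TrivialOn Iy.1 → γ • x = x → γ = 1) ∧
        -- the pushforward to `Y`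
        ∃ ι : 𝒱H.Realization → R.RealGV, Continuous ι ∧ (∀ x, ι (𝒱H.proj x) = R.projGV x) ∧
          ∀ x : K.Obj,
            ((fun p => R.realψ (ι (θ p))) ⁻¹' {K.footprintMap x}).Finite ∧
            pushforwardWeight (fun p => R.realψ (ι (θ p))) Λ (K.footprintMap x) =
              OrbifoldAtlas.weight x := by
  obtain ⟨θ, hθ⟩ : ∃ θ : (OrientedOrbifoldAtlas.groupoidV R).HausdorffRealization ≃ₜ
      R.groupoidVH.Realization,
      ∀ x, θ ((OrientedOrbifoldAtlas.groupoidV R).projH x) = R.groupoidVH.proj x :=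
    OrbifoldAtlas.Reduction.exists_homeomorph R
  -- Through `θ`, the projection to the Hausdorff quotient inherits everything known about the
  -- realization of the closed groupoid.
  have hπ : OrbifoldAtlas.Reduction.IsRealization (OrientedOrbifoldAtlas.groupoidV R).projH := by
    refine ⟨?_, fun x y => ?_⟩
    · have h : (OrientedOrbifoldAtlas.groupoidV R).projH = θ.symm ∘ R.groupoidVH.proj := by
        funext x
        exact θ.eq_symm_apply.2 (hθ x)
      rw [h]
      exact θ.symm.isQuotientMap.comp R.isRealization_proj.isQuotientMap
    · rw [← R.isRealization_proj.eq_iff, ← hθ, ← hθ, θ.injective.eq_iff]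
  obtain ⟨φ, -, hφ⟩ := hπ.exists_continuous_footprint
  -- The weight is written as `1 / |Γ_low|`, a form in which no chart has to be chosen.
  let Λ : (OrientedOrbifoldAtlas.groupoidV R).HausdorffRealization → ℚ := fun p =>
    1 / (Nat.card (ProdGroup K.Γ (R.low (φ p)).1) : ℚ)
  have hΛ : ∀ (J : K.Index), ∀ p ∈ (OrientedOrbifoldAtlas.groupoidV R).projH '' R.part J,
      Λ p = ((R.fibre (OrientedOrbifoldAtlas.groupoidV R).projH J p).ncard : ℚ) /
        (Nat.card (ProdGroup K.Γ J.1) : ℚ) := by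
    rintro J _ ⟨⟨⟨_, x⟩, hx⟩, rfl, rfl⟩
    rw [hπ.ncard_fibre_div hx]
    simp only [Λ, hφ]
    rfl
  let ι : R.groupoidVH.Realization → R.RealGV := Quotient.lift R.projGV (by
    rintro _ _ ⟨f, rfl, rfl⟩
    exact Quot.sound ⟨f.1, f.2.2, rfl, rfl⟩)
  have hι : ∀ x, R.realψ (ι (θ ((OrientedOrbifoldAtlas.groupoidV R).projH x))) =
      K.footprintMap x.1 := fun x => by
    rw [hθ]
    rfl
  refine ⟨OrientedOrbifoldAtlas.groupoidV R, R.groupoidVH,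
    ⟨OrbifoldAtlas.Reduction.isSubgroupoid_topGroupoidV,
      OrbifoldAtlas.Reduction.nonsingular_topGroupoidV,
      preservesOrientation_pullback _ (isEtale_subtypeVal R.objV)⟩,
    ⟨OrbifoldAtlas.Reduction.morV_subset_morVH, OrbifoldAtlas.Reduction.isSubgroupoid_subgroupoid,
      OrbifoldAtlas.isEtale_src, OrbifoldAtlas.isEtale_tgt,
      OrbifoldAtlas.Reduction.isLocallyEmbedded_subgroupoid⟩, θ, hθ, Λ,
    OrbifoldAtlas.Reduction.isWnb_groupoidV hπ (fun p => ?_) hΛ,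
    fun J y hy => ⟨?_, hΛ J y hy, ?_⟩, ι, ?_, fun x => rfl, hπ.pushforwardWeight_eq hι hΛ⟩
  · have : 0 < Nat.card (ProdGroup K.Γ (R.low (φ p)).1) := Nat.card_pos
    simp only [Λ]
    positivity
  · obtain ⟨⟨⟨_, x⟩, hx⟩, rfl, rfl⟩ := hy
    exact hπ.finite_fibre hx
  · obtain ⟨⟨⟨_, x⟩, hx⟩, rfl, rfl⟩ := hy
    refine ⟨_, hπ.isLeast_low hx, ?_⟩
    rintro x' ⟨hx', h⟩
    have hψ : K.ψ _ x' = K.ψ _ x := ((hπ.eq_iff _ _).1 h).footprintMap_eq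
    rw [← h, hπ.fibre_eq hx', hψ]
    exact ⟨rfl, fun γ hγ => OrbifoldAtlas.Reduction.eq_one_of_smul_eq hx' (hψ ▸ hγ)⟩
  · exact Continuous.quotient_lift continuous_quot_mk _
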